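/- Notation. Let $e(x)=\exp(2\pi i x)$ and, for $v\in\mathbb C$ and $n\ge 1$, $\tau_v(n)=\sum_{n_1n_2=n}(n_1/n_2)^v$. Let $J_\nu$ and $K_\nu$ denote the Bessel functions, let $\zeta$ be the Riemann zeta function, and put $$k_0(x,v)=\frac{J_{2v}(x)-J_{-2v}(x)}{2\cos(\pi(1/2+v))},\qquad k_1(x,v)=\frac2\pi\sin(\pi(1/2+v))\,K_{2v}(x)\qquad(x>0).$$ The Mellin transform of $\phi$ is $\hat\phi(z)=\int_0^\infty t^{z-1}\phi(t)\,dt$. Lemma (Kuznetsov). Let $\phi:[0,\infty)\to\mathbb C$ be continuous on $(0,\infty)$, and suppose that there are $\sigma_0<0$, $\sigma_1>1$ and $\epsilon>0$ such that 1. for $\sigma_0<\Re s<\sigma_1$ the integral defining $\hat\phi(2s)$ converges absolutely, and $\hat\phi(2s)$ is a holomorphic function of $s$ in this strip; 2. for every $\sigma$ with $\sigma_0<\sigma<\sigma_1$ the function $t\mapsto\bigl((1+|t|)^{1-2\sigma+\epsilon}+1\bigr)\,|\hat\phi(2\sigma+2it)|$ is integrable on $(-\infty,\infty)$. Let $v\in\mathbb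 C$ with $\Re v=0$, let $c,d\ge1$ be coprime integers, and let $d^*$ be an integer with $dd^*\equiv1\pmod c$. If $v\ne0$, then $$\frac{4\pi}{c}\sum_{n=1}^\infty\tau_v(n)\,e\!\left(\frac{nd}{c}\right)\phi\!\left(\frac{4\pi\sqrt n}{c}\right)=2\frac{\zeta(1+2v)}{(4\pi)^{1+2v}}\hat\phi(2+2v)+2\frac{\zeta(1-2v)}{(4\pi)^{1-2v}}\hat\phi(2-2v)$$ $$\qquad+\sum_{n=1}^\infty\tau_v(n)\int_0^\infty\left(e\!\left(-\frac{nd^*}{c}\right)k_0(x\sqrt n,v)+e\!\left(\frac{nd^*}{c}\right)k_1(x\sqrt n,v)\right)\phi(x)\,x\,dx,$$ where both series and all the integrals converge absolutely. If $v=0$, the same holds (with absolute convergence) when the sum of the two terms containing $\zeta$ and the kernel $k_0(x,0)$ are replaced by their limits as $v\to0$, which exist. -/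

import Mathlib

open MeasureTheory Set Filter Topology

namespace Voronoi

/-- `e(x) = exp(2πix)`. -/
noncomputable def e (x : ℝ) : ℂ := Complex.exp (2 * Real.pi * Complex.I * x)

/-- `τ_v(n) = ∑_{n₁ n₂ = n} (n₁ / n₂)^v`. -/
noncomputable def tau (v : ℂ) (n : ℕ) : ℂ :=
  ∑ p ∈ n.divisorsAntidiagonal, ((p.1 : ℂ) / (p.2 : ℂ)) ^ v

/-- The Bessel function of the first kind `J_ν(x)` of complex order `ν`, for real `x > 0`, by its
power series. At the poles of `Γ` Mathlib has `Γ = 0`, so `(Γ (m + ν + 1))⁻¹` is the entire function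
`1 / Γ` at every `ν`. -/
noncomputable def besselJ (ν : ℂ) (x : ℝ) : ℂ :=
  ∑' m : ℕ, ((-1 : ℂ) ^ m / (m.factorial : ℂ)) * (Complex.Gamma (m + ν + 1))⁻¹ *
    ((x / 2 : ℝ) : ℂ) ^ (2 * (m : ℂ) + ν)

/-- The modified Bessel function of the second kind `K_ν(x)` of complex order `ν`, for real `x > 0`:
`K_ν(x) = ∫_0^∞ exp(-x cosh t) cosh(ν t) dt`. -/
noncomputable def besselK (ν : ℂ) (x : ℝ) : ℂ :=
  ∫ t in Ioi (0 : ℝ), (Real.exp (-x * Real.cosh t) : ℂ) * Complex.cosh (ν * t)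

/-- `k₀(x, v) = (J_{2v}(x) - J_{-2v}(x)) / (2 cos(π(1/2 + v)))`; the formula is `0 / 0` at `v = 0`,
where only its limit is meaningful. -/
noncomputable def k₀ (x : ℝ) (v : ℂ) : ℂ :=
  1 / (2 * Complex.cos (Real.pi * (1 / 2 + v))) * (besselJ (2 * v) x - besselJ (-2 * v) x)

/-- `k₁(x, v) = (2 / π) sin(π(1/2 + v)) K_{2v}(x)`. -/
noncomputable def k₁ (x : ℝ) (v : ℂ) : ℂ :=
  2 / Real.pi * Complex.sin (Real.pi * (1 / 2 + v)) * besselK (2 * v) x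

/-- The polar terms
`2 ζ(1+2v) (4π)^{-(1+2v)} φ̂(2+2v) + 2 ζ(1-2v) (4π)^{-(1-2v)} φ̂(2-2v)`, for `v ≠ 0`. -/
noncomputable def polarTerms (φ : ℝ → ℂ) (v : ℂ) : ℂ :=
  2 * (riemannZeta (1 + 2 * v) / (4 * Real.pi : ℂ) ^ (1 + 2 * v)) * mellin φ (2 + 2 * v) +
  2 * (riemannZeta (1 - 2 * v) / (4 * Real.pi : ℂ) ^ (1 - 2 * v)) * mellin φ (2 - 2 * v)

end Voronoi

/-! The Estermann function `∑ τ_v(n) e(nu/c) n^{-s}` (`estermann`, with `u` a class mod `c`) is a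
finite sum of products of a periodic zeta function and a Hurwitz zeta function. For a unit `u` it
continues meromorphically with poles at most at `1 ± v`, and its functional equation `s ↦ 1 - s`
replaces `u` by `±u⁻¹` (`estermann_one_sub`). The Voronoi formula is this functional equation
integrated against `φ̂`. By Mellin inversion the left-hand series is an integral of `φ̂(2s)
(4π/c)^{1-2s}` times the Estermann function over `Re s = 1 + δ`. Moving the line to `Re s = -δ`
produces the polar terms as residues (`estermann_shift`). There the functional equation, with `w = 1
- s`, gives two absolutely convergent Dirichlet series weighted by `Γ(w-v) Γ(w+v)` times `cos πv` or
`cos πw`. Mellin-Parseval turns their terms into integrals of `φ(x) x` against `k₁` and `k₀`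
(`hasSum_tau_mul_integral`).

For `k₁` this rests on the Mellin transform of `K` (`mellin_besselK`). For `k₀` the kernel `cos(πw)
Γ(w-v) Γ(w+v)` has size `|Im w|^{2 Re w - 1}`, so it is absolutely integrable only to the left of
its poles at `±v`. The residues at these poles are carried by a Gaussian equal to `1` at `±v`:
`kernelIntegral` is a sum of two absolutely convergent integrals over `Re w = ±δ`. Pushing the
contour to the left through the poles `±v - m` sums the power series of `J_{∓2v}`
(`k₀_eq_kernelIntegral`), while the integrals themselves stay continuous at `v = 0`.

The poles `±v`, and likewise `1 ± v`, merge at `v = 0`. The residues of `G(s) / ((s-p)(s-q))` add up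
to the divided difference `dslope G p q`, which is `G'(p)` when `p = q`, so each contour shift is
done once for both cases (`integral_sub_integral_eq_dslope`). A shift requires only exponential
growth inside the strip and integrability on its two edges, thanks to a factor `exp(η s²)` with `η →
0`. Hence no convexity bound for a zeta function is needed. -/

namespace Voronoi

/-! ### Contour shifts in vertical strips. -/

/-- The closed vertical strip `a ≤ Re s ≤ b`. -/
def closedStrip (a b : ℝ) : Set ℂ := {s | a ≤ s.re ∧ s.re ≤ b}

/-- The filter of points of a closed vertical strip whose imaginary part tends to infinity. -/
def stripFilter (a b : ℝ) : Filter ℂ :=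
  comap (fun s : ℂ => |s.im|) atTop ⊓ 𝓟 (closedStrip a b)

/-- Growth at most exponential in the imaginary part on a closed vertical strip. -/
def ExpGrowth (a b : ℝ) (f : ℂ → ℂ) : Prop :=
  ∃ K : ℝ, f =O[stripFilter a b] fun s : ℂ => Real.exp (K * |s.im|)

/-- A primitive is `-i log(z + it)`, with the principal logarithm holomorphic on the right
half-plane. The factor `log T` cancels between the symmetric endpoints, leaving `log i - log(-i) =
iπ`. -/
theorem tendsto_integral_inv_add_mul_I {z : ℂ} (hz : 0 < z.re) :
    Tendsto (fun T : ℝ => ∫ t in (-T)..T, (z + t * Complex.I)⁻¹) atTop (𝓝 Real.pi) := by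
  have hslit : ∀ t : ℝ, z + t * Complex.I ∈ Complex.slitPlane := fun t => by
    left; simpa using hz
  have h1 : ∀ T : ℝ, ∫ t in (-T)..T, (z + t * Complex.I)⁻¹ =
      -Complex.I * Complex.log (z + T * Complex.I)
        - -Complex.I * Complex.log (z + (-T : ℝ) * Complex.I) := by
    intro T
    apply intervalIntegral.integral_eq_sub_of_hasDerivAt
    · intro t _
      have h2 : HasDerivAt (fun t : ℝ => z + t * Complex.I) (1 * Complex.I) t :=
        ((Complex.ofRealCLM.hasDerivAt (x := t)).mul_const Complex.I).const_add z
      have h3 := (h2.clog_real (hslit t)).const_mul (-Complex.I)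
      convert! h3 using 1
      have h4 : z + t * Complex.I ≠ 0 := Complex.slitPlane_ne_zero (hslit t)
      field_simp
      rw [Complex.I_sq]; ring
    · apply Continuous.intervalIntegrable
      exact Continuous.inv₀ (by fun_prop) fun t => Complex.slitPlane_ne_zero (hslit t)
  have h2 : ∀ᶠ T : ℝ in atTop, -Complex.I * (Complex.log (z * (T⁻¹ : ℝ) + Complex.I)
      - Complex.log (z * (T⁻¹ : ℝ) - Complex.I)) = ∫ t in (-T)..T, (z + t * Complex.I)⁻¹ := by
    filter_upwards [eventually_gt_atTop 0] with T hT
    rw [h1]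
    have hT' : (T : ℂ) ≠ 0 := by exact_mod_cast hT.ne'
    have e1 : z + T * Complex.I = (T : ℂ) * (z * (T⁻¹ : ℝ) + Complex.I) := by
      push_cast; field_simp
    have e2 : z + (-T : ℝ) * Complex.I = (T : ℂ) * (z * (T⁻¹ : ℝ) - Complex.I) := by
      push_cast; field_simp; ring
    have n1 : z * (T⁻¹ : ℝ) + Complex.I ≠ 0 := by
      intro h; have := Complex.slitPlane_ne_zero (hslit T); rw [e1, h] at this; simp at this
    have n2 : z * (T⁻¹ : ℝ) - Complex.I ≠ 0 := by
      intro h; have := Complex.slitPlane_ne_zero (hslit (-T)); rw [e2, h] at this; simp at this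
    rw [e1, e2, Complex.log_ofReal_mul hT n1, Complex.log_ofReal_mul hT n2]
    ring
  refine Tendsto.congr' h2 ?_
  have h3 : Tendsto (fun T : ℝ => z * (T⁻¹ : ℝ)) atTop (𝓝 0) := by
    have := (Complex.continuous_ofReal.tendsto 0).comp tendsto_inv_atTop_zero
    simpa using this.const_mul z
  have h4 : Tendsto (fun T : ℝ => Complex.log (z * (T⁻¹ : ℝ) + Complex.I)) atTop
      (𝓝 (Complex.log Complex.I)) := by
    have : Tendsto (fun T : ℝ => z * (T⁻¹ : ℝ) + Complex.I) atTop (𝓝 Complex.I) := by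
      simpa using h3.add_const Complex.I
    exact this.clog (by right; simp)
  have h5 : Tendsto (fun T : ℝ => Complex.log (z * (T⁻¹ : ℝ) - Complex.I)) atTop
      (𝓝 (Complex.log (-Complex.I))) := by
    have : Tendsto (fun T : ℝ => z * (T⁻¹ : ℝ) - Complex.I) atTop (𝓝 (-Complex.I)) := by
      simpa using h3.sub_const Complex.I
    exact this.clog (by right; simp)
  have h6 := (h4.sub h5).const_mul (-Complex.I)
  convert! h6 using 2
  rw [Complex.log_I, Complex.log_neg_I]
  ring_nf
  rw [Complex.I_sq]; ring

theorem tendsto_integral_inv_add_mul_I_of_neg {z : ℂ} (hz : z.re < 0) :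
    Tendsto (fun T : ℝ => ∫ t in (-T)..T, (z + t * Complex.I)⁻¹) atTop (𝓝 (-Real.pi)) := by
  have := (tendsto_integral_inv_add_mul_I (z := -z) (by simpa using hz)).neg
  refine this.congr fun T => ?_
  have h := intervalIntegral.integral_comp_neg (a := -T) (b := T)
    fun t : ℝ => (z + t * Complex.I)⁻¹
  rw [neg_neg] at h
  rw [← h, ← intervalIntegral.integral_neg]
  congr 1 with t
  rw [neg_inv]
  push_cast
  ring_nf

/-- The sign condition puts `p` and `q` on the same side of the line, so the two limits `±π` of the
partial fractions cancel. For `p = q` there is an explicit primitive instead. -/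
theorem tendsto_integral_inv_sub_mul_inv_sub {a : ℝ} {p q : ℂ} (h : 0 < (a - p.re) * (a - q.re)) :
    Tendsto (fun T : ℝ => ∫ t in (-T)..T,
      ((a + t * Complex.I - p) * (a + t * Complex.I - q))⁻¹) atTop (𝓝 0) := by
  have hp : ∀ t : ℝ, (a + t * Complex.I - p) ≠ 0 := fun t h0 => by
    have := congrArg Complex.re h0
    simp at this
    rw [this] at h; simp at h
  have hq : ∀ t : ℝ, (a + t * Complex.I - q) ≠ 0 := fun t h0 => by
    have := congrArg Complex.re h0
    simp at this
    rw [this] at h; simp at h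
  by_cases hpq : p = q
  · subst hpq
    have h1 : ∀ T : ℝ, ∫ t in (-T)..T, ((a + t * Complex.I - p) * (a + t * Complex.I - p))⁻¹ =
        Complex.I * (a + T * Complex.I - p)⁻¹ -
          Complex.I * (a + (-T : ℝ) * Complex.I - p)⁻¹ := by
      intro T
      apply intervalIntegral.integral_eq_sub_of_hasDerivAt
        (f := fun t : ℝ => Complex.I * (a + t * Complex.I - p)⁻¹)
      · intro t _
        have h2 : HasDerivAt (fun t : ℝ => a + t * Complex.I - p) (1 * Complex.I) t :=
          (((Complex.ofRealCLM.hasDerivAt (x := t)).mul_const Complex.I).const_add _).sub_const p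
        have h3 := (h2.fun_inv (hp t)).const_mul Complex.I
        convert! h3 using 1
        have := hp t
        field_simp
        rw [Complex.I_sq]; ring
      · apply Continuous.intervalIntegrable
        exact Continuous.inv₀ (by fun_prop) fun t => mul_ne_zero (hp t) (hp t)
    simp_rw [h1]
    have h4 : Tendsto (fun T : ℝ => (a + T * Complex.I - p)⁻¹) atTop (𝓝 0) := by
      apply Filter.tendsto_inv₀_cobounded.comp
      rw [← tendsto_norm_atTop_iff_cobounded]
      refine tendsto_atTop_mono (fun T => (le_abs_self _).trans (Complex.abs_im_le_norm _)) ?_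
      simpa [sub_eq_add_neg] using tendsto_atTop_add_const_right atTop (-p.im) tendsto_id
    have h5 : Tendsto (fun T : ℝ => (a + (-T : ℝ) * Complex.I - p)⁻¹) atTop (𝓝 0) := by
      apply Filter.tendsto_inv₀_cobounded.comp
      rw [← tendsto_norm_atTop_iff_cobounded]
      refine tendsto_atTop_mono (fun T => (neg_le_abs _).trans (Complex.abs_im_le_norm _)) ?_
      simpa using tendsto_atTop_add_const_left atTop p.im tendsto_id
    simpa using (h4.const_mul Complex.I).sub (h5.const_mul Complex.I)
  · have h1 : ∀ T : ℝ, ∫ t in (-T)..T, ((a + t * Complex.I - p) * (a + t * Complex.I - q))⁻¹ =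
        (p - q)⁻¹ * ((∫ t in (-T)..T, (a - p + t * Complex.I)⁻¹) -
          ∫ t in (-T)..T, (a - q + t * Complex.I)⁻¹) := by
      intro T
      rw [← intervalIntegral.integral_sub, ← intervalIntegral.integral_const_mul]
      · apply intervalIntegral.integral_congr
        intro t _
        simp only
        have h2 := hp t
        have h3 := hq t
        rw [show (a - p + t * Complex.I) = a + t * Complex.I - p by ring,
          show (a - q + t * Complex.I) = a + t * Complex.I - q by ring]
        have := sub_ne_zero.mpr hpq
        field_simp
        ring
      · apply Continuous.intervalIntegrable
        refine Continuous.inv₀ (by fun_prop) fun t => ?_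
        rw [show (a - p + t * Complex.I) = a + t * Complex.I - p by ring]; exact hp t
      · apply Continuous.intervalIntegrable
        refine Continuous.inv₀ (by fun_prop) fun t => ?_
        rw [show (a - q + t * Complex.I) = a + t * Complex.I - q by ring]; exact hq t
    simp_rw [h1]
    rcases pos_and_pos_or_neg_and_neg_of_mul_pos h with ⟨h2, h3⟩ | ⟨h2, h3⟩
    · simpa using ((tendsto_integral_inv_add_mul_I (z := a - p) (by simpa using h2)).sub
        (tendsto_integral_inv_add_mul_I (z := a - q) (by simpa using h3))).const_mul (p - q)⁻¹
    · simpa using ((tendsto_integral_inv_add_mul_I_of_neg (z := a - p) (by simpa using h2)).sub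
        (tendsto_integral_inv_add_mul_I_of_neg (z := a - q) (by simpa using h3))).const_mul
          (p - q)⁻¹

theorem tendsto_stripFilter_iff {a b : ℝ} {f : ℂ → ℂ} :
    Tendsto f (stripFilter a b) (𝓝 0) ↔
      ∀ ε > 0, ∃ T : ℝ, ∀ s ∈ closedStrip a b, T ≤ |s.im| → ‖f s‖ < ε := by
  have hb : (stripFilter a b).HasBasis (fun _ : ℝ => True)
      fun T => (fun s : ℂ => |s.im|) ⁻¹' Ici T ∩ closedStrip a b :=
    (atTop_basis.comap _).inf_principal _
  rw [hb.tendsto_iff Metric.nhds_basis_ball]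
  simp only [mem_inter_iff, mem_preimage, mem_Ici, true_and, mem_ball_zero_iff, and_imp]
  exact forall₂_congr fun ε _ => exists_congr fun T => forall_congr' fun s => by tauto

theorem tendsto_integral_sub_of_tendsto_zero {f : ℂ → ℂ} {a b : ℝ} (hab : a ≤ b)
    (hf : DifferentiableOn ℂ f (closedStrip a b)) (h0 : Tendsto f (stripFilter a b) (𝓝 0)) :
    Tendsto (fun T : ℝ => (∫ t in (-T)..T, f (b + t * Complex.I)) -
      ∫ t in (-T)..T, f (a + t * Complex.I)) atTop (𝓝 0) := by
  rw [tendsto_stripFilter_iff] at h0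
  rw [Metric.tendsto_atTop]
  intro ε hε
  -- Each horizontal edge has length `b - a` and so contributes at most `ε / 4`; the `+ 1` covers `a
  -- = b`.
  obtain ⟨T₀, hT₀⟩ := h0 (ε / (4 * (b - a + 1))) (by apply div_pos hε; linarith)
  refine ⟨max T₀ 0, fun T hT => ?_⟩
  have hT1 : T₀ ≤ T := (le_max_left _ _).trans hT
  have hT2 : 0 ≤ T := (le_max_right _ _).trans hT
  have key := Complex.integral_boundary_rect_eq_zero_of_differentiableOn f
    (a + (-T : ℝ) * Complex.I) (b + T * Complex.I) (hf.mono fun s hs => by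
      rw [Complex.mem_reProdIm] at hs
      have := hs.1
      simp [uIcc_of_le hab] at this
      exact this)
  simp at key
  have hbd : ∀ τ : ℝ, |τ| = T → ‖∫ x in a..b, f (x + τ * Complex.I)‖ ≤ ε / 4 := by
    intro τ hτ
    have h1 : ‖∫ x in a..b, f (x + τ * Complex.I)‖ ≤ ε / (4 * (b - a + 1)) * |b - a| := by
      apply intervalIntegral.norm_integral_le_of_norm_le_const
      intro x hx
      rw [uIoc_of_le hab] at hx
      refine (hT₀ _ ⟨?_, ?_⟩ ?_).le
      · simpa using hx.1.le
      · simpa using hx.2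
      · simpa [hτ] using hT1
    refine h1.trans ?_
    rw [abs_of_nonneg (by linarith), div_mul_eq_mul_div, div_le_div_iff₀ (by linarith) (by norm_num)]
    nlinarith
  have h1 := hbd T (abs_of_nonneg hT2)
  have h2 := hbd (-T) (by rw [abs_neg, abs_of_nonneg hT2])
  rw [dist_zero_right]
  have h3 : Complex.I * ((∫ t in (-T)..T, f (b + t * Complex.I)) -
      ∫ t in (-T)..T, f (a + t * Complex.I)) = (∫ x in a..b, f (x + T * Complex.I)) -
        ∫ x in a..b, f (x + (-T : ℝ) * Complex.I) := by
    push_cast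
    simp only [neg_mul]
    linear_combination key
  have h4 := congrArg norm h3
  rw [norm_mul, Complex.norm_I, one_mul] at h4
  rw [h4]
  exact (norm_sub_le _ _).trans_lt (by linarith)

theorem ofReal_add_mul_I_mem_closedStrip {a b x : ℝ} (h1 : a ≤ x) (h2 : x ≤ b) (t : ℝ) :
    (x + t * Complex.I : ℂ) ∈ closedStrip a b := by
  simpa [closedStrip] using ⟨h1, h2⟩

section

variable {F G : ℂ → ℂ} {a b : ℝ} {p q : ℂ}

theorem closedStrip_mem_nhds (hp : p.re ∈ Ioo a b) : closedStrip a b ∈ 𝓝 p :=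
  mem_of_superset ((isOpen_Ioo.preimage Complex.continuous_re).mem_nhds hp)
    fun _ hs => ⟨hs.1.le, hs.2.le⟩

/-- Newton interpolation of `G` at the nodes `p`, `q`, divided by `(s - p)(s - q)`. It remains valid
for coinciding nodes, which is what makes the double pole a special case. -/
theorem div_mul_sub_eq_dslope (G : ℂ → ℂ) {s p q : ℂ} (hp : s ≠ p) (hq : s ≠ q) :
    G s / ((s - p) * (s - q)) = G p * ((s - p) * (s - q))⁻¹ + dslope G p q * (s - q)⁻¹ +
      dslope (dslope G p) q s := by
  have h1 := sub_smul_dslope G p s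
  have h2 := sub_smul_dslope (dslope G p) q s
  simp only [smul_eq_mul] at h1 h2
  have h3 := sub_ne_zero.mpr hp
  have h4 := sub_ne_zero.mpr hq
  field_simp
  linear_combination (-1 : ℂ) * h1 - (s - p) * h2

theorem tendsto_inv_sub_stripFilter (a b : ℝ) (p : ℂ) :
    Tendsto (fun s : ℂ => (s - p)⁻¹) (stripFilter a b) (𝓝 0) := by
  apply Filter.tendsto_inv₀_cobounded.comp
  rw [← tendsto_norm_atTop_iff_cobounded]
  have h : Tendsto (fun s : ℂ => |s.im| + -|p.im|) (stripFilter a b) atTop :=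
    tendsto_atTop_add_const_right _ _ (tendsto_comap.mono_left inf_le_left)
  refine tendsto_atTop_mono (fun s => ?_) h
  refine le_trans ?_ (Complex.abs_im_le_norm _)
  rw [Complex.sub_im]
  have := abs_sub_abs_le_abs_sub s.im p.im
  linarith

theorem eventually_stripFilter_ne (a b : ℝ) (p : ℂ) : ∀ᶠ s in stripFilter a b, s ≠ p := by
  have h : Tendsto (fun s : ℂ => |s.im|) (stripFilter a b) atTop :=
    tendsto_comap.mono_left inf_le_left
  filter_upwards [h.eventually_gt_atTop |p.im|] with s hs h
  rw [h] at hs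
  exact lt_irrefl _ hs

/-- Of the three Newton terms, the first has vanishing integral over either line, the second
contributes `π - (-π)` times `dslope G p q`, and the third is holomorphic and tends to zero at the
ends of the strip, so Cauchy's theorem applies to it. -/
theorem tendsto_integral_sub_of_tendsto_zero_of_poles (hp : p.re ∈ Ioo a b) (hq : q.re ∈ Ioo a b)
    (hG : DifferentiableOn ℂ G (closedStrip a b))
    (hFG : ∀ s ∈ closedStrip a b, s ≠ p → s ≠ q → F s = G s / ((s - p) * (s - q)))
    (h0 : Tendsto F (stripFilter a b) (𝓝 0)) :
    Tendsto (fun T : ℝ => (∫ t in (-T)..T, F (b + t * Complex.I)) -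
      ∫ t in (-T)..T, F (a + t * Complex.I)) atTop (𝓝 (2 * Real.pi * dslope G p q)) := by
  have hab : a ≤ b := (hp.1.trans hp.2).le
  have hg1 : DifferentiableOn ℂ (dslope G p) (closedStrip a b) :=
    (Complex.differentiableOn_dslope (closedStrip_mem_nhds hp)).mpr hG
  have hg2 : DifferentiableOn ℂ (dslope (dslope G p) q) (closedStrip a b) :=
    (Complex.differentiableOn_dslope (closedStrip_mem_nhds hq)).mpr hg1
  have hdec : ∀ s ∈ closedStrip a b, s ≠ p → s ≠ q → F s = G p * ((s - p) * (s - q))⁻¹ +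
      dslope G p q * (s - q)⁻¹ + dslope (dslope G p) q s := fun s hs h1 h2 => by
    rw [hFG s hs h1 h2, div_mul_sub_eq_dslope G h1 h2]
  have hg0 : Tendsto (dslope (dslope G p) q) (stripFilter a b) (𝓝 0) := by
    have hp0 := tendsto_inv_sub_stripFilter a b p
    have hq0 := tendsto_inv_sub_stripFilter a b q
    have h := (h0.sub ((hp0.mul hq0).const_mul (G p))).sub (hq0.const_mul (dslope G p q))
    simp only [mul_zero, sub_zero] at h
    refine h.congr' ?_
    filter_upwards [eventually_stripFilter_ne a b p, eventually_stripFilter_ne a b q,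
      mem_inf_of_right (mem_principal_self (closedStrip a b))] with s h1 h2 hs
    rw [hdec s hs h1 h2, mul_inv]
    ring
  have main := tendsto_integral_sub_of_tendsto_zero hab hg2 hg0
  have hne : ∀ x : ℝ, ∀ r : ℂ, x ≠ r.re → ∀ t : ℝ, (x + t * Complex.I : ℂ) ≠ r :=
    fun x r hx t h => hx (by simpa using congrArg Complex.re h)
  have hline : ∀ x : ℝ, a ≤ x → x ≤ b → x ≠ p.re → x ≠ q.re → ∀ T : ℝ,
      ∫ t in (-T)..T, F (x + t * Complex.I) =
        G p * (∫ t in (-T)..T, ((x + t * Complex.I - p) * (x + t * Complex.I - q))⁻¹) +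
        dslope G p q * (∫ t in (-T)..T, (x - q + t * Complex.I)⁻¹) +
        ∫ t in (-T)..T, dslope (dslope G p) q (x + t * Complex.I) := by
    intro x h1 h2 h3 h4 T
    have c1 : Continuous fun t : ℝ =>
        ((x + t * Complex.I - p) * (x + t * Complex.I - q) : ℂ)⁻¹ :=
      Continuous.inv₀ (by fun_prop) fun t =>
        mul_ne_zero (sub_ne_zero.mpr (hne x p h3 t)) (sub_ne_zero.mpr (hne x q h4 t))
    have c2 : Continuous fun t : ℝ => (x - q + t * Complex.I : ℂ)⁻¹ :=
      Continuous.inv₀ (by fun_prop) fun t => by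
        rw [show (x - q + t * Complex.I : ℂ) = x + t * Complex.I - q by ring]
        exact sub_ne_zero.mpr (hne x q h4 t)
    have c3 : Continuous fun t : ℝ => dslope (dslope G p) q (x + t * Complex.I) :=
      hg2.continuousOn.comp_continuous (by fun_prop)
        fun t => ofReal_add_mul_I_mem_closedStrip h1 h2 t
    rw [← intervalIntegral.integral_const_mul, ← intervalIntegral.integral_const_mul,
      ← intervalIntegral.integral_add ((c1.const_mul _).intervalIntegrable _ _)
        ((c2.const_mul _).intervalIntegrable _ _),
      ← intervalIntegral.integral_add
        (((c1.const_mul _).fun_add (c2.const_mul _)).intervalIntegrable _ _)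
        (c3.intervalIntegrable _ _)]
    congr 1 with t
    rw [hdec _ (ofReal_add_mul_I_mem_closedStrip h1 h2 t) (hne x p h3 t) (hne x q h4 t)]
    ring_nf
  have hb := hline b hab le_rfl hp.2.ne' hq.2.ne'
  have ha := hline a le_rfl hab hp.1.ne hq.1.ne
  simp_rw [hb, ha]
  have l1 := tendsto_integral_inv_sub_mul_inv_sub (a := b) (p := p) (q := q)
    (mul_pos (sub_pos.mpr hp.2) (sub_pos.mpr hq.2))
  have l2 := tendsto_integral_inv_sub_mul_inv_sub (a := a) (p := p) (q := q)
    (mul_pos_of_neg_of_neg (sub_neg.mpr hp.1) (sub_neg.mpr hq.1))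
  have l3 := tendsto_integral_inv_add_mul_I (z := b - q) (by simpa using hq.2)
  have l4 := tendsto_integral_inv_add_mul_I_of_neg (z := a - q) (by simpa using hq.1)
  have := ((((l1.sub l2).const_mul (G p)).add ((l3.sub l4).const_mul (dslope G p q)))).add main
  convert! this using 2
  · ring
  · ring

end

theorem norm_exp_mul_sq (η x t : ℝ) :
    ‖Complex.exp (η * (x + t * Complex.I) ^ 2)‖ = Real.exp (η * (x ^ 2 - t ^ 2)) := by
  rw [Complex.norm_exp]
  congr 1
  simp [pow_two]

theorem tendsto_mul_exp_sq_stripFilter {F : ℂ → ℂ} {a b : ℝ} (h : ExpGrowth a b F) {η : ℝ}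
    (hη : 0 < η) :
    Tendsto (fun s => F s * Complex.exp (η * s ^ 2)) (stripFilter a b) (𝓝 0) := by
  obtain ⟨K, hK⟩ := h
  have h1 : (fun s : ℂ => Complex.exp (η * s ^ 2)) =O[stripFilter a b]
      fun s : ℂ => Real.exp (-η * |s.im| ^ 2) := by
    refine Asymptotics.IsBigO.of_bound (Real.exp (η * (max |a| |b|) ^ 2)) ?_
    filter_upwards [mem_inf_of_right (mem_principal_self (closedStrip a b))] with s hs
    have : s = s.re + s.im * Complex.I := (Complex.re_add_im s).symm
    rw [this, norm_exp_mul_sq]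
    rw [Real.norm_of_nonneg (Real.exp_pos _).le, ← Real.exp_add]
    apply Real.exp_le_exp.mpr
    have h2 : s.re ^ 2 ≤ (max |a| |b|) ^ 2 := by
      rw [← sq_abs]
      apply pow_le_pow_left₀ (abs_nonneg _)
      exact abs_le_max_abs_abs hs.1 hs.2
    simp
    nlinarith
  have h2 := hK.mul h1
  refine h2.trans_tendsto ?_
  have h3 : Tendsto (fun y : ℝ => Real.exp (K * y) * Real.exp (-η * y ^ 2)) atTop (𝓝 0) := by
    simp_rw [← Real.exp_add]
    refine Real.tendsto_exp_atBot.comp ?_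
    have : (fun y : ℝ => K * y + -η * y ^ 2) = fun y => y * (K + -η * y) := by ext y; ring
    rw [this]
    refine tendsto_id.atTop_mul_atBot₀ ?_
    exact tendsto_atBot_add_const_left _ _ (tendsto_id.const_mul_atTop_of_neg (by linarith))
  exact h3.comp (tendsto_comap.mono_left inf_le_left)

theorem tendsto_integral_mul_exp_sq {F : ℂ → ℂ} {a : ℝ}
    (ha : Integrable fun t : ℝ => F (a + t * Complex.I)) :
    Tendsto (fun η : ℝ => ∫ t : ℝ, F (a + t * Complex.I) *
      Complex.exp (η * (a + t * Complex.I) ^ 2)) (𝓝[>] 0)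
      (𝓝 (∫ t : ℝ, F (a + t * Complex.I))) := by
  apply tendsto_integral_filter_of_dominated_convergence
    (fun t : ℝ => ‖F (a + t * Complex.I)‖ * Real.exp (a ^ 2))
  · refine Eventually.of_forall fun η => ha.aestronglyMeasurable.mul ?_
    exact Continuous.aestronglyMeasurable (by fun_prop)
  · filter_upwards [Ioc_mem_nhdsGT (zero_lt_one' ℝ)] with η hη
    refine Eventually.of_forall fun t => ?_
    rw [norm_mul, norm_exp_mul_sq]
    gcongr
    nlinarith [hη.1, hη.2, sq_nonneg a, sq_nonneg t, mul_nonneg hη.1.le (sq_nonneg t)]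
  · exact ha.norm.mul_const _
  · refine Eventually.of_forall fun t => ?_
    have : Continuous fun η : ℝ => F (a + t * Complex.I) *
      Complex.exp (η * (a + t * Complex.I) ^ 2) := by fun_prop
    have h := this.tendsto 0
    simp only [Complex.ofReal_zero, zero_mul, Complex.exp_zero, mul_one] at h
    exact h.mono_left nhdsWithin_le_nhds

section

variable {F G : ℂ → ℂ} {a b : ℝ} {p q : ℂ}

theorem tendsto_dslope_mul_exp_sq (hG : DifferentiableAt ℂ G p) :
    Tendsto (fun η : ℝ => dslope (fun s => G s * Complex.exp (η * s ^ 2)) p q) (𝓝[>] 0)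
      (𝓝 (dslope G p q)) := by
  refine Tendsto.mono_left ?_ nhdsWithin_le_nhds
  by_cases hpq : q = p
  · subst hpq
    have h1 : ∀ η : ℝ, dslope (fun s => G s * Complex.exp (η * s ^ 2)) q q =
        deriv G q * Complex.exp (η * q ^ 2) +
          G q * (Complex.exp (η * q ^ 2) * (η * (2 * q))) := by
      intro η
      rw [dslope_same]
      have h2 : HasDerivAt (fun s : ℂ => Complex.exp (η * s ^ 2))
          (Complex.exp (η * q ^ 2) * (η * (2 * q))) q := by
        have := (((hasDerivAt_pow 2 q).const_mul (η : ℂ)).cexp)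
        simpa using this
      exact (hG.hasDerivAt.mul h2).deriv
    simp_rw [h1]
    rw [dslope_same]
    have : Continuous fun η : ℝ => deriv G q * Complex.exp (η * q ^ 2) +
          G q * (Complex.exp (η * q ^ 2) * (η * (2 * q))) := by fun_prop
    simpa using this.tendsto 0
  · simp_rw [dslope_of_ne _ hpq, slope_def_module, smul_eq_mul]
    have : Continuous fun η : ℝ => (q - p)⁻¹ *
      (G q * Complex.exp (η * q ^ 2) - G p * Complex.exp (η * p ^ 2)) := by fun_prop
    simpa using this.tendsto 0

/-- Shifting a vertical line of integration across two simple poles or one double pole. -/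
theorem integral_sub_integral_eq_dslope (hp : p.re ∈ Ioo a b) (hq : q.re ∈ Ioo a b)
    (hG : DifferentiableOn ℂ G (closedStrip a b))
    (hFG : ∀ s ∈ closedStrip a b, s ≠ p → s ≠ q → F s = G s / ((s - p) * (s - q)))
    (hF : ExpGrowth a b F) (ha : Integrable fun t : ℝ => F (a + t * Complex.I))
    (hb : Integrable fun t : ℝ => F (b + t * Complex.I)) :
    (∫ t : ℝ, F (b + t * Complex.I)) - ∫ t : ℝ, F (a + t * Complex.I) =
      2 * Real.pi * dslope G p q := by
  have hint : ∀ x : ℝ, (Integrable fun t : ℝ => F (x + t * Complex.I)) → ∀ η : ℝ, 0 < η →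
      Integrable fun t : ℝ => F (x + t * Complex.I) *
        Complex.exp (η * (x + t * Complex.I) ^ 2) := by
    intro x hx η hη
    refine hx.mul_bdd (c := Real.exp (η * x ^ 2))
      (Continuous.aestronglyMeasurable (by fun_prop)) (Eventually.of_forall fun t => ?_)
    rw [norm_exp_mul_sq]
    gcongr
    nlinarith [sq_nonneg t]
  -- The factor `exp(η s²)` beats any exponential growth in the strip. The limit `η → 0` only
  -- involves the two edges, where `F` is integrable, and the divided difference, which is
  -- continuous in `η`.
  have hη : ∀ η : ℝ, 0 < η →
      (∫ t : ℝ, F (b + t * Complex.I) * Complex.exp (η * (b + t * Complex.I) ^ 2)) -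
        (∫ t : ℝ, F (a + t * Complex.I) * Complex.exp (η * (a + t * Complex.I) ^ 2)) =
      2 * Real.pi * dslope (fun s => G s * Complex.exp (η * s ^ 2)) p q := by
    intro η hη
    have h1 := tendsto_integral_sub_of_tendsto_zero_of_poles
      (F := fun s => F s * Complex.exp (η * s ^ 2)) (G := fun s => G s * Complex.exp (η * s ^ 2))
      hp hq (hG.mul (Differentiable.differentiableOn (by fun_prop)))
      (fun s hs h1 h2 => by rw [hFG s hs h1 h2]; ring)
      (tendsto_mul_exp_sq_stripFilter hF hη)
    have h2 := (intervalIntegral_tendsto_integral (hint b hb η hη) tendsto_neg_atTop_atBot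
      tendsto_id).sub (intervalIntegral_tendsto_integral (hint a ha η hη) tendsto_neg_atTop_atBot
      tendsto_id)
    exact tendsto_nhds_unique h2 h1
  have h1 := (tendsto_integral_mul_exp_sq hb).sub (tendsto_integral_mul_exp_sq ha)
  have h2 := (tendsto_dslope_mul_exp_sq (q := q)
    (hG.differentiableAt (closedStrip_mem_nhds hp))).const_mul (2 * Real.pi : ℂ)
  refine tendsto_nhds_unique h1 (h2.congr' ?_)
  filter_upwards [self_mem_nhdsWithin] with η h
  exact (hη η h).symm

end

/-! ### Calculus of functions of exponential growth in strips. -/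

namespace ExpGrowth

variable {f g : ℂ → ℂ} {a b : ℝ}

theorem congr' (hf : ExpGrowth a b f) (h : f =ᶠ[stripFilter a b] g) : ExpGrowth a b g := by
  obtain ⟨K, hK⟩ := hf
  exact ⟨K, hK.congr' h .rfl⟩

theorem mul (hf : ExpGrowth a b f) (hg : ExpGrowth a b g) :
    ExpGrowth a b (fun s => f s * g s) := by
  obtain ⟨K, hK⟩ := hf
  obtain ⟨K', hK'⟩ := hg
  refine ⟨K + K', (hK.mul hK').congr_right fun s => ?_⟩
  rw [← Real.exp_add, add_mul]

theorem add (hf : ExpGrowth a b f) (hg : ExpGrowth a b g) :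
    ExpGrowth a b (fun s => f s + g s) := by
  obtain ⟨K, hK⟩ := hf
  obtain ⟨K', hK'⟩ := hg
  refine ⟨max K K', (hK.trans ?_).add (hK'.trans ?_)⟩ <;>
  · refine Asymptotics.IsBigO.of_bound 1 (Eventually.of_forall fun s => ?_)
    rw [Real.norm_of_nonneg (Real.exp_pos _).le, Real.norm_of_nonneg (Real.exp_pos _).le, one_mul]
    gcongr
    simp

theorem sum {ι : Type*} {u : Finset ι} {f : ι → ℂ → ℂ} (hf : ∀ i ∈ u, ExpGrowth a b (f i)) :
    ExpGrowth a b (fun s => ∑ i ∈ u, f i s) := by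
  classical
  induction u using Finset.induction_on with
  | empty =>
    exact ⟨0, by simpa using Asymptotics.isBigO_zero (E' := ℂ) (fun _ : ℂ => (1 : ℝ)) _⟩
  | insert i u hi ih =>
    simp_rw [Finset.sum_insert hi]
    exact (hf i (by simp)).add (ih fun j hj => hf j (by simp [hj]))

theorem of_norm_le {C K T : ℝ}
    (h : ∀ s ∈ closedStrip a b, T ≤ |s.im| → ‖f s‖ ≤ C * Real.exp (K * |s.im|)) :
    ExpGrowth a b f := by
  refine ⟨K, Asymptotics.IsBigO.of_bound C ?_⟩
  have h1 : Tendsto (fun s : ℂ => |s.im|) (stripFilter a b) atTop :=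
    tendsto_comap.mono_left inf_le_left
  filter_upwards [mem_inf_of_right (mem_principal_self (closedStrip a b)),
    h1.eventually_ge_atTop T] with s hs hT
  rw [Real.norm_of_nonneg (Real.exp_pos _).le]
  exact h s hs hT

theorem of_bounded {C : ℝ} (h : ∀ s ∈ closedStrip a b, ‖f s‖ ≤ C) : ExpGrowth a b f :=
  of_norm_le (C := C) (K := 0) (T := 0) fun s hs _ => by simpa using h s hs

theorem const (a b : ℝ) (z : ℂ) : ExpGrowth a b (fun _ => z) :=
  of_bounded fun _ _ => le_rfl

theorem inv_sub (z : ℂ) : ExpGrowth a b (fun s => (s - z)⁻¹) := by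
  refine ⟨0, ?_⟩
  simp only [zero_mul, Real.exp_zero]
  exact (tendsto_inv_sub_stripFilter a b z).isBigO_one ℝ

theorem exp_const_mul (z : ℂ) : ExpGrowth a b (fun s => Complex.exp (z * s)) := by
  refine of_norm_le (C := Real.exp (|z.re| * max |a| |b|)) (K := |z.im|) (T := 0) fun s hs _ => ?_
  rw [Complex.norm_exp, ← Real.exp_add, Complex.mul_re]
  gcongr
  have h1 := abs_le_max_abs_abs hs.1 hs.2
  have h2 := le_abs_self (z.re * s.re)
  have h3 := neg_abs_le (z.im * s.im)
  rw [abs_mul] at h2 h3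
  nlinarith [abs_nonneg z.re, mul_le_mul_of_nonneg_left h1 (abs_nonneg z.re)]

theorem cpow_neg {z : ℂ} (hz : z ≠ 0) : ExpGrowth a b (fun s => z ^ (-s)) := by
  refine (exp_const_mul (-Complex.log z)).congr' (Eventually.of_forall fun s => ?_)
  simp only [Complex.cpow_def_of_ne_zero hz]
  ring_nf

/-- Composition with an imaginary-direction translation or a real one. -/
theorem comp_add_const {w : ℂ} (hf : ExpGrowth (a + w.re) (b + w.re) f) :
    ExpGrowth a b (fun s => f (s + w)) := by
  obtain ⟨K, hK⟩ := hf
  have ht : Tendsto (fun s : ℂ => s + w) (stripFilter a b)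
      (stripFilter (a + w.re) (b + w.re)) := by
    refine tendsto_inf.mpr ⟨?_, ?_⟩
    · rw [tendsto_comap_iff]
      have h : Tendsto (fun s : ℂ => |s.im| + -|w.im|) (stripFilter a b) atTop :=
        tendsto_atTop_add_const_right _ _ (tendsto_comap.mono_left inf_le_left)
      refine tendsto_atTop_mono (fun s => ?_) h
      have := abs_sub_abs_le_abs_sub s.im (-w.im)
      simp at this ⊢
      linarith
    · refine Tendsto.mono_left ?_ inf_le_right
      rw [tendsto_principal_principal]
      intro s hs
      simpa [closedStrip] using hs
  refine ⟨|K|, (hK.comp_tendsto ht).trans ?_⟩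
  refine Asymptotics.IsBigO.of_bound (Real.exp (|K| * |w.im|)) (Eventually.of_forall fun s => ?_)
  simp only [Function.comp_apply, Complex.add_im, Real.norm_of_nonneg (Real.exp_pos _).le]
  rw [← Real.exp_add]
  gcongr
  have h1 := abs_add_le s.im w.im
  have h2 := mul_le_mul_of_nonneg_right (le_abs_self K) (abs_nonneg (s.im + w.im))
  have h3 := mul_le_mul_of_nonneg_left h1 (abs_nonneg K)
  linarith

theorem cos_const_mul (z : ℂ) : ExpGrowth a b (fun s => Complex.cos (z * s)) := by
  have h := ((exp_const_mul (a := a) (b := b) (z * Complex.I)).add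
    (exp_const_mul (-z * Complex.I))).mul (const a b (1 / 2))
  refine h.congr' (Eventually.of_forall fun s => ?_)
  simp only [Complex.cos]
  ring_nf

theorem mono {a' b' : ℝ} (hf : ExpGrowth a b f) (ha : a ≤ a') (hb : b' ≤ b) :
    ExpGrowth a' b' f := by
  obtain ⟨K, hK⟩ := hf
  exact ⟨K, hK.mono (inf_le_inf_left _ (principal_mono.mpr fun s hs =>
    ⟨ha.trans hs.1, hs.2.trans hb⟩))⟩

end ExpGrowth

/-! ### Stirling-type upper bounds for the Gamma function. -/

theorem norm_Gamma_le_Gamma_re {s : ℂ} (hs : 0 < s.re) : ‖Complex.Gamma s‖ ≤ Real.Gamma s.re := by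
  rw [Complex.Gamma_eq_integral hs, Real.Gamma_eq_integral hs, Complex.GammaIntegral]
  refine (norm_integral_le_integral_norm _).trans (le_of_eq ?_)
  refine setIntegral_congr_fun measurableSet_Ioi fun x hx => ?_
  simp only [norm_mul, Complex.norm_real, Real.norm_of_nonneg (Real.exp_pos _).le]
  rw [Complex.norm_cpow_eq_rpow_re_of_pos hx]
  simp

theorem exists_norm_Gamma_le {a b : ℝ} (ha : 0 < a) :
    ∃ C : ℝ, ∀ s ∈ closedStrip a b, ‖Complex.Gamma s‖ ≤ C := by
  have hc : ContinuousOn Real.Gamma (Icc a b) := fun x hx =>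
    (Real.differentiableAt_Gamma fun m => by
      have : 0 < x := ha.trans_le hx.1
      have : (0 : ℝ) ≤ m := m.cast_nonneg
      linarith).continuousAt.continuousWithinAt
  obtain ⟨C, hC⟩ := isCompact_Icc.exists_bound_of_continuousOn hc
  refine ⟨C, fun s hs => ?_⟩
  exact (norm_Gamma_le_Gamma_re (ha.trans_le hs.1)).trans ((le_abs_self _).trans (hC s.re hs))

/-- On the line `Re s = 1/2` the point `1 - s` is the conjugate of `s`, so the reflection formula
gives `|Γ(s)|² = π / cosh(πy)` exactly. -/
theorem norm_Gamma_half_add_mul_I_le (y : ℝ) :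
    ‖Complex.Gamma (1 / 2 + y * Complex.I)‖ ≤
      √(2 * Real.pi) * Real.exp (-(Real.pi * |y| / 2)) := by
  have h1 : (1 : ℂ) - (1 / 2 + y * Complex.I) =
      (starRingEnd ℂ) (1 / 2 + y * Complex.I) := by
    apply Complex.ext
    · simp; norm_num
    · simp
  have h2 := Complex.Gamma_mul_Gamma_one_sub (1 / 2 + y * Complex.I)
  rw [h1, Complex.Gamma_conj, Complex.mul_conj] at h2
  have h3 : Complex.sin (Real.pi * (1 / 2 + y * Complex.I)) = (Real.cosh (Real.pi * y) : ℝ) := by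
    rw [show (Real.pi * (1 / 2 + y * Complex.I) : ℂ) =
      (Real.pi * y : ℝ) * Complex.I + Real.pi / 2 by push_cast; ring, Complex.sin_add_pi_div_two,
      Complex.cos_mul_I, Complex.ofReal_cosh]
  rw [h3] at h2
  have h4 : Complex.normSq (Complex.Gamma (1 / 2 + y * Complex.I)) =
      Real.pi / Real.cosh (Real.pi * y) := by exact_mod_cast h2
  rw [Complex.normSq_eq_norm_sq] at h4
  have h5 : Real.exp (Real.pi * |y|) / 2 ≤ Real.cosh (Real.pi * y) := by
    rw [← Real.cosh_abs, abs_mul, abs_of_pos Real.pi_pos, Real.cosh_eq]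
    have := Real.exp_pos (-(Real.pi * |y|))
    linarith
  apply le_of_sq_le_sq _ (by positivity)
  rw [h4, mul_pow, Real.sq_sqrt (by positivity), ← Real.exp_nat_mul]
  calc Real.pi / Real.cosh (Real.pi * y) ≤ Real.pi / (Real.exp (Real.pi * |y|) / 2) := by
        gcongr
    _ = 2 * Real.pi * Real.exp (-(Real.pi * |y|)) := by
        rw [Real.exp_neg]; field_simp
    _ = _ := by congr 2; push_cast; ring

theorem arg_mul_im_le {s : ℂ} (hs : 0 < s.re) : s.arg * s.im ≤ Real.pi * |s.im| / 2 := by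
  have h1 := (Complex.abs_arg_lt_pi_div_two_iff.mpr (Or.inl hs)).le
  have h2 := le_abs_self (s.arg * s.im)
  rw [abs_mul] at h2
  nlinarith [abs_nonneg s.im]

/-- The complementary angle `π/2 - |arg s|` has tangent `Re s / |Im s|` and is at most its tangent.
-/
theorem le_arg_mul_im {s : ℂ} (hs : 0 < s.re) : Real.pi * |s.im| / 2 - s.re ≤ s.arg * s.im := by
  have key : ∀ θ y : ℝ, 0 < y → 0 < θ → θ < Real.pi / 2 → Real.tan θ = y / s.re →
      Real.pi * y / 2 - s.re ≤ θ * y := by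
    intro θ y hy h1 h2 h3
    have h4 := Real.le_tan (x := Real.pi / 2 - θ) (by linarith) (by linarith)
    rw [Real.tan_pi_div_two_sub, h3, inv_div, le_div_iff₀ hy] at h4
    linarith
  have hlt := Complex.abs_arg_lt_pi_div_two_iff.mpr (Or.inl hs)
  rw [abs_lt] at hlt
  rcases lt_trichotomy s.im 0 with h | h | h
  · have h1 := key (-s.arg) (-s.im) (by linarith)
      (by linarith [Complex.arg_neg_iff.mpr h]) (by linarith)
      (by rw [Real.tan_neg, Complex.tan_arg, neg_div])
    rw [abs_of_neg h]
    linarith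
  · simp [h, hs.le]
  · rw [abs_of_pos h]
    refine key _ _ h (lt_of_le_of_ne (Complex.arg_nonneg_iff.mpr h.le) fun h0 => ?_) hlt.2
      (Complex.tan_arg s)
    have := Complex.tan_arg s
    rw [← h0, Real.tan_zero, eq_comm, div_eq_zero_iff] at this
    rcases this with h' | h' <;> linarith

/-- Phragmén-Lindelöf for `Γ(s) s^{1/2 - s}`, where `s^{s - 1/2}` is the expected growth. The edge
`Re s = 1/2` is explicit, and `Re s = 3/2` reduces to it by `Γ(s) = (s-1) Γ(s-1)` and `|s - 1| ≤
|s|`. -/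
theorem norm_Gamma_mul_cpow_le {s : ℂ} (h1 : 1 / 2 ≤ s.re) (h2 : s.re ≤ 3 / 2) :
    ‖Complex.Gamma s * s ^ (1 / 2 - s)‖ ≤ √(2 * Real.pi) := by
  have hne : ∀ {s : ℂ}, 0 < s.re → s ≠ 0 := fun hs h0 => by simp [h0] at hs
  have hcpow : ∀ {s : ℂ}, 0 < s.re → ‖s ^ (1 / 2 - s)‖ ≤
      ‖s‖ ^ (1 / 2 - s.re) * Real.exp (Real.pi * |s.im| / 2) := by
    intro s hs
    rw [Complex.norm_cpow_of_ne_zero (hne hs), div_eq_mul_inv, ← Real.exp_neg]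
    have : -(s.arg * (1 / 2 - s).im) = s.arg * s.im := by simp
    rw [this]
    have h3 := arg_mul_im_le hs
    have h4 : (1 / 2 - s : ℂ).re = 1 / 2 - s.re := by simp
    rw [h4]
    gcongr
  refine PhragmenLindelof.vertical_strip (a := 1 / 2) (b := 3 / 2)
    (f := fun s => Complex.Gamma s * s ^ (1 / 2 - s)) ?_ ?_ ?_ ?_ h1 h2
  · apply DifferentiableOn.diffContOnCl
    rw [Complex.closure_preimage_re, closure_Ioo (by norm_num)]
    intro s hs
    have hs' : 0 < s.re := lt_of_lt_of_le (by norm_num) hs.1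
    refine DifferentiableAt.differentiableWithinAt (DifferentiableAt.mul ?_ ?_)
    · refine Complex.differentiableAt_Gamma s fun m h => ?_
      rw [h] at hs'
      simp at hs'
      have : (0 : ℝ) ≤ m := m.cast_nonneg
      linarith
    · exact DifferentiableAt.cpow differentiableAt_id (by fun_prop) (Or.inl hs')
  · obtain ⟨C, hC⟩ := exists_norm_Gamma_le (a := 1 / 2) (b := 3 / 2) (by norm_num)
    -- A strip of width `1` tolerates growth `exp(B exp(c |Im s|))` for any `c < π`; here `exp(π |Im
    -- s| / 2)` is all that occurs, so `c = 1` is ample.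
    refine ⟨1, by norm_num; linarith [Real.pi_gt_three], Real.pi / 2,
      Asymptotics.IsBigO.of_bound C ?_⟩
    have hT : Tendsto (_root_.abs ∘ Complex.im)
      (comap (_root_.abs ∘ Complex.im) atTop ⊓ 𝓟 (Complex.re ⁻¹' Ioo (1 / 2) (3 / 2))) atTop :=
      tendsto_comap.mono_left inf_le_left
    filter_upwards [hT.eventually_ge_atTop 1,
      mem_inf_of_right (mem_principal_self _)] with s hs1 hs2
    have hs1 : 1 ≤ |s.im| := hs1
    rw [norm_mul, Real.norm_of_nonneg (Real.exp_pos _).le, one_mul]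
    have h3 := hC s ⟨hs2.1.le, hs2.2.le⟩
    refine mul_le_mul h3 ?_ (norm_nonneg _) ((norm_nonneg _).trans h3)
    refine (hcpow (lt_trans (by norm_num) hs2.1)).trans ?_
    have h4 : ‖s‖ ^ (1 / 2 - s.re) ≤ 1 :=
      Real.rpow_le_one_of_one_le_of_nonpos (hs1.trans (Complex.abs_im_le_norm s))
        (by linarith [hs2.1])
    refine (mul_le_of_le_one_left (Real.exp_pos _).le h4).trans (Real.exp_le_exp.mpr ?_)
    have := Real.add_one_le_exp |s.im|
    nlinarith [Real.pi_pos]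
  · intro s hs
    have hs' : s = 1 / 2 + s.im * Complex.I := by
      apply Complex.ext <;> simp [hs]
    have h3 := norm_Gamma_half_add_mul_I_le s.im
    rw [← hs'] at h3
    have h4 := hcpow (s := s) (by rw [hs]; norm_num)
    rw [hs, sub_self, Real.rpow_zero, one_mul] at h4
    rw [norm_mul]
    refine (mul_le_mul h3 h4 (norm_nonneg _) (by positivity)).trans (le_of_eq ?_)
    rw [mul_assoc, ← Real.exp_add]
    simp
  · intro s hs
    have hs0 : 0 < s.re := by rw [hs]; norm_num
    have hs' : s - 1 = 1 / 2 + s.im * Complex.I := by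
      apply Complex.ext <;> simp [hs]; norm_num
    have h3 := norm_Gamma_half_add_mul_I_le s.im
    rw [← hs'] at h3
    have h4 := hcpow hs0
    rw [hs, show (1 / 2 - 3 / 2 : ℝ) = -1 by norm_num, Real.rpow_neg_one] at h4
    have h5 : Complex.Gamma s = (s - 1) * Complex.Gamma (s - 1) := by
      rw [← Complex.Gamma_add_one, sub_add_cancel]
      rw [hs']; intro h; have := congrArg Complex.re h; simp at this
    have h6 : ‖s - 1‖ ≤ ‖s‖ := by
      apply le_of_sq_le_sq _ (norm_nonneg _)
      rw [← Complex.normSq_eq_norm_sq, ← Complex.normSq_eq_norm_sq, Complex.normSq_apply,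
        Complex.normSq_apply]
      simp [hs]; norm_num
    have hs1 : 0 < ‖s‖ := norm_pos_iff.mpr (hne hs0)
    rw [norm_mul, h5, norm_mul]
    calc ‖s - 1‖ * ‖Complex.Gamma (s - 1)‖ * ‖s ^ (1 / 2 - s)‖
        ≤ ‖s‖ * (√(2 * Real.pi) * Real.exp (-(Real.pi * |s.im| / 2))) *
          (‖s‖⁻¹ * Real.exp (Real.pi * |s.im| / 2)) := by gcongr
      _ = √(2 * Real.pi) := by
        rw [Real.exp_neg]; field_simp

/-- Stirling's upper bound for `Γ`, as a predicate at one point. -/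
def GammaBound (C : ℝ) (s : ℂ) : Prop :=
  ‖Complex.Gamma s‖ ≤ C * ((1 + |s.im|) ^ (s.re - 1 / 2) * Real.exp (-(Real.pi * |s.im| / 2)))

theorem exists_gammaBound : ∃ C : ℝ, 0 < C ∧ ∀ s ∈ closedStrip (1 / 2) (3 / 2), GammaBound C s := by
  refine ⟨√(2 * Real.pi) * (3 / 2) * Real.exp (3 / 2), by positivity, fun s hs => ?_⟩
  have hs0 : 0 < s.re := lt_of_lt_of_le (by norm_num) hs.1
  have hne : s ≠ 0 := fun h0 => by simp [h0] at hs0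
  have h1 := norm_Gamma_mul_cpow_le hs.1 hs.2
  rw [norm_mul, Complex.norm_cpow_of_ne_zero hne, div_eq_mul_inv, ← Real.exp_neg] at h1
  rw [show -(s.arg * (1 / 2 - s).im) = s.arg * s.im by simp,
    show (1 / 2 - s : ℂ).re = -(s.re - 1 / 2) by simp, Real.rpow_neg (norm_nonneg _)] at h1
  have h2 := le_arg_mul_im hs0
  have hn : 0 < ‖s‖ := norm_pos_iff.mpr hne
  have hpos : 0 < ‖s‖ ^ (s.re - 1 / 2) := Real.rpow_pos_of_pos hn _
  have h3 : ‖Complex.Gamma s‖ ≤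
      √(2 * Real.pi) * ‖s‖ ^ (s.re - 1 / 2) * Real.exp (-(s.arg * s.im)) := by
    rw [Real.exp_neg]
    have := Real.exp_pos (s.arg * s.im)
    rw [← div_eq_mul_inv, le_div_iff₀ this]
    rw [← mul_assoc, mul_comm _ (‖s‖ ^ (s.re - 1 / 2))⁻¹, mul_assoc,
      inv_mul_le_iff₀ hpos] at h1
    linarith
  have h4 : ‖s‖ ^ (s.re - 1 / 2) ≤ 3 / 2 * (1 + |s.im|) ^ (s.re - 1 / 2) := by
    have h5 : ‖s‖ ≤ 3 / 2 * (1 + |s.im|) := by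
      refine (Complex.norm_le_abs_re_add_abs_im s).trans ?_
      rw [abs_of_pos hs0]
      nlinarith [hs.2, abs_nonneg s.im]
    have h6 : 0 ≤ s.re - 1 / 2 := by linarith [hs.1]
    refine (Real.rpow_le_rpow (norm_nonneg _) h5 h6).trans ?_
    rw [Real.mul_rpow (by norm_num) (by positivity)]
    have h7 : (3 / 2 : ℝ) ^ (s.re - 1 / 2) ≤ (3 / 2 : ℝ) ^ (1 : ℝ) :=
      Real.rpow_le_rpow_of_exponent_le (by norm_num) (by linarith [hs.2])
    rw [Real.rpow_one] at h7
    gcongr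
  have h8 : Real.exp (-(s.arg * s.im)) ≤
      Real.exp (3 / 2) * Real.exp (-(Real.pi * |s.im| / 2)) := by
    rw [← Real.exp_add]
    apply Real.exp_le_exp.mpr
    linarith [hs.2]
  unfold GammaBound
  calc ‖Complex.Gamma s‖ ≤
      √(2 * Real.pi) * ‖s‖ ^ (s.re - 1 / 2) * Real.exp (-(s.arg * s.im)) := h3
    _ ≤ √(2 * Real.pi) * (3 / 2 * (1 + |s.im|) ^ (s.re - 1 / 2)) *
      (Real.exp (3 / 2) * Real.exp (-(Real.pi * |s.im| / 2))) := by gcongr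
    _ = _ := by ring

/-- One application of `Γ(s) = Γ(s+1) / s` carries the bound to the left of the pole at `0`. Staying
at distance `η` from it makes `1 + |Im s|` comparable to `|s|`. -/
theorem exists_gammaBound_of_neg {η : ℝ} (hη : 0 < η) :
    ∃ C : ℝ, 0 < C ∧ ∀ s ∈ closedStrip (-1 / 2) (-η), GammaBound C s := by
  obtain ⟨C, hC0, hC⟩ := exists_gammaBound
  refine ⟨C * (1 + η⁻¹), by positivity, fun s hs => ?_⟩
  have hs0 : s.re < 0 := lt_of_le_of_lt hs.2 (by linarith)
  have hne : s ≠ 0 := fun h0 => by simp [h0] at hs0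
  have h1 := hC (s + 1) ⟨by simp; linarith [hs.1], by simp; linarith⟩
  unfold GammaBound at h1 ⊢
  rw [Complex.Gamma_add_one s hne, norm_mul] at h1
  simp only [Complex.add_im, Complex.one_im, add_zero, Complex.add_re, Complex.one_re] at h1
  have h2 : 1 + |s.im| ≤ (1 + η⁻¹) * ‖s‖ := by
    have h3 := Complex.abs_im_le_norm s
    have h4 : η ≤ ‖s‖ := by
      refine le_trans ?_ (Complex.abs_re_le_norm s)
      rw [abs_of_neg hs0]; linarith [hs.2]
    have h5 : 1 ≤ η⁻¹ * ‖s‖ := by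
      rw [inv_mul_eq_div, one_le_div hη]; exact h4
    linarith
  have hn : 0 < ‖s‖ := norm_pos_iff.mpr hne
  rw [show s.re + 1 - 1 / 2 = (s.re - 1 / 2) + 1 by ring, Real.rpow_add_one (by positivity)] at h1
  have h6 : ‖s‖ * ‖Complex.Gamma s‖ ≤ ‖s‖ * (C * (1 + η⁻¹) * ((1 + |s.im|) ^ (s.re - 1 / 2) *
      Real.exp (-(Real.pi * |s.im| / 2)))) := by
    refine h1.trans ?_
    calc _ ≤ C * ((1 + |s.im|) ^ (s.re - 1 / 2) * ((1 + η⁻¹) * ‖s‖) *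
        Real.exp (-(Real.pi * |s.im| / 2))) := by gcongr
      _ = _ := by ring
  exact le_of_mul_le_mul_left h6 hn

/-- Peetre's inequality. It makes bounds for `Γ(w ± v)` uniform for `v` of bounded imaginary part.
-/
theorem one_add_abs_add_rpow_le (t y α : ℝ) :
    (1 + |t + y|) ^ α ≤ (1 + |t|) ^ α * (1 + |y|) ^ |α| := by
  rcases le_total 0 α with h | h
  · rw [abs_of_nonneg h, ← Real.mul_rpow (by positivity) (by positivity)]
    apply Real.rpow_le_rpow (by positivity) _ h
    nlinarith [abs_add_le t y, abs_nonneg t, abs_nonneg y, mul_nonneg (abs_nonneg t) (abs_nonneg y)]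
  · rw [abs_of_nonpos h]
    have h1 : (1 + |t|) / (1 + |y|) ≤ 1 + |t + y| := by
      rw [div_le_iff₀ (by positivity)]
      have := abs_sub_abs_le_abs_sub t (-y)
      rw [abs_neg, sub_neg_eq_add] at this
      nlinarith [abs_nonneg y, mul_nonneg (abs_nonneg (t + y)) (abs_nonneg y)]
    refine (Real.rpow_le_rpow_of_nonpos (by positivity) h1 h).trans (le_of_eq ?_)
    rw [Real.div_rpow (by positivity) (by positivity), Real.rpow_neg (by positivity), div_eq_mul_inv]

theorem norm_cos_pi_mul_le (w : ℂ) : ‖Complex.cos (Real.pi * w)‖ ≤ Real.exp (Real.pi * |w.im|) := by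
  rw [Complex.cos, norm_div, Complex.norm_ofNat]
  have h : ∀ z : ℂ, |z.im| ≤ Real.pi * |w.im| →
      ‖Complex.exp (z * Complex.I)‖ ≤ Real.exp (Real.pi * |w.im|) := by
    intro z hz
    rw [Complex.norm_exp]
    apply Real.exp_le_exp.mpr
    simp
    linarith [neg_abs_le z.im]
  have h1 := h (Real.pi * w) (by simp [abs_mul, abs_of_pos Real.pi_pos])
  have h2 := h (-(Real.pi * w)) (by simp [abs_mul, abs_of_pos Real.pi_pos])
  have := norm_add_le (Complex.exp (Real.pi * w * Complex.I))
    (Complex.exp (-(Real.pi * w) * Complex.I))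
  linarith

/-- Stirling's bound for the product `Γ(w - v) Γ(w + v)`. -/
theorem GammaBound.norm_mul_le {C Y : ℝ} {v w : ℂ} (h1 : GammaBound C (w - v))
    (h2 : GammaBound C (w + v)) (hC : 0 < C) (hv : |v.re| ≤ 1) (hY : |v.im| ≤ Y)
    (hw : |w.re| ≤ 2) :
    ‖Complex.Gamma (w - v) * Complex.Gamma (w + v)‖ ≤ C ^ 2 * (1 + Y) ^ (8 : ℝ) *
      ((1 + |w.im|) ^ (2 * w.re - 1) * Real.exp (-(Real.pi * |w.im|))) := by
  unfold GammaBound at h1 h2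
  rw [norm_mul]
  have hw' := abs_le.mp hw
  have hv' := abs_le.mp hv
  have hY0 : 0 ≤ Y := (abs_nonneg _).trans hY
  -- The exponents that occur are `Re(w ± v) - 1/2`, of absolute value at most `7/2`; the round
  -- value `4` is used for both and adds up to the `8` in the constant.
  have p : ∀ y α : ℝ, |y| ≤ Y → |α| ≤ 4 → (1 + |w.im + y|) ^ α ≤
      (1 + |w.im|) ^ α * (1 + Y) ^ (4 : ℝ) := by
    intro y α hy hα
    refine (one_add_abs_add_rpow_le _ _ _).trans ?_
    gcongr
    refine (Real.rpow_le_rpow (by positivity) (by linarith : 1 + |y| ≤ 1 + Y)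
      (abs_nonneg α)).trans ?_
    exact Real.rpow_le_rpow_of_exponent_le (by linarith) hα
  have p1 := p (-v.im) ((w - v).re - 1 / 2) (by rwa [abs_neg])
    (by rw [abs_le]; simp; constructor <;> linarith)
  have p2 := p v.im ((w + v).re - 1 / 2) hY
    (by rw [abs_le]; simp; constructor <;> linarith)
  rw [← sub_eq_add_neg] at p1
  have e1 : (1 + |w.im|) ^ ((w - v).re - 1 / 2) * (1 + |w.im|) ^ ((w + v).re - 1 / 2) =
      (1 + |w.im|) ^ (2 * w.re - 1) := by
    rw [← Real.rpow_add (by positivity)]; congr 1; simp; ring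
  have e2 : (1 + Y) ^ (4 : ℝ) * (1 + Y) ^ (4 : ℝ) = (1 + Y) ^ (8 : ℝ) := by
    rw [← Real.rpow_add (by positivity)]; norm_num
  have e3 : Real.exp (-(Real.pi * |(w - v).im| / 2)) * Real.exp (-(Real.pi * |(w + v).im| / 2)) ≤
      Real.exp (-(Real.pi * |w.im|)) := by
    rw [← Real.exp_add]
    apply Real.exp_le_exp.mpr
    have := abs_add_le (w - v).im (w + v).im
    rw [show (w - v).im + (w + v).im = 2 * w.im by simp; ring, abs_mul, abs_two] at this
    nlinarith [Real.pi_pos]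
  calc ‖Complex.Gamma (w - v)‖ * ‖Complex.Gamma (w + v)‖
      ≤ (C * ((1 + |(w - v).im|) ^ ((w - v).re - 1 / 2) *
          Real.exp (-(Real.pi * |(w - v).im| / 2)))) *
        (C * ((1 + |(w + v).im|) ^ ((w + v).re - 1 / 2) *
          Real.exp (-(Real.pi * |(w + v).im| / 2)))) :=
        mul_le_mul h1 h2 (norm_nonneg _) (by positivity)
    _ = C ^ 2 * ((1 + |w.im - v.im|) ^ ((w - v).re - 1 / 2) *
          (1 + |w.im + v.im|) ^ ((w + v).re - 1 / 2)) *
        (Real.exp (-(Real.pi * |(w - v).im| / 2)) *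
          Real.exp (-(Real.pi * |(w + v).im| / 2))) := by
        simp only [Complex.sub_im, Complex.add_im]; ring
    _ ≤ C ^ 2 * (((1 + |w.im|) ^ ((w - v).re - 1 / 2) * (1 + Y) ^ (4 : ℝ)) *
          ((1 + |w.im|) ^ ((w + v).re - 1 / 2) * (1 + Y) ^ (4 : ℝ))) *
        Real.exp (-(Real.pi * |w.im|)) := by gcongr
    _ = _ := by rw [← e1, ← e2]; ring

/-! ### The Barnes kernel and its decay on vertical lines. -/

/-- `cos(πw) Γ(w - v) Γ(w + v)`, up to scaling the Mellin transform of `k₀(·, v)` at `2w`. -/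
noncomputable def barnesKernel (v w : ℂ) : ℂ :=
  Complex.cos (Real.pi * w) * (Complex.Gamma (w - v) * Complex.Gamma (w + v))

/-- Uniformity in `v`, including `v` off the imaginary axis, is needed because the limit of `k₀` at
`v = 0` is taken over all complex directions. -/
theorem exists_norm_Gamma_mul_Gamma_le_neg {δ : ℝ} (hδ : 0 < δ) (hδ' : δ ≤ 1 / 4) (Y : ℝ) :
    ∃ C : ℝ, 0 < C ∧ ∀ v : ℂ, |v.re| ≤ δ / 2 → |v.im| ≤ Y → ∀ w : ℂ, w.re = -δ →
      ‖Complex.Gamma (w - v) * Complex.Gamma (w + v)‖ ≤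
        C * ((1 + |w.im|) ^ (-1 - 2 * δ) * Real.exp (-(Real.pi * |w.im|))) := by
  obtain ⟨C, hC0, hC⟩ := exists_gammaBound_of_neg (η := δ / 2) (by positivity)
  refine ⟨C ^ 2 * (1 + max Y 0) ^ (8 : ℝ), by positivity, fun v hv hY w hw => ?_⟩
  have hv' := abs_le.mp hv
  have h1 : GammaBound C (w - v) := hC _ ⟨by simp [hw]; linarith, by simp [hw]; linarith⟩
  have h2 : GammaBound C (w + v) := hC _ ⟨by simp [hw]; linarith, by simp [hw]; linarith⟩
  have := h1.norm_mul_le h2 hC0 (by linarith) (hY.trans (le_max_left Y 0))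
    (by rw [hw, abs_neg, abs_of_pos hδ]; linarith)
  rwa [hw, show 2 * -δ - 1 = -1 - 2 * δ by ring] at this

theorem exists_norm_Gamma_mul_Gamma_le {δ : ℝ} (hδ : 0 < δ) (hδ' : δ ≤ 1 / 4) (Y : ℝ) :
    ∃ C : ℝ, 0 < C ∧ ∀ v : ℂ, v.re = 0 → |v.im| ≤ Y → ∀ w : ℂ, w.re = 1 + δ →
      ‖Complex.Gamma (w - v) * Complex.Gamma (w + v)‖ ≤
        C * ((1 + |w.im|) ^ (1 + 2 * δ) * Real.exp (-(Real.pi * |w.im|))) := by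
  obtain ⟨C, hC0, hC⟩ := exists_gammaBound
  refine ⟨C ^ 2 * (1 + max Y 0) ^ (8 : ℝ), by positivity, fun v hv hY w hw => ?_⟩
  have h1 : GammaBound C (w - v) := hC _ ⟨by simp [hw, hv]; linarith, by simp [hw, hv]; linarith⟩
  have h2 : GammaBound C (w + v) := hC _ ⟨by simp [hw, hv]; linarith, by simp [hw, hv]; linarith⟩
  have := h1.norm_mul_le h2 hC0 (by rw [hv]; simp) (hY.trans (le_max_left Y 0))
    (by rw [hw, abs_of_pos (by linarith)]; linarith)
  rwa [hw, show 2 * (1 + δ) - 1 = 1 + 2 * δ by ring] at this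

theorem norm_cos_mul_le {z w : ℂ} {A : ℝ}
    (h : ‖z‖ ≤ A * Real.exp (-(Real.pi * |w.im|))) : ‖Complex.cos (Real.pi * w) * z‖ ≤ A := by
  rw [norm_mul]
  calc _ ≤ Real.exp (Real.pi * |w.im|) * (A * Real.exp (-(Real.pi * |w.im|))) :=
        mul_le_mul (norm_cos_pi_mul_le w) h (norm_nonneg _) (Real.exp_pos _).le
    _ = A := by rw [Real.exp_neg]; field_simp

/-- A Gaussian equal to `1` at `±v`. -/
noncomputable def gauss (v w : ℂ) : ℂ := Complex.exp (w ^ 2 - v ^ 2)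

theorem norm_gauss_le {Y : ℝ} {v w : ℂ} (hY : |v.im| ≤ Y) :
    ‖gauss v w‖ ≤ Real.exp (w.re ^ 2 + Y ^ 2 - w.im ^ 2) := by
  rw [gauss, Complex.norm_exp]
  apply Real.exp_le_exp.mpr
  simp [pow_two]
  have : v.im ^ 2 ≤ Y ^ 2 := by rw [← sq_abs]; exact pow_le_pow_left₀ (abs_nonneg _) hY 2
  nlinarith [sq_nonneg v.re]

theorem exists_norm_barnesKernel_mul_gauss_le {δ : ℝ} (hδ : 0 < δ) (hδ' : δ ≤ 1 / 4) (Y : ℝ) :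
    ∃ C : ℝ, 0 < C ∧ ∀ v : ℂ, |v.re| ≤ δ / 2 → |v.im| ≤ Y → ∀ w : ℂ, w.re = δ →
      ‖barnesKernel v w * gauss v w‖ ≤ C * (1 + |w.im|) ^ (-1 - 2 * δ) := by
  obtain ⟨C, hC⟩ := exists_norm_Gamma_le (a := δ / 2) (b := 3 * δ / 2) (by positivity)
  -- The `9` is the maximum of `6t - t²`, which dominates `πt + 2t - t²` for `t = |Im w|`: the
  -- growth of the cosine, the room for the polynomial weight, and the Gaussian.
  refine ⟨(C ^ 2 + 1) * Real.exp (δ ^ 2 + Y ^ 2 + 9), by positivity, fun v hv hY w hw => ?_⟩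
  have hv' := abs_le.mp hv
  have h1 := hC (w - v) ⟨by simp [hw]; linarith, by simp [hw]; linarith⟩
  have h2 := hC (w + v) ⟨by simp [hw]; linarith, by simp [hw]; linarith⟩
  have h3 := norm_gauss_le (w := w) hY
  rw [hw] at h3
  have h4 := norm_cos_pi_mul_le w
  have hC0 : 0 ≤ C := (norm_nonneg _).trans h1
  rw [barnesKernel, norm_mul, norm_mul, norm_mul]
  have h5 : (1 : ℝ) ≤ Real.exp (2 * |w.im|) * (1 + |w.im|) ^ (-1 - 2 * δ) := by
    have h6 : (1 + |w.im|) ^ (1 + 2 * δ) ≤ Real.exp (2 * |w.im|) := by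
      calc (1 + |w.im|) ^ (1 + 2 * δ) ≤ (1 + |w.im|) ^ (2 : ℝ) :=
            Real.rpow_le_rpow_of_exponent_le (by linarith [abs_nonneg w.im]) (by linarith)
        _ ≤ (Real.exp |w.im|) ^ (2 : ℝ) := by
            apply Real.rpow_le_rpow (by positivity) _ (by norm_num)
            linarith [Real.add_one_le_exp |w.im|]
        _ = _ := by rw [← Real.exp_mul]; ring_nf
    rw [show -1 - 2 * δ = -(1 + 2 * δ) by ring, Real.rpow_neg (by positivity), ← div_eq_mul_inv,
      le_div_iff₀ (by positivity), one_mul]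
    exact h6
  calc ‖Complex.cos (Real.pi * w)‖ * (‖Complex.Gamma (w - v)‖ * ‖Complex.Gamma (w + v)‖) *
        ‖gauss v w‖
      ≤ Real.exp (Real.pi * |w.im|) * (C * C) * Real.exp (δ ^ 2 + Y ^ 2 - w.im ^ 2) := by gcongr
    _ ≤ Real.exp (Real.pi * |w.im|) * (C ^ 2 + 1) * Real.exp (δ ^ 2 + Y ^ 2 - w.im ^ 2) *
        (Real.exp (2 * |w.im|) * (1 + |w.im|) ^ (-1 - 2 * δ)) := by
        refine le_trans ?_ (le_mul_of_one_le_right (by positivity) h5)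
        gcongr
        nlinarith
    _ = (C ^ 2 + 1) * (Real.exp (Real.pi * |w.im| + (δ ^ 2 + Y ^ 2 - w.im ^ 2) + 2 * |w.im|)) *
        (1 + |w.im|) ^ (-1 - 2 * δ) := by rw [Real.exp_add, Real.exp_add]; ring
    _ ≤ _ := by
        refine mul_le_mul_of_nonneg_right (mul_le_mul_of_nonneg_left (Real.exp_le_exp.mpr ?_)
          (by positivity)) (by positivity)
        have := Real.pi_lt_four
        rw [← sq_abs w.im]
        nlinarith [sq_nonneg (|w.im| - 3), abs_nonneg w.im]

/-- The growth of the cosine uses up the exponential decay of the two Gamma factors, leaving the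
power `2 Re w - 1`. It is integrable at `Re w = -δ`, which is why the undamped kernel is first
integrated to the left of its poles at `±v`. -/
theorem exists_norm_barnesKernel_le {δ : ℝ} (hδ : 0 < δ) (hδ' : δ ≤ 1 / 4) (Y : ℝ) :
    ∃ C : ℝ, 0 < C ∧ ∀ v : ℂ, |v.re| ≤ δ / 2 → |v.im| ≤ Y → ∀ w : ℂ, w.re = -δ →
      ‖barnesKernel v w‖ ≤ C * (1 + |w.im|) ^ (-1 - 2 * δ) := by
  obtain ⟨C, hC0, hC⟩ := exists_norm_Gamma_mul_Gamma_le_neg hδ hδ' Y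
  refine ⟨C, hC0, fun v hv hY w hw => norm_cos_mul_le ?_⟩
  rw [mul_assoc]
  exact hC v hv hY w hw

theorem exists_norm_barnesKernel_mul_one_sub_gauss_le {δ : ℝ} (hδ : 0 < δ) (hδ' : δ ≤ 1 / 4)
    (Y : ℝ) :
    ∃ C : ℝ, 0 < C ∧ ∀ v : ℂ, |v.re| ≤ δ / 2 → |v.im| ≤ Y → ∀ w : ℂ, w.re = -δ →
      ‖barnesKernel v w * (1 - gauss v w)‖ ≤ C * (1 + |w.im|) ^ (-1 - 2 * δ) := by
  obtain ⟨C, hC0, hC⟩ := exists_norm_barnesKernel_le hδ hδ' Y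
  refine ⟨C * (1 + Real.exp (δ ^ 2 + Y ^ 2)), by positivity, fun v hv hY w hw => ?_⟩
  rw [norm_mul]
  have h1 := hC v hv hY w hw
  have h2 : ‖1 - gauss v w‖ ≤ 1 + Real.exp (δ ^ 2 + Y ^ 2) := by
    refine (norm_sub_le _ _).trans ?_
    rw [norm_one]
    gcongr
    refine (norm_gauss_le hY).trans (Real.exp_le_exp.mpr ?_)
    rw [hw]
    nlinarith [sq_nonneg w.im]
  calc _ ≤ C * (1 + |w.im|) ^ (-1 - 2 * δ) * (1 + Real.exp (δ ^ 2 + Y ^ 2)) := by gcongr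
    _ = _ := by ring

/-- The Gaussian equals `1` at `±v`, and for `v = 0` its derivative there vanishes too. Inserting it
therefore changes no residue, even at a double pole. -/
theorem dslope_mul_gauss {G : ℂ → ℂ} {v : ℂ} (hG : DifferentiableAt ℂ G v) :
    dslope (fun w => G w * gauss v w) v (-v) = dslope G v (-v) := by
  by_cases hv : v = 0
  · subst hv
    simp only [neg_zero, dslope_same]
    have h2 : HasDerivAt (gauss 0) 0 0 := by
      have : HasDerivAt (fun w : ℂ => Complex.exp (w ^ 2 - 0 ^ 2)) 0 0 := by
        convert! ((hasDerivAt_pow 2 (0 : ℂ)).sub_const (0 ^ 2 : ℂ)).cexp using 1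
        simp
      exact this
    rw [(hG.hasDerivAt.fun_mul h2).deriv]
    simp [gauss]
  · have hne : -v ≠ v := fun h => hv (by simpa using self_eq_neg.mp h.symm)
    rw [dslope_of_ne _ hne, dslope_of_ne _ hne, slope_def_module, slope_def_module]
    simp [gauss]

/-! ### Residues of the Barnes kernel and the terms of the Bessel series. -/

theorem Gamma_add_one_eq_prod (m : ℕ) (z : ℂ) (hz : ∀ j : ℕ, j ≤ m → z - j ≠ 0) :
    Complex.Gamma (z + 1) = z * (∏ j ∈ Finset.range m, (z - (j + 1))) * Complex.Gamma (z - m) := by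
  induction m with
  | zero => simpa using Complex.Gamma_add_one z (by simpa using hz 0 le_rfl)
  | succ m ih =>
    rw [ih fun j hj => hz j (by omega), Finset.prod_range_succ]
    have h := Complex.Gamma_add_one (z - (m + 1)) (by simpa using hz (m + 1) le_rfl)
    rw [show z - (m + 1) + 1 = z - m by ring] at h
    rw [h]
    push_cast
    ring

section

variable {δ : ℝ} {v : ℂ}

theorem differentiableAt_Gamma_of_re_pos {s : ℂ} (hs : 0 < s.re) :
    DifferentiableAt ℂ Complex.Gamma s :=
  Complex.differentiableAt_Gamma s fun m h => by
    rw [h] at hs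
    simp at hs
    have : (0 : ℝ) ≤ m := m.cast_nonneg
    linarith

theorem differentiableAt_barnesKernel {w : ℂ}
    (h1 : ∀ m : ℕ, w - v ≠ -m) (h2 : ∀ m : ℕ, w + v ≠ -m) :
    DifferentiableAt ℂ (barnesKernel v) w := by
  refine DifferentiableAt.mul (by fun_prop) (DifferentiableAt.mul ?_ ?_)
  · exact (Complex.differentiableAt_Gamma _ h1).comp w (by fun_prop : DifferentiableAt ℂ (· - v) w)
  · exact (Complex.differentiableAt_Gamma _ h2).comp w (by fun_prop : DifferentiableAt ℂ (· + v) w)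

theorem ne_neg_natCast_of_re {z : ℂ} (h1 : -1 < z.re) (h2 : z.re ≠ 0) (m : ℕ) : z ≠ -m := by
  intro h
  have h3 := congrArg Complex.re h
  simp at h3
  rw [h3] at h1 h2
  have : (m : ℝ) < 1 := by linarith
  have : m = 0 := by
    have : m < 1 := by exact_mod_cast this
    omega
  simp [this] at h2

theorem continuous_barnesKernel_line {x : ℝ} (h1 : -1 < x - |v.re|) (h2 : |v.re| < |x|) :
    Continuous fun t : ℝ => barnesKernel v (x + t * Complex.I) := by
  have hb := abs_le.mp (le_refl |v.re|)
  have hx : x - v.re ≠ 0 ∧ x + v.re ≠ 0 := by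
    constructor
    · intro h; rw [sub_eq_zero.mp h] at h2; exact lt_irrefl _ h2
    · intro h; rw [eq_neg_of_add_eq_zero_left h, abs_neg] at h2; exact lt_irrefl _ h2
  refine continuous_iff_continuousAt.mpr fun t => ?_
  have hl : ContinuousAt (fun t : ℝ => (x + t * Complex.I : ℂ)) t := by fun_prop
  refine ContinuousAt.comp (g := barnesKernel v) (f := fun t : ℝ => (x + t * Complex.I : ℂ)) ?_ hl
  exact (differentiableAt_barnesKernel
    (ne_neg_natCast_of_re (by simp; linarith [hb.2]) (by simpa using hx.1))
    (ne_neg_natCast_of_re (by simp; linarith [hb.1]) (by simpa using hx.2))).continuousAt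

/-- The numerator of `barnesKernel v (w - m) * y ^ (-2 * (w - m))` over `(w - v) * (w + v)`. -/
noncomputable def barnesNumerator (v : ℂ) (y : ℝ) (m : ℕ) (w : ℂ) : ℂ :=
  Complex.cos (Real.pi * (w - m)) * (y : ℂ) ^ (-2 * (w - m)) *
    (Complex.Gamma (w - v + 1) * Complex.Gamma (w + v + 1)) *
    ((∏ j ∈ Finset.range m, (w - v - (j + 1))) * ∏ j ∈ Finset.range m, (w + v - (j + 1)))⁻¹

/-- Translation by `m` brings the poles at `±v - m` to `±v`, so every step of the leftward shift
happens in one fixed strip with the same two poles. -/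
theorem barnesKernel_mul_eq_barnesNumerator {y : ℝ} {m : ℕ} {w : ℂ}
    (h1 : ∀ j : ℕ, j ≤ m → w - v - j ≠ 0) (h2 : ∀ j : ℕ, j ≤ m → w + v - j ≠ 0) :
    barnesKernel v (w - m) * (y : ℂ) ^ (-2 * (w - m)) =
      barnesNumerator v y m w / ((w - v) * (w + v)) := by
  rw [barnesNumerator, barnesKernel, Gamma_add_one_eq_prod m _ h1, Gamma_add_one_eq_prod m _ h2]
  have p1 : (∏ j ∈ Finset.range m, (w - v - (j + 1))) ≠ 0 := Finset.prod_ne_zero_iff.mpr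
    fun j hj => by simpa using h1 (j + 1) (by simpa using hj)
  have p2 : (∏ j ∈ Finset.range m, (w + v - (j + 1))) ≠ 0 := Finset.prod_ne_zero_iff.mpr
    fun j hj => by simpa using h2 (j + 1) (by simpa using hj)
  have n1 : w - v ≠ 0 := by simpa using h1 0 (by simp)
  have n2 : w + v ≠ 0 := by simpa using h2 0 (by simp)
  rw [show w - m - v = w - v - m by ring, show w - m + v = w + v - m by ring]
  field_simp

theorem sub_natCast_ne_zero_of_re {z : ℂ} (hz : z.re < 1) (h0 : z ≠ 0) (j : ℕ) : z - j ≠ 0 := by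
  intro h
  rw [sub_eq_zero.mp h] at hz h0
  simp at hz
  simp [hz] at h0

theorem differentiableAt_barnesNumerator {y : ℝ} (hy : 0 < y) (m : ℕ) {w : ℂ}
    (h1 : -1 < w.re - |v.re|) (h2 : w.re + |v.re| < 1) :
    DifferentiableAt ℂ (barnesNumerator v y m) w := by
  have hb := abs_le.mp (le_refl |v.re|)
  have hy' : (y : ℂ) ≠ 0 := by exact_mod_cast hy.ne'
  refine DifferentiableAt.mul (DifferentiableAt.mul (DifferentiableAt.mul (by fun_prop) ?_)
    (DifferentiableAt.mul ?_ ?_)) (DifferentiableAt.inv ?_ ?_)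
  · exact DifferentiableAt.const_cpow (by fun_prop) (Or.inl hy')
  · refine (differentiableAt_Gamma_of_re_pos ?_).comp w
      (by fun_prop : DifferentiableAt ℂ (fun w => w - v + 1) w)
    simp; linarith
  · refine (differentiableAt_Gamma_of_re_pos ?_).comp w
      (by fun_prop : DifferentiableAt ℂ (fun w => w + v + 1) w)
    simp; linarith
  · fun_prop
  · refine mul_ne_zero (Finset.prod_ne_zero_iff.mpr fun j _ h => ?_)
      (Finset.prod_ne_zero_iff.mpr fun j _ h => ?_)
    · have h3 := congrArg Complex.re h
      simp at h3
      have : (0 : ℝ) ≤ j := j.cast_nonneg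
      linarith
    · have h3 := congrArg Complex.re h
      simp at h3
      have : (0 : ℝ) ≤ j := j.cast_nonneg
      linarith

theorem expGrowth_barnesNumerator {y : ℝ} (hy : 0 < y) (m : ℕ) {a b : ℝ}
    (h1 : -1 < a - |v.re|) : ExpGrowth a b (barnesNumerator v y m) := by
  have hb := abs_le.mp (le_refl |v.re|)
  have hy' : (y : ℂ) ≠ 0 := by exact_mod_cast hy.ne'
  have hG : ∀ u : ℂ, 0 < a + u.re → ExpGrowth a b fun w => Complex.Gamma (w + u) := by
    intro u hu
    obtain ⟨C, hC⟩ := exists_norm_Gamma_le (b := b + u.re) hu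
    exact ExpGrowth.of_bounded fun w hw => hC _ ⟨by simpa using hw.1, by simpa using hw.2⟩
  have hprod : ∀ u : ℂ, ExpGrowth a b fun w =>
      (∏ j ∈ Finset.range m, (w + u - (j + 1)))⁻¹ := by
    intro u
    induction m with
    | zero => simpa using ExpGrowth.const a b 1
    | succ m ih =>
      simp_rw [Finset.prod_range_succ, mul_inv]
      refine ih.mul ((ExpGrowth.inv_sub (m + 1 - u)).congr' (Eventually.of_forall fun w => ?_))
      simp only
      congr 1; ring
  have hcos : ExpGrowth a b fun w => Complex.cos (Real.pi * (w - m)) := by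
    simpa [sub_eq_add_neg] using (ExpGrowth.cos_const_mul (Real.pi : ℂ)).comp_add_const
      (a := a) (b := b) (w := (-m : ℂ))
  have hpow : ExpGrowth a b fun w => (y : ℂ) ^ (-2 * (w - m)) := by
    refine ((ExpGrowth.exp_const_mul (-2 * Complex.log y)).comp_add_const
      (a := a) (b := b) (w := (-m : ℂ))).congr' (Eventually.of_forall fun w => ?_)
    simp only [Complex.cpow_def_of_ne_zero hy']
    ring_nf
  have h := ((hcos.mul hpow).mul ((hG (-v + 1) (by simp; linarith)).mul
    (hG (v + 1) (by simp; linarith)))).mul ((hprod (-v)).mul (hprod v))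
  refine h.congr' (Eventually.of_forall fun w => ?_)
  simp only [barnesNumerator, mul_inv, sub_eq_add_neg, add_assoc]

theorem prod_range_neg_add_one (m : ℕ) :
    ∏ j ∈ Finset.range m, (0 - ((j : ℂ) + 1)) = (-1) ^ m * (m.factorial : ℂ) := by
  induction m with
  | zero => simp
  | succ m ih => rw [Finset.prod_range_succ, ih, Nat.factorial_succ]; push_cast; ring

theorem sin_pi_mul_ne_zero {z : ℂ} (hz : z ≠ 0) (h : |z.re| < 1) :
    Complex.sin (Real.pi * z) ≠ 0 := by
  intro h0
  obtain ⟨k, hk⟩ := Complex.sin_eq_zero_iff.mp h0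
  have hpi : (Real.pi : ℂ) ≠ 0 := by exact_mod_cast Real.pi_ne_zero
  rw [mul_comm] at hk
  have hzk := mul_right_cancel₀ hpi hk
  rw [hzk] at h hz
  simp at h hz
  have : |k| < 1 := by exact_mod_cast h
  exact hz (Int.abs_lt_one_iff.mp this)

/-- The residue at `v - m`: the reflection formula for `Γ(2v - m)` brings in `sin 2πv = 2 sin πv cos
πv`, whose cosine cancels that of the kernel. What remains is the `m`-th term of `J_{-2v}(2y)`. -/
theorem barnesNumerator_self_div (hv : v ≠ 0) (hv' : |v.re| < 1 / 2) (y : ℝ) (m : ℕ) :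
    barnesNumerator v y m v / (2 * v) = Real.pi / (2 * Complex.sin (Real.pi * v)) *
      (((-1 : ℂ) ^ m / (m.factorial : ℂ)) * (Complex.Gamma (m + -2 * v + 1))⁻¹ *
        (y : ℂ) ^ (2 * (m : ℂ) + -2 * v)) := by
  have hb := abs_lt.mp hv'
  have h2v : 2 * v ≠ 0 := mul_ne_zero two_ne_zero hv
  have hsub : ∀ j : ℕ, 2 * v - j ≠ 0 := sub_natCast_ne_zero_of_re (by simp; linarith) h2v
  have e1 := Gamma_add_one_eq_prod m (2 * v) fun j _ => hsub j
  have e2 := Complex.Gamma_mul_Gamma_one_sub (2 * v - m)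
  have hG : Complex.Gamma (m + -2 * v + 1) ≠ 0 := by
    apply Complex.Gamma_ne_zero_of_re_pos
    have : (0 : ℝ) ≤ m := m.cast_nonneg
    simp; linarith
  rw [show 1 - (2 * v - m) = m + -2 * v + 1 by ring,
    show Real.pi * (2 * v - m) = 2 * (Real.pi * v) - m * Real.pi by ring,
    Complex.sin_antiperiodic.sub_nat_mul_eq, Complex.sin_two_mul] at e2
  have hs2 := sin_pi_mul_ne_zero (z := 2 * v) h2v (by
    simp [abs_mul]; linarith)
  rw [show Real.pi * (2 * v) = 2 * (Real.pi * v) by ring, Complex.sin_two_mul] at hs2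
  have hs : Complex.sin (Real.pi * v) ≠ 0 := fun h => hs2 (by rw [h]; ring)
  have hc : Complex.cos (Real.pi * v) ≠ 0 := fun h => hs2 (by rw [h]; ring)
  have hp : ∏ j ∈ Finset.range m, (2 * v - ((j : ℂ) + 1)) ≠ 0 := Finset.prod_ne_zero_iff.mpr
    fun j _ => by simpa using hsub (j + 1)
  have e3 : Complex.Gamma (2 * v - m) = Real.pi / ((-1) ^ m *
      (2 * Complex.sin (Real.pi * v) * Complex.cos (Real.pi * v))) *
      (Complex.Gamma (m + -2 * v + 1))⁻¹ := by
    rw [← e2, mul_assoc, mul_inv_cancel₀ hG, mul_one]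
  rw [barnesNumerator, sub_self, zero_add, Complex.Gamma_one, prod_range_neg_add_one,
    ← two_mul, e1, show Real.pi * (v - m) = Real.pi * v - m * Real.pi by ring,
    Complex.cos_antiperiodic.sub_nat_mul_eq, e3, show -2 * (v - m) = 2 * (m : ℂ) + -2 * v by ring]
  have hf : (m.factorial : ℂ) ≠ 0 := by exact_mod_cast m.factorial_ne_zero
  have hm : ((-1 : ℂ) ^ m) * (-1) ^ m = 1 := by rw [← mul_pow]; simp
  have hm0 : ((-1 : ℂ) ^ m) ≠ 0 := by simp
  clear e1 e2 e3
  generalize Complex.Gamma (m + -2 * v + 1) = g at hG ⊢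
  generalize ∏ j ∈ Finset.range m, (2 * v - ((j : ℂ) + 1)) = P at hp ⊢
  generalize (y : ℂ) ^ (2 * (m : ℂ) + -2 * v) = Q
  field_simp
  linear_combination -Q * hm

theorem barnesNumerator_neg (v : ℂ) (y : ℝ) (m : ℕ) (w : ℂ) :
    barnesNumerator (-v) y m w = barnesNumerator v y m w := by
  simp only [barnesNumerator, sub_neg_eq_add, ← sub_eq_add_neg]
  ring

theorem dslope_barnesNumerator (hv : v ≠ 0) (hv' : |v.re| < 1 / 2) (y : ℝ) (m : ℕ) :
    dslope (barnesNumerator v y m) v (-v) = Real.pi / (2 * Complex.sin (Real.pi * v)) *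
      (((-1 : ℂ) ^ m / (m.factorial : ℂ)) * (Complex.Gamma (m + -2 * v + 1))⁻¹ *
        (y : ℂ) ^ (2 * (m : ℂ) + -2 * v) -
      ((-1 : ℂ) ^ m / (m.factorial : ℂ)) * (Complex.Gamma (m + 2 * v + 1))⁻¹ *
        (y : ℂ) ^ (2 * (m : ℂ) + 2 * v)) := by
  have hne : -v ≠ v := fun h => hv (by simpa using self_eq_neg.mp h.symm)
  have h1 := barnesNumerator_self_div hv hv' y m
  have h2 := barnesNumerator_self_div (neg_ne_zero.mpr hv) (by simpa using hv') y m
  rw [barnesNumerator_neg, mul_neg, mul_neg, Complex.sin_neg, show -2 * -v = 2 * v by ring] at h2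
  rw [dslope_of_ne _ hne, slope_def_module, smul_eq_mul]
  have e : (-v - v)⁻¹ * (barnesNumerator v y m (-v) - barnesNumerator v y m v) =
      barnesNumerator v y m v / (2 * v) + barnesNumerator v y m (-v) / -(2 * v) := by
    rw [show -v - v = -(2 * v) by ring, inv_neg]
    have : 2 * v ≠ 0 := mul_ne_zero two_ne_zero hv
    field_simp
    ring
  rw [e, h1, h2]
  ring

end

section

variable {δ : ℝ} {v : ℂ}

theorem integrable_one_add_abs_rpow {r : ℝ} (hr : r < -1) :
    Integrable fun t : ℝ => (1 + |t|) ^ r := by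
  have := integrable_one_add_norm (E := ℝ) (μ := volume) (r := -r) (by simpa using by linarith)
  simpa using this

theorem norm_ofReal_cpow {y : ℝ} (hy : 0 < y) (w : ℂ) : ‖(y : ℂ) ^ w‖ = y ^ w.re :=
  Complex.norm_cpow_eq_rpow_re_of_pos hy w

theorem continuous_ofReal_cpow_line {y : ℝ} (hy : 0 < y) (a b x : ℂ) :
    Continuous fun t : ℝ => (y : ℂ) ^ (a * (x + t * Complex.I) + b) :=
  Continuous.const_cpow (by fun_prop) (Or.inl (by exact_mod_cast hy.ne'))

theorem integrable_barnesKernel_mul_cpow (hδ : 0 < δ) (hδ' : δ ≤ 1 / 4) (hv : |v.re| ≤ δ / 2)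
    {y : ℝ} (hy : 0 < y) :
    Integrable fun t : ℝ => barnesKernel v ((-δ : ℝ) + t * Complex.I) *
      (y : ℂ) ^ (-2 * ((-δ : ℝ) + t * Complex.I : ℂ)) := by
  obtain ⟨C, hC0, hC⟩ := exists_norm_barnesKernel_le hδ hδ' |v.im|
  refine ((integrable_one_add_abs_rpow (r := -1 - 2 * δ) (by linarith)).const_mul
    (C * y ^ (2 * δ))).mono' ?_ (Eventually.of_forall fun t => ?_)
  · refine Continuous.aestronglyMeasurable (Continuous.mul ?_ ?_)
    · exact continuous_barnesKernel_line (by linarith)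
        (by rw [abs_neg, abs_of_pos hδ]; linarith)
    · simpa using continuous_ofReal_cpow_line hy (-2) 0 ((-δ : ℝ) : ℂ)
  · rw [norm_mul, norm_ofReal_cpow hy]
    have := hC v hv le_rfl ((-δ : ℝ) + t * Complex.I) (by simp)
    simp only [Complex.add_im, Complex.ofReal_im, Complex.mul_im, Complex.ofReal_re,
      Complex.I_im, mul_one, Complex.I_re, mul_zero, add_zero, zero_add] at this
    have e : (-2 * ((-δ : ℝ) + t * Complex.I : ℂ)).re = 2 * δ := by simp
    rw [e]
    calc _ ≤ C * (1 + |t|) ^ (-1 - 2 * δ) * y ^ (2 * δ) := by gcongr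
      _ = _ := by ring

theorem factorial_le_norm_prod {z : ℂ} (hz : z.re ≤ 0) (m : ℕ) :
    (m.factorial : ℝ) ≤ ‖∏ j ∈ Finset.range m, (z - ((j : ℂ) + 1))‖ := by
  induction m with
  | zero => simp
  | succ m ih =>
    rw [Finset.prod_range_succ, norm_mul, Nat.factorial_succ, mul_comm]
    push_cast
    refine mul_le_mul ih ?_ (by positivity) (norm_nonneg _)
    have h := Complex.abs_re_le_norm (z - ((m : ℂ) + 1))
    refine le_trans ?_ h
    rw [abs_of_neg]
    · simp; linarith
    · have : (0 : ℝ) ≤ m := m.cast_nonneg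
      simp; linarith

/-- Iterating `Γ(z+1) = z Γ(z)` compares the kernel on a far left line with the kernel on `Re w =
-δ`. Integrability and the decay `(y²)^m / m!` of the integrals then follow without Stirling bounds
far to the left. -/
theorem barnesKernel_sub_natCast_mul_cpow {y : ℝ} (hy : 0 < y) (m : ℕ) {w : ℂ}
    (h1 : (w - v).re < 0) (h2 : (w + v).re < 0) :
    barnesKernel v (w - m) * (y : ℂ) ^ (-2 * (w - m)) =
      barnesKernel v w * (y : ℂ) ^ (-2 * w) * ((-1) ^ m * (y : ℂ) ^ (2 * m) *
        ((∏ j ∈ Finset.range m, (w - v - ((j : ℂ) + 1))) *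
          ∏ j ∈ Finset.range m, (w + v - ((j : ℂ) + 1)))⁻¹) := by
  have key : ∀ z : ℂ, z.re < 0 → Complex.Gamma (z - m) =
      Complex.Gamma z * (∏ j ∈ Finset.range m, (z - ((j : ℂ) + 1)))⁻¹ := by
    intro z hz
    have hz0 : z ≠ 0 := fun h => by simp [h] at hz
    have h := Gamma_add_one_eq_prod m z fun j _ =>
      sub_natCast_ne_zero_of_re (by linarith) hz0 j
    rw [Complex.Gamma_add_one z hz0, mul_assoc] at h
    have hp : (∏ j ∈ Finset.range m, (z - ((j : ℂ) + 1))) ≠ 0 := Finset.prod_ne_zero_iff.mpr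
      fun j _ => by simpa using sub_natCast_ne_zero_of_re (by linarith) hz0 (j + 1)
    rw [mul_left_cancel₀ hz0 h]
    field_simp
  have hy' : (y : ℂ) ≠ 0 := by exact_mod_cast hy.ne'
  have e : (y : ℂ) ^ (-2 * (w - m)) = (y : ℂ) ^ (-2 * w) * (y : ℂ) ^ (2 * m) := by
    rw [show -2 * (w - m) = -2 * w + (2 * m : ℕ) by push_cast; ring, Complex.cpow_add _ _ hy',
      Complex.cpow_natCast]
  rw [barnesKernel, barnesKernel, show w - m - v = w - v - m by ring,
    show w - m + v = w + v - m by ring, key _ h1, key _ h2, e,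
    show Real.pi * (w - m) = Real.pi * w - m * Real.pi by ring,
    Complex.cos_antiperiodic.sub_nat_mul_eq, mul_inv]
  ring

theorem norm_barnes_factor_le {y : ℝ} (hy : 0 < y) (m : ℕ) {w : ℂ}
    (h1 : (w - v).re ≤ 0) (h2 : (w + v).re ≤ 0) :
    ‖(-1 : ℂ) ^ m * (y : ℂ) ^ (2 * m) * ((∏ j ∈ Finset.range m, (w - v - ((j : ℂ) + 1))) *
          ∏ j ∈ Finset.range m, (w + v - ((j : ℂ) + 1)))⁻¹‖ ≤ (y ^ 2) ^ m / m.factorial := by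
  have f1 := factorial_le_norm_prod h1 m
  have f2 := factorial_le_norm_prod h2 m
  have hf : (1 : ℝ) ≤ m.factorial := by exact_mod_cast m.factorial_pos
  rw [norm_mul, norm_mul, norm_pow, norm_pow, norm_neg, norm_one, one_pow, one_mul, norm_inv,
    norm_mul, Complex.norm_real, Real.norm_of_nonneg hy.le, pow_mul, ← div_eq_mul_inv]
  gcongr
  calc (m.factorial : ℝ) ≤ m.factorial * m.factorial := le_mul_of_one_le_right (by linarith) hf
    _ ≤ _ := by gcongr

theorem integrable_barnesKernel_sub_mul_cpow (hδ : 0 < δ) (hδ' : δ ≤ 1 / 4) (hv : |v.re| ≤ δ / 2)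
    {y : ℝ} (hy : 0 < y) (m : ℕ) :
    Integrable (fun t : ℝ => barnesKernel v ((-δ : ℝ) + t * Complex.I - m) *
      (y : ℂ) ^ (-2 * ((-δ : ℝ) + t * Complex.I - m : ℂ))) ∧
    ‖∫ t : ℝ, barnesKernel v ((-δ : ℝ) + t * Complex.I - m) *
      (y : ℂ) ^ (-2 * ((-δ : ℝ) + t * Complex.I - m : ℂ))‖ ≤
        (∫ t : ℝ, ‖barnesKernel v ((-δ : ℝ) + t * Complex.I) *
          (y : ℂ) ^ (-2 * ((-δ : ℝ) + t * Complex.I : ℂ))‖) * ((y ^ 2) ^ m / m.factorial) := by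
  have hv' := abs_le.mp hv
  have h1 : ∀ t : ℝ, (((-δ : ℝ) + t * Complex.I : ℂ) - v).re < 0 := fun t => by
    simp; linarith
  have h2 : ∀ t : ℝ, (((-δ : ℝ) + t * Complex.I : ℂ) + v).re < 0 := fun t => by
    simp; linarith
  simp_rw [fun t : ℝ => barnesKernel_sub_natCast_mul_cpow hy m (h1 t) (h2 t)]
  have h0 := integrable_barnesKernel_mul_cpow hδ hδ' hv hy
  have hb : ∀ t : ℝ, _ := fun t => norm_barnes_factor_le hy m (h1 t).le (h2 t).le
  refine ⟨h0.mul_bdd (Measurable.aestronglyMeasurable ?_) (Eventually.of_forall hb), ?_⟩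
  · exact Measurable.mul measurable_const (Measurable.inv
      (Continuous.measurable (by fun_prop)))
  · rw [← integral_mul_const]
    refine norm_integral_le_of_norm_le (h0.norm.mul_const _) (Eventually.of_forall fun t => ?_)
    rw [norm_mul]
    gcongr
    exact hb t

theorem integral_barnes_step (hδ : 0 < δ) (hδ' : δ ≤ 1 / 4) (hv : |v.re| ≤ δ / 2)
    {y : ℝ} (hy : 0 < y) (m : ℕ) :
    (∫ t : ℝ, barnesKernel v ((-δ : ℝ) + t * Complex.I - m) *
      (y : ℂ) ^ (-2 * ((-δ : ℝ) + t * Complex.I - m : ℂ))) -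
    (∫ t : ℝ, barnesKernel v ((-δ : ℝ) + t * Complex.I - (m + 1 : ℕ)) *
      (y : ℂ) ^ (-2 * ((-δ : ℝ) + t * Complex.I - (m + 1 : ℕ) : ℂ))) =
    2 * Real.pi * dslope (barnesNumerator v y (m + 1)) v (-v) := by
  have hv' := abs_le.mp hv
  -- The right edge of the strip for the translate by `m + 1` is the left edge for the translate by
  -- `m`, so consecutive steps telescope.
  have hshift : ∀ t : ℝ, ((1 - δ : ℝ) + t * Complex.I - (m + 1 : ℕ) : ℂ) =
      (-δ : ℝ) + t * Complex.I - m := fun t => by push_cast; ring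
  have hFG : ∀ w ∈ closedStrip (-δ) (1 - δ), w ≠ v → w ≠ -v →
      barnesKernel v (w - (m + 1 : ℕ)) * (y : ℂ) ^ (-2 * (w - (m + 1 : ℕ))) =
        barnesNumerator v y (m + 1) w / ((w - v) * (w - -v)) := by
    intro w hw h1 h2
    rw [sub_neg_eq_add]
    refine barnesKernel_mul_eq_barnesNumerator (fun j _ => ?_) (fun j _ => ?_)
    · exact sub_natCast_ne_zero_of_re (by simp; linarith [hw.2]) (sub_ne_zero.mpr h1) j
    · exact sub_natCast_ne_zero_of_re (by simp; linarith [hw.2])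
        (by rwa [ne_eq, ← sub_neg_eq_add, sub_eq_zero]) j
  have := integral_sub_integral_eq_dslope (a := -δ) (b := 1 - δ) (p := v) (q := -v)
    (F := fun w => barnesKernel v (w - (m + 1 : ℕ)) * (y : ℂ) ^ (-2 * (w - (m + 1 : ℕ))))
    (G := barnesNumerator v y (m + 1)) ⟨by linarith, by linarith⟩
    ⟨by simp; linarith, by simp; linarith⟩
    (fun w hw => (differentiableAt_barnesNumerator hy (m + 1) (by linarith [hw.1])
      (by linarith [hw.2])).differentiableWithinAt) hFG ?_
      (integrable_barnesKernel_sub_mul_cpow hδ hδ' hv hy (m + 1)).1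
      (by simpa only [hshift] using (integrable_barnesKernel_sub_mul_cpow hδ hδ' hv hy m).1)
  · simpa only [hshift] using this
  · refine (((expGrowth_barnesNumerator hy (m + 1) (by linarith)).mul (ExpGrowth.inv_sub v)).mul
      (ExpGrowth.inv_sub (-v))).congr' ?_
    filter_upwards [eventually_stripFilter_ne _ _ v, eventually_stripFilter_ne _ _ (-v),
      mem_inf_of_right (mem_principal_self _)] with w h1 h2 hw
    rw [hFG w hw h1 h2, div_eq_mul_inv, mul_inv, mul_assoc]

end

/-! ### Mellin-Barnes form of `k₀`, regular at `v = 0`. -/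

theorem summable_besselJ {ν : ℂ} (hν : |ν.re| < 1) (y : ℝ) (hy : 0 < y) :
    Summable fun m : ℕ => ((-1 : ℂ) ^ m / (m.factorial : ℂ)) * (Complex.Gamma (m + ν + 1))⁻¹ *
      (y : ℂ) ^ (2 * (m : ℂ) + ν) := by
  have hν' := abs_lt.mp hν
  have hy' : (y : ℂ) ≠ 0 := by exact_mod_cast hy.ne'
  refine summable_of_ratio_norm_eventually_le (r := 1 / 2) (by norm_num) ?_
  -- The ratio of consecutive terms is at most `y² / ((m+1) m)` in norm, since `|Re ν| < 1` gives
  -- `|m + ν + 1| ≥ m`. It is below `1/2` once `m ≥ 2y²` and `m ≥ 1`.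
  obtain ⟨N, hN⟩ := exists_nat_ge (2 * y ^ 2)
  filter_upwards [eventually_ge_atTop (max N 1)] with m hm
  have hm1 : (1 : ℝ) ≤ m := by exact_mod_cast (le_max_right N 1).trans hm
  have hmN : (N : ℝ) ≤ m := by exact_mod_cast (le_max_left N 1).trans hm
  have hne : (m : ℂ) + ν + 1 ≠ 0 := by
    intro h
    have := congrArg Complex.re h
    simp at this; linarith
  have hnorm : (m : ℝ) ≤ ‖(m : ℂ) + ν + 1‖ := by
    refine le_trans ?_ ((le_abs_self _).trans (Complex.abs_re_le_norm _))
    simp; linarith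
  have e1 : Complex.Gamma ((m + 1 : ℕ) + ν + 1) = (m + ν + 1) * Complex.Gamma (m + ν + 1) := by
    rw [← Complex.Gamma_add_one _ hne]; push_cast; ring_nf
  have e2 : (y : ℂ) ^ (2 * ((m + 1 : ℕ) : ℂ) + ν) = (y : ℂ) ^ (2 * (m : ℂ) + ν) * y ^ 2 := by
    rw [show 2 * ((m + 1 : ℕ) : ℂ) + ν = 2 * (m : ℂ) + ν + (2 : ℕ) by push_cast; ring,
      Complex.cpow_add _ _ hy', Complex.cpow_natCast]
  rw [e1, e2, Nat.factorial_succ]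
  have e3 : (-1 : ℂ) ^ (m + 1) / ((m + 1) * m.factorial : ℕ) *
      ((m + ν + 1) * Complex.Gamma (m + ν + 1))⁻¹ * ((y : ℂ) ^ (2 * (m : ℂ) + ν) * y ^ 2) =
      (-1 * y ^ 2 / ((m + 1) * (m + ν + 1))) * ((-1) ^ m / m.factorial *
        (Complex.Gamma (m + ν + 1))⁻¹ * (y : ℂ) ^ (2 * (m : ℂ) + ν)) := by
    push_cast
    simp only [div_eq_mul_inv, mul_inv]
    ring
  rw [e3, norm_mul]
  gcongr
  have hm2 : ‖(m : ℂ) + 1‖ = m + 1 := by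
    have : (m : ℂ) + 1 = ((m + 1 : ℝ) : ℂ) := by push_cast; rfl
    rw [this, Complex.norm_real, Real.norm_of_nonneg (by linarith)]
  rw [norm_div, norm_mul, norm_mul, norm_neg, norm_one, one_mul, norm_pow, Complex.norm_real,
    Real.norm_of_nonneg hy.le, hm2, div_le_div_iff₀ (by nlinarith) (by norm_num)]
  nlinarith

/-- The Mellin-Barnes integral of `k₀`, with the pole terms written as a difference of integrals
against a Gaussian over the lines `Re w = ±δ`. -/
noncomputable def kernelIntegral (δ : ℝ) (v : ℂ) (y : ℝ) : ℂ :=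
  (∫ t : ℝ, barnesKernel v (δ + t * Complex.I) * gauss v (δ + t * Complex.I) *
    (y : ℂ) ^ (-2 * (δ + t * Complex.I))) +
  ∫ t : ℝ, barnesKernel v ((-δ : ℝ) + t * Complex.I) * (1 - gauss v ((-δ : ℝ) + t * Complex.I)) *
    (y : ℂ) ^ (-2 * ((-δ : ℝ) + t * Complex.I))

section

variable {δ : ℝ} {v : ℂ}

theorem continuous_gauss_line (v : ℂ) (x : ℝ) :
    Continuous fun t : ℝ => gauss v (x + t * Complex.I) := by
  unfold gauss; fun_prop

theorem integrable_barnesKernel_mul_gauss (hδ : 0 < δ) (hδ' : δ ≤ 1 / 4) (hv : |v.re| ≤ δ / 2) :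
    Integrable fun t : ℝ => barnesKernel v (δ + t * Complex.I) *
      gauss v (δ + t * Complex.I) := by
  obtain ⟨C, hC0, hC⟩ := exists_norm_barnesKernel_mul_gauss_le hδ hδ' |v.im|
  refine ((integrable_one_add_abs_rpow (r := -1 - 2 * δ) (by linarith)).const_mul C).mono' ?_
    (Eventually.of_forall fun t => ?_)
  · exact ((continuous_barnesKernel_line (by linarith)
      (by rw [abs_of_pos hδ]; linarith)).mul (continuous_gauss_line _ _)).aestronglyMeasurable
  · simpa using hC v hv le_rfl (δ + t * Complex.I) (by simp)

theorem integrable_barnesKernel_mul_one_sub_gauss (hδ : 0 < δ) (hδ' : δ ≤ 1 / 4)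
    (hv : |v.re| ≤ δ / 2) :
    Integrable fun t : ℝ => barnesKernel v ((-δ : ℝ) + t * Complex.I) *
      (1 - gauss v ((-δ : ℝ) + t * Complex.I)) := by
  obtain ⟨C, hC0, hC⟩ := exists_norm_barnesKernel_mul_one_sub_gauss_le hδ hδ' |v.im|
  refine ((integrable_one_add_abs_rpow (r := -1 - 2 * δ) (by linarith)).const_mul C).mono' ?_
    (Eventually.of_forall fun t => ?_)
  · exact ((continuous_barnesKernel_line (by linarith)
      (by rw [abs_neg, abs_of_pos hδ]; linarith)).mul
        (continuous_const.sub (continuous_gauss_line _ _))).aestronglyMeasurable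
  · simpa using hC v hv le_rfl ((-δ : ℝ) + t * Complex.I) (by simp)

theorem integrable_mul_cpow_line {f : ℝ → ℂ} (hf : Integrable f) {y : ℝ} (hy : 0 < y) (x : ℝ) :
    Integrable fun t : ℝ => f t * (y : ℂ) ^ (-2 * (x + t * Complex.I)) := by
  refine hf.mul_bdd (c := y ^ (-2 * x)) ?_ (Eventually.of_forall fun t => ?_)
  · simpa using (continuous_ofReal_cpow_line hy (-2) 0 x).aestronglyMeasurable
  · rw [norm_ofReal_cpow hy]
    simp

theorem barnesKernel_mul_eq_barnesNumerator_zero (y : ℝ) {w : ℂ} (h1 : w ≠ v) (h2 : w ≠ -v) :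
    barnesKernel v w * (y : ℂ) ^ (-2 * w) = barnesNumerator v y 0 w / ((w - v) * (w - -v)) := by
  have := barnesKernel_mul_eq_barnesNumerator (v := v) (y := y) (m := 0) (w := w)
    (fun j hj => by simpa [Nat.le_zero.mp hj] using sub_ne_zero.mpr h1)
    (fun j hj => by
      simpa [Nat.le_zero.mp hj] using fun h => h2 (eq_neg_of_add_eq_zero_left h))
  simpa using this

theorem expGrowth_gauss (v : ℂ) (a b : ℝ) : ExpGrowth a b (gauss v) := by
  refine ExpGrowth.of_bounded (C := Real.exp ((max |a| |b|) ^ 2 + |v.im| ^ 2)) fun w hw => ?_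
  refine (norm_gauss_le le_rfl).trans (Real.exp_le_exp.mpr ?_)
  have h2 : w.re ^ 2 ≤ (max |a| |b|) ^ 2 := by
    rw [← sq_abs]
    exact pow_le_pow_left₀ (abs_nonneg _) (abs_le_max_abs_abs hw.1 hw.2) 2
  nlinarith [sq_nonneg w.im]

/-- With the Gaussian the kernel is integrable on both sides of the poles at `±v`, so the leading
pair of residues becomes a difference of two absolutely convergent integrals. -/
theorem integral_barnes_gauss (hδ : 0 < δ) (hδ' : δ ≤ 1 / 4) (hv : |v.re| ≤ δ / 2)
    {y : ℝ} (hy : 0 < y) :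
    (∫ t : ℝ, barnesKernel v (δ + t * Complex.I) * gauss v (δ + t * Complex.I) *
      (y : ℂ) ^ (-2 * (δ + t * Complex.I))) -
    (∫ t : ℝ, barnesKernel v ((-δ : ℝ) + t * Complex.I) * gauss v ((-δ : ℝ) + t * Complex.I) *
      (y : ℂ) ^ (-2 * ((-δ : ℝ) + t * Complex.I))) =
    2 * Real.pi * dslope (barnesNumerator v y 0) v (-v) := by
  have hv' := abs_le.mp hv
  rw [← dslope_mul_gauss (differentiableAt_barnesNumerator hy 0 (by
    rcases abs_cases v.re with h | h <;> linarith) (by rcases abs_cases v.re with h | h <;> linarith))]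
  have hFG : ∀ w ∈ closedStrip (-δ) δ, w ≠ v → w ≠ -v →
      barnesKernel v w * gauss v w * (y : ℂ) ^ (-2 * w) =
        barnesNumerator v y 0 w * gauss v w / ((w - v) * (w - -v)) := by
    intro w _ h1 h2
    rw [mul_right_comm, barnesKernel_mul_eq_barnesNumerator_zero y h1 h2, div_mul_eq_mul_div]
  refine integral_sub_integral_eq_dslope (a := -δ) (b := δ) (p := v) (q := -v)
    (F := fun w => barnesKernel v w * gauss v w * (y : ℂ) ^ (-2 * w))
    (G := fun w => barnesNumerator v y 0 w * gauss v w) ⟨by linarith, by linarith⟩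
    ⟨by simp; linarith, by simp; linarith⟩ ?_ hFG ?_ ?_ ?_
  · intro w hw
    refine ((differentiableAt_barnesNumerator hy 0 (by linarith [hw.1])
      (by linarith [hw.2])).mul ?_).differentiableWithinAt
    unfold gauss; fun_prop
  · refine ((((expGrowth_barnesNumerator hy 0 (by linarith)).mul (expGrowth_gauss v _ _)).mul
      (ExpGrowth.inv_sub v)).mul (ExpGrowth.inv_sub (-v))).congr' ?_
    filter_upwards [eventually_stripFilter_ne _ _ v, eventually_stripFilter_ne _ _ (-v),
      mem_inf_of_right (mem_principal_self _)] with w h1 h2 hw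
    rw [hFG w hw h1 h2, div_eq_mul_inv, mul_inv, mul_assoc]
  · have h := (integrable_barnesKernel_mul_cpow hδ hδ' hv hy).mul_bdd
      (c := Real.exp (δ ^ 2 + |v.im| ^ 2)) (continuous_gauss_line v (-δ)).aestronglyMeasurable
      (Eventually.of_forall fun t => by
        refine (norm_gauss_le le_rfl).trans (Real.exp_le_exp.mpr ?_)
        simp; nlinarith [sq_nonneg t])
    refine h.congr (Eventually.of_forall fun t => ?_)
    simp only
    ring
  · exact integrable_mul_cpow_line (integrable_barnesKernel_mul_gauss hδ hδ' hv) hy δ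

/-- The shifts telescope: the partial sum of residues differs from `kernelIntegral` by the integral
over `Re w = -δ - N`, which is `O((y²)^N / N!)`. -/
theorem tendsto_sum_dslope_barnesNumerator (hδ : 0 < δ) (hδ' : δ ≤ 1 / 4) (hv : |v.re| ≤ δ / 2)
    {y : ℝ} (hy : 0 < y) :
    Tendsto (fun N : ℕ => 2 * Real.pi * ∑ m ∈ Finset.range (N + 1),
      dslope (barnesNumerator v y m) v (-v)) atTop (𝓝 (kernelIntegral δ v y)) := by
  set J : ℕ → ℂ := fun m => ∫ t : ℝ, barnesKernel v ((-δ : ℝ) + t * Complex.I - m) *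
      (y : ℂ) ^ (-2 * ((-δ : ℝ) + t * Complex.I - m : ℂ)) with hJ
  have h0 : kernelIntegral δ v y = 2 * Real.pi * dslope (barnesNumerator v y 0) v (-v) + J 0 := by
    rw [← integral_barnes_gauss hδ hδ' hv hy, kernelIntegral, sub_add_eq_add_sub, eq_sub_iff_add_eq,
      add_assoc, ← integral_add]
    · congr 2 with t
      simp only [Nat.cast_zero, sub_zero]
      ring
    · exact integrable_mul_cpow_line (integrable_barnesKernel_mul_one_sub_gauss hδ hδ' hv) hy (-δ)
    · have h := (integrable_barnesKernel_mul_cpow hδ hδ' hv hy).mul_bdd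
        (c := Real.exp (δ ^ 2 + |v.im| ^ 2)) (continuous_gauss_line v (-δ)).aestronglyMeasurable
        (Eventually.of_forall fun t => by
          refine (norm_gauss_le le_rfl).trans (Real.exp_le_exp.mpr ?_)
          simp; nlinarith [sq_nonneg t])
      refine h.congr (Eventually.of_forall fun t => ?_)
      simp only
      ring
  have hsum : ∀ N : ℕ, 2 * Real.pi * ∑ m ∈ Finset.range (N + 1),
      dslope (barnesNumerator v y m) v (-v) = kernelIntegral δ v y - J N := by
    intro N
    induction N with
    | zero => rw [h0]; simp
    | succ N ih =>
      have := integral_barnes_step hδ hδ' hv hy N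
      rw [Finset.sum_range_succ, mul_add, ih, ← this]
      simp only [hJ]
      ring
  simp_rw [hsum]
  have hJ0 : Tendsto J atTop (𝓝 0) := by
    refine squeeze_zero_norm (fun m => (integrable_barnesKernel_sub_mul_cpow hδ hδ' hv hy m).2) ?_
    simpa using (FloorSemiring.tendsto_pow_div_factorial_atTop (y ^ 2)).const_mul _
  simpa using hJ0.const_sub (kernelIntegral δ v y)

/-- The residues sum to `π / (2 sin πv)` times `J_{-2v}(x) - J_{2v}(x)`, and `cos(π(1/2 + v)) = -sin
πv` matches sign and denominator with `k₀`. -/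
theorem k₀_eq_kernelIntegral (hδ : 0 < δ) (hδ' : δ ≤ 1 / 4) (hv : |v.re| ≤ δ / 2) (hv0 : v ≠ 0)
    {x : ℝ} (hx : 0 < x) : k₀ x v = (2 * Real.pi ^ 2 : ℂ)⁻¹ * kernelIntegral δ v (x / 2) := by
  have h1 := tendsto_sum_dslope_barnesNumerator hδ hδ' hv (half_pos hx)
  simp_rw [dslope_barnesNumerator hv0 (by linarith : |v.re| < 1 / 2), ← Finset.mul_sum,
    Finset.sum_sub_distrib] at h1
  have hs1 := (summable_besselJ (ν := -2 * v) (by simp [abs_mul]; linarith) _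
    (half_pos hx)).hasSum.tendsto_sum_nat.comp (tendsto_add_atTop_nat 1)
  have hs2 := (summable_besselJ (ν := 2 * v) (by simp [abs_mul]; linarith) _
    (half_pos hx)).hasSum.tendsto_sum_nat.comp (tendsto_add_atTop_nat 1)
  have h2 := tendsto_nhds_unique h1 (((hs1.sub hs2).const_mul _).const_mul _)
  rw [h2, k₀, besselJ, besselJ, show (Real.pi * (1 / 2 + v) : ℂ) = Real.pi * v + Real.pi / 2 by ring,
    Complex.cos_add_pi_div_two]
  have hs := sin_pi_mul_ne_zero hv0 (by linarith)
  have hpi : (Real.pi : ℂ) ≠ 0 := by exact_mod_cast Real.pi_ne_zero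
  field_simp
  ring

/-- The lines `Re w = ±δ` keep away from the poles for all small `v`, and the bounds are uniform, so
dominated convergence sees no singularity at `v = 0`. This is the source of the limit of `k₀`. -/
theorem tendsto_kernelIntegral (hδ : 0 < δ) (hδ' : δ ≤ 1 / 4) {y : ℝ} (hy : 0 < y) :
    Tendsto (fun v => kernelIntegral δ v y) (𝓝 0) (𝓝 (kernelIntegral δ 0 y)) := by
  have hev : ∀ᶠ v : ℂ in 𝓝 0, |v.re| ≤ δ / 2 ∧ |v.im| ≤ 1 := by
    have h1 : ∀ᶠ v : ℂ in 𝓝 0, |v.re| < δ / 2 :=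
      (by fun_prop : Continuous fun v : ℂ => |v.re|).tendsto 0 |>.eventually_lt_const
        (by simpa using by positivity)
    have h2 : ∀ᶠ v : ℂ in 𝓝 0, |v.im| < 1 :=
      (by fun_prop : Continuous fun v : ℂ => |v.im|).tendsto 0 |>.eventually_lt_const (by simp)
    filter_upwards [h1, h2] with v a b using ⟨a.le, b.le⟩
  have hcont : ∀ w : ℂ, |w.re| = δ → ContinuousAt (fun v => barnesKernel v w) 0 := by
    intro w hw
    have hw1 := abs_le.mp hw.le
    have hw0 : w.re ≠ 0 := fun h => by rw [h] at hw; simp at hw; linarith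
    refine ContinuousAt.mul continuousAt_const (ContinuousAt.mul ?_ ?_)
    · refine ContinuousAt.comp (g := Complex.Gamma) (f := fun v => w - v)
        (Complex.differentiableAt_Gamma _ ?_).continuousAt (by fun_prop)
      exact ne_neg_natCast_of_re (by simp; linarith [hw1.1]) (by simpa)
    · refine ContinuousAt.comp (g := Complex.Gamma) (f := fun v => w + v)
        (Complex.differentiableAt_Gamma _ ?_).continuousAt (by fun_prop)
      exact ne_neg_natCast_of_re (by simp; linarith [hw1.1]) (by simpa)
  have hgauss : ∀ w : ℂ, ContinuousAt (fun v => gauss v w) 0 := fun w => by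
    unfold gauss; fun_prop
  have hint := integrable_one_add_abs_rpow (r := -1 - 2 * δ) (by linarith)
  refine Tendsto.add ?_ ?_
  · obtain ⟨C, hC0, hC⟩ := exists_norm_barnesKernel_mul_gauss_le hδ hδ' 1
    refine tendsto_integral_filter_of_dominated_convergence
      (fun t : ℝ => C * (1 + |t|) ^ (-1 - 2 * δ) * y ^ (-2 * δ)) ?_ ?_
      ((hint.const_mul C).mul_const _) (Eventually.of_forall fun t => ?_)
    · filter_upwards [hev] with v hv
      exact (integrable_mul_cpow_line
        (integrable_barnesKernel_mul_gauss hδ hδ' hv.1) hy δ).aestronglyMeasurable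
    · filter_upwards [hev] with v hv
      refine Eventually.of_forall fun t => ?_
      rw [norm_mul, norm_ofReal_cpow hy]
      have := hC v hv.1 hv.2 (δ + t * Complex.I) (by simp)
      simp at this ⊢
      gcongr
    · exact (((hcont _ (by simp [abs_of_pos hδ])).mul (hgauss _)).mul continuousAt_const).tendsto
  · obtain ⟨C, hC0, hC⟩ := exists_norm_barnesKernel_mul_one_sub_gauss_le hδ hδ' 1
    refine tendsto_integral_filter_of_dominated_convergence
      (fun t : ℝ => C * (1 + |t|) ^ (-1 - 2 * δ) * y ^ (-2 * -δ)) ?_ ?_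
      ((hint.const_mul C).mul_const _) (Eventually.of_forall fun t => ?_)
    · filter_upwards [hev] with v hv
      exact (integrable_mul_cpow_line
        (integrable_barnesKernel_mul_one_sub_gauss hδ hδ' hv.1) hy (-δ)).aestronglyMeasurable
    · filter_upwards [hev] with v hv
      refine Eventually.of_forall fun t => ?_
      rw [norm_mul, norm_ofReal_cpow hy]
      have := hC v hv.1 hv.2 ((-δ : ℝ) + t * Complex.I) (by simp)
      simp at this ⊢
      gcongr
    · exact (((hcont _ (by simp [abs_of_pos hδ])).mul
        (continuousAt_const.sub (hgauss _))).mul continuousAt_const).tendsto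

end

/-! ### The Mellin transform of `K_{2v}`. -/

/-- The logistic parametrisation of `(0, 1)`. -/
theorem logistic_facts :
    (∀ t : ℝ, HasDerivAt (fun t : ℝ => (1 + Real.exp (-2 * t))⁻¹)
      (2 * ((Real.exp t / (2 * Real.cosh t)) * (Real.exp (-t) / (2 * Real.cosh t)))) t) ∧
    (∀ t : ℝ, (1 + Real.exp (-2 * t))⁻¹ = Real.exp t / (2 * Real.cosh t)) ∧
    (∀ t : ℝ, 1 - (1 + Real.exp (-2 * t))⁻¹ = Real.exp (-t) / (2 * Real.cosh t)) ∧
    Function.Injective (fun t : ℝ => (1 + Real.exp (-2 * t))⁻¹) ∧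
    range (fun t : ℝ => (1 + Real.exp (-2 * t))⁻¹) = Ioo 0 1 := by
  have h1 : ∀ t : ℝ, (1 + Real.exp (-2 * t))⁻¹ = Real.exp t / (2 * Real.cosh t) := fun t => by
    rw [Real.cosh_eq, show -2 * t = -t + -t by ring, Real.exp_add, Real.exp_neg]
    have := Real.exp_pos t
    field_simp
  have h2 : ∀ t : ℝ, 1 - (1 + Real.exp (-2 * t))⁻¹ = Real.exp (-t) / (2 * Real.cosh t) :=
    fun t => by
      rw [h1, Real.cosh_eq]
      have := Real.exp_pos t
      have := Real.exp_pos (-t)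
      field_simp
      ring
  refine ⟨fun t => ?_, h1, h2, ?_, ?_⟩
  · have h3 : HasDerivAt (fun t : ℝ => 1 + Real.exp (-2 * t)) (Real.exp (-2 * t) * -2) t := by
      simpa using (((hasDerivAt_id t).const_mul (-2)).exp).const_add 1
    convert! h3.fun_inv (by positivity) using 1
    rw [← h1, ← h2]
    have := Real.exp_pos (-2 * t)
    field_simp
    ring
  · intro a b h
    simpa using h
  · ext y
    constructor
    · rintro ⟨t, rfl⟩
      have := Real.exp_pos (-2 * t)
      exact ⟨by positivity, inv_lt_one_of_one_lt₀ (by linarith)⟩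
    · rintro ⟨hy0, hy1⟩
      refine ⟨-Real.log (y⁻¹ - 1) / 2, ?_⟩
      have : 0 < y⁻¹ - 1 := by
        rw [sub_pos]; exact (one_lt_inv₀ hy0).mpr hy1
      simp only
      rw [show -2 * (-Real.log (y⁻¹ - 1) / 2) = Real.log (y⁻¹ - 1) by ring, Real.exp_log this]
      simp

/-- Euler's Beta integral under `x = e^t / (2 cosh t)`, for which `1 - x = e^{-t} / (2 cosh t)` and
`dx = 2 x (1 - x) dt`. -/
theorem beta_logistic {a b : ℂ} (ha : 0 < a.re) (hb : 0 < b.re) :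
    Integrable (fun t : ℝ => Complex.exp ((a - b) * t) *
      ((2 * Real.cosh t : ℝ) : ℂ) ^ (-(a + b))) ∧
    ∫ t : ℝ, Complex.exp ((a - b) * t) * ((2 * Real.cosh t : ℝ) : ℂ) ^ (-(a + b)) =
      Complex.betaIntegral a b / 2 := by
  obtain ⟨hderiv, h1, h2, hinj, hrange⟩ := logistic_facts
  have key : ∀ t : ℝ, |2 * ((Real.exp t / (2 * Real.cosh t)) * (Real.exp (-t) / (2 * Real.cosh t)))| •
      ((((1 + Real.exp (-2 * t))⁻¹ : ℝ) : ℂ) ^ (a - 1) *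
        (1 - (((1 + Real.exp (-2 * t))⁻¹ : ℝ) : ℂ)) ^ (b - 1)) =
      2 * (Complex.exp ((a - b) * t) * ((2 * Real.cosh t : ℝ) : ℂ) ^ (-(a + b))) := by
    intro t
    have hc := Real.cosh_pos t
    have hcpow : ∀ z : ℂ, ((2 * Real.cosh t : ℝ) : ℂ) ^ z =
        Complex.exp (Real.log (2 * Real.cosh t) * z) := fun z => by
      rw [Complex.cpow_def_of_ne_zero (by exact_mod_cast (by positivity : 2 * Real.cosh t ≠ 0)),
        Complex.ofReal_log (by positivity)]
    have hp : ∀ u : ℝ, ∀ z : ℂ, ((Real.exp u / (2 * Real.cosh t) : ℝ) : ℂ) ^ (z - 1) *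
        ((Real.exp u / (2 * Real.cosh t) : ℝ) : ℂ) =
          Complex.exp ((u - Real.log (2 * Real.cosh t)) * z) := by
      intro u z
      have hne : ((Real.exp u / (2 * Real.cosh t) : ℝ) : ℂ) ≠ 0 := by
        exact_mod_cast (by positivity : Real.exp u / (2 * Real.cosh t) ≠ 0)
      rw [Complex.cpow_sub _ _ hne, Complex.cpow_one, div_mul_cancel₀ _ hne,
        Complex.cpow_def_of_ne_zero hne, ← Complex.ofReal_log (by positivity),
        Real.log_div (Real.exp_pos u).ne' (by positivity), Real.log_exp]
      push_cast; rfl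
    have e : (1 : ℂ) - (((1 + Real.exp (-2 * t))⁻¹ : ℝ) : ℂ) =
        ((Real.exp (-t) / (2 * Real.cosh t) : ℝ) : ℂ) := by
      rw [← h2]; push_cast; rfl
    rw [abs_of_pos (by positivity), Complex.real_smul, e, h1, hcpow]
    push_cast only [Complex.ofReal_mul]
    have p1 := hp t a
    have p2 := hp (-t) b
    calc _ = 2 * ((((Real.exp t / (2 * Real.cosh t) : ℝ) : ℂ) ^ (a - 1) *
        ((Real.exp t / (2 * Real.cosh t) : ℝ) : ℂ)) *
        (((Real.exp (-t) / (2 * Real.cosh t) : ℝ) : ℂ) ^ (b - 1) *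
        ((Real.exp (-t) / (2 * Real.cosh t) : ℝ) : ℂ))) := by push_cast; ring
      _ = _ := by
        rw [p1, p2, ← Complex.exp_add, ← Complex.exp_add]
        push_cast
        ring_nf
  have hI : IntegrableOn (fun x : ℝ => (x : ℂ) ^ (a - 1) * (1 - (x : ℂ)) ^ (b - 1)) (Ioo 0 1) := by
    have := Complex.betaIntegral_convergent ha hb
    rw [intervalIntegrable_iff_integrableOn_Ioo_of_le zero_le_one] at this
    exact this
  have himg : (fun t : ℝ => (1 + Real.exp (-2 * t))⁻¹) '' univ = Ioo 0 1 := by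
    rw [image_univ, hrange]
  rw [← himg] at hI
  have hI2 := (integrableOn_image_iff_integrableOn_abs_deriv_smul MeasurableSet.univ
    (fun t _ => (hderiv t).hasDerivWithinAt) hinj.injOn _).mp hI
  have hE := integral_image_eq_integral_abs_deriv_smul MeasurableSet.univ
    (fun t _ => (hderiv t).hasDerivWithinAt) hinj.injOn
    (fun x : ℝ => (x : ℂ) ^ (a - 1) * (1 - (x : ℂ)) ^ (b - 1))
  simp_rw [key] at hI2 hE
  rw [himg, setIntegral_univ, integral_const_mul] at hE
  rw [integrableOn_univ] at hI2
  refine ⟨?_, ?_⟩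
  · have := hI2.const_mul (1 / 2 : ℂ)
    refine this.congr (Eventually.of_forall fun t => ?_)
    simp only
    ring
  · rw [Complex.betaIntegral, intervalIntegral.integral_of_le zero_le_one,
      integral_Ioc_eq_integral_Ioo, hE]
    ring

section

variable {v w : ℂ}

theorem norm_cosh_mul_le (hv : v.re = 0) (t : ℝ) : ‖Complex.cosh (2 * v * t)‖ ≤ 1 := by
  have h : 2 * v * t = ((2 * v.im * t : ℝ) : ℂ) * Complex.I := by
    apply Complex.ext <;> simp [hv]
  rw [h, Complex.cosh_mul_I, ← Complex.ofReal_cos, Complex.norm_real]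
  exact Real.abs_cos_le_one _

theorem integrable_inv_cosh_rpow {a : ℝ} (ha : 0 < a) :
    Integrable fun t : ℝ => (1 / Real.cosh t) ^ (2 * a) := by
  have h := (beta_logistic (a := a) (b := a) (by simpa) (by simpa)).1.norm.const_mul (2 ^ (2 * a))
  refine h.congr (Eventually.of_forall fun t => ?_)
  have hc := Real.cosh_pos t
  simp only [sub_self, zero_mul, Complex.exp_zero, one_mul]
  rw [norm_ofReal_cpow (by positivity), show (-(a + a) : ℂ).re = -(2 * a) by simp; ring,
    Real.mul_rpow (by norm_num) hc.le, one_div, Real.inv_rpow hc.le, Real.rpow_neg (by norm_num),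
    Real.rpow_neg hc.le]
  have : (0 : ℝ) < 2 ^ (2 * a) := by positivity
  field_simp

theorem measurable_mellin_besselK_integrand (v w : ℂ) :
    Measurable fun p : ℝ × ℝ => (p.1 : ℂ) ^ (2 * w - 1) *
      ((Real.exp (-p.1 * Real.cosh p.2) : ℂ) * Complex.cosh (2 * v * p.2)) := by
  refine Measurable.mul ?_ (Continuous.measurable (by fun_prop))
  exact (Complex.measurable_ofReal.comp measurable_fst).pow_const _

theorem integrable_mellin_besselK_integrand (hv : v.re = 0) (hw : 0 < w.re) :
    Integrable (fun p : ℝ × ℝ => (p.1 : ℂ) ^ (2 * w - 1) *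
      ((Real.exp (-p.1 * Real.cosh p.2) : ℂ) * Complex.cosh (2 * v * p.2)))
      ((volume.restrict (Ioi 0)).prod (volume.restrict (Ioi 0))) := by
  have hn : ∀ t : ℝ, ∀ x ∈ Ioi (0 : ℝ), ‖(x : ℂ) ^ (2 * w - 1) *
      ((Real.exp (-x * Real.cosh t) : ℂ) * Complex.cosh (2 * v * t))‖ =
      x ^ (2 * w.re - 1) * Real.exp (-(Real.cosh t * x)) * ‖Complex.cosh (2 * v * t)‖ := by
    intro t x hx
    rw [norm_mul, norm_mul, norm_ofReal_cpow hx, Complex.norm_real,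
      Real.norm_of_nonneg (Real.exp_pos _).le]
    simp
    ring_nf
  have hi : ∀ t : ℝ, IntegrableOn
      (fun x : ℝ => x ^ (2 * w.re - 1) * Real.exp (-(Real.cosh t * x))) (Ioi 0) := by
    intro t
    have := Real.integral_rpow_mul_exp_neg_mul_Ioi (a := 2 * w.re) (by linarith) (Real.cosh_pos t)
    -- A non-integrable function has integral `0` by convention, while the known value is positive.
    by_contra hcon
    rw [integral_undef hcon] at this
    have hG := Real.Gamma_pos_of_pos (by linarith : 0 < 2 * w.re)
    have hc := Real.cosh_pos t
    have : 0 < (1 / Real.cosh t) ^ (2 * w.re) * Real.Gamma (2 * w.re) := by positivity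
    linarith
  rw [integrable_prod_iff' (measurable_mellin_besselK_integrand v w).aestronglyMeasurable]
  refine ⟨Eventually.of_forall fun t => ?_, ?_⟩
  · refine ((hi t).mul_const ‖Complex.cosh (2 * v * t)‖).mono' ?_ ?_
    · exact ((measurable_mellin_besselK_integrand v w).comp
        (measurable_id.prodMk measurable_const)).aestronglyMeasurable
    · exact (ae_restrict_iff' measurableSet_Ioi).mpr
        (Eventually.of_forall fun x hx => (hn t x hx).le)
  · have h1 : ∀ t : ℝ, ∫ x in Ioi (0 : ℝ), ‖(x : ℂ) ^ (2 * w - 1) *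
        ((Real.exp (-x * Real.cosh t) : ℂ) * Complex.cosh (2 * v * t))‖ =
        (1 / Real.cosh t) ^ (2 * w.re) * (Real.Gamma (2 * w.re) * ‖Complex.cosh (2 * v * t)‖) := by
      intro t
      rw [setIntegral_congr_fun measurableSet_Ioi (hn t), integral_mul_const,
        Real.integral_rpow_mul_exp_neg_mul_Ioi (by linarith) (Real.cosh_pos t)]
      ring
    simp_rw [h1]
    refine (integrable_inv_cosh_rpow hw).integrableOn.mul_bdd (c := Real.Gamma (2 * w.re)) ?_ ?_
    · exact Continuous.aestronglyMeasurable (by fun_prop)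
    · refine Eventually.of_forall fun t => ?_
      have hG := Real.Gamma_pos_of_pos (by linarith : 0 < 2 * w.re)
      rw [norm_mul, norm_norm, Real.norm_of_nonneg hG.le]
      exact mul_le_of_le_one_right hG.le (norm_cosh_mul_le hv t)

theorem integral_cosh_mul_inv_cosh (h1 : 0 < (w + v).re) (h2 : 0 < (w - v).re) :
    ∫ t in Ioi (0 : ℝ), Complex.cosh (2 * v * t) * ((2 * Real.cosh t : ℝ) : ℂ) ^ (-(2 * w)) =
      Complex.betaIntegral (w + v) (w - v) / 4 := by
  obtain ⟨hi, he⟩ := beta_logistic h1 h2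
  simp only [show w + v - (w - v) = 2 * v by ring, show w + v + (w - v) = 2 * w by ring] at hi he
  rw [← integral_add_compl (measurableSet_Ioi (a := (0 : ℝ))) hi, compl_Ioi] at he
  have h3 := integral_comp_neg_Ioi (0 : ℝ) (fun t : ℝ =>
    Complex.exp (2 * v * t) * ((2 * Real.cosh t : ℝ) : ℂ) ^ (-(2 * w)))
  rw [neg_zero] at h3
  rw [← h3, ← integral_add hi.integrableOn] at he
  · have h4 : ∀ t : ℝ, Complex.cosh (2 * v * t) * ((2 * Real.cosh t : ℝ) : ℂ) ^ (-(2 * w)) =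
        (1 / 2 : ℂ) * (Complex.exp (2 * v * t) * ((2 * Real.cosh t : ℝ) : ℂ) ^ (-(2 * w)) +
          Complex.exp (2 * v * (-t : ℝ)) * ((2 * Real.cosh (-t) : ℝ) : ℂ) ^ (-(2 * w))) := by
      intro t
      rw [Real.cosh_neg, Complex.cosh]
      push_cast
      ring_nf
    simp_rw [h4]
    rw [integral_const_mul, he]
    ring
  · exact hi.comp_neg.integrableOn

/-- Fubini in the defining integral: the `x`-integral gives `Γ(2w) (cosh t)^{-2w}`, the `t`-integral
is then a Beta integral at `(w + v, w - v)`, and `Γ(2w)` times this Beta value is the product of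
Gammas. -/
theorem mellin_besselK (hv : v.re = 0) (hw : 0 < w.re) :
    MellinConvergent (besselK (2 * v)) (2 * w) ∧ mellin (besselK (2 * v)) (2 * w) =
      2 ^ (2 * w - 2) * (Complex.Gamma (w - v) * Complex.Gamma (w + v)) := by
  have hint := integrable_mellin_besselK_integrand hv hw
  have hK : ∀ x : ℝ, (x : ℂ) ^ (2 * w - 1) • besselK (2 * v) x =
      ∫ t in Ioi (0 : ℝ), (x : ℂ) ^ (2 * w - 1) *
        ((Real.exp (-x * Real.cosh t) : ℂ) * Complex.cosh (2 * v * t)) := by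
    intro x
    rw [besselK, smul_eq_mul, integral_const_mul]
  refine ⟨?_, ?_⟩
  · rw [MellinConvergent]
    simp_rw [hK]
    exact hint.integral_prod_left
  · rw [mellin]
    simp_rw [hK]
    rw [integral_integral_swap hint]
    have h1 : ∀ t : ℝ, ∫ x in Ioi (0 : ℝ), (x : ℂ) ^ (2 * w - 1) *
        ((Real.exp (-x * Real.cosh t) : ℂ) * Complex.cosh (2 * v * t)) =
        Complex.Gamma (2 * w) * 2 ^ (2 * w) *
          (Complex.cosh (2 * v * t) * ((2 * Real.cosh t : ℝ) : ℂ) ^ (-(2 * w))) := by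
      intro t
      have hc := Real.cosh_pos t
      have h2 := Complex.integral_cpow_mul_exp_neg_mul_Ioi (a := 2 * w) (r := (Real.cosh t : ℝ))
        (by simpa using hw) (by simpa using hc)
      have h3 : (1 / ((Real.cosh t : ℝ) : ℂ)) ^ (2 * w) =
          2 ^ (2 * w) * ((2 * Real.cosh t : ℝ) : ℂ) ^ (-(2 * w)) := by
        rw [one_div, Complex.inv_cpow, Complex.cpow_neg, Complex.ofReal_mul,
          Complex.mul_cpow_ofReal_nonneg (by norm_num) hc.le, mul_inv]
        · have : (((2 : ℝ) : ℂ)) ^ (2 * w) ≠ 0 := by simp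
          rw [← mul_assoc, show (2 : ℂ) ^ (2 * w) = (((2 : ℝ) : ℂ)) ^ (2 * w) by norm_num,
            mul_inv_cancel₀ this, one_mul]
        · rw [Complex.arg_ofReal_of_nonneg hc.le]; exact Real.pi_pos.ne
      rw [h3] at h2
      rw [show Complex.Gamma (2 * w) * 2 ^ (2 * w) * (Complex.cosh (2 * v * t) *
        ((2 * Real.cosh t : ℝ) : ℂ) ^ (-(2 * w))) = (2 ^ (2 * w) * ((2 * Real.cosh t : ℝ) : ℂ) ^
          (-(2 * w)) * Complex.Gamma (2 * w)) * Complex.cosh (2 * v * t) by ring, ← h2,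
        ← integral_mul_const]
      congr 1 with x
      push_cast
      ring_nf
    simp_rw [h1]
    have hwv : 0 < (w - v).re := by simpa [hv] using hw
    have hwv' : 0 < (w + v).re := by simpa [hv] using hw
    rw [integral_const_mul, integral_cosh_mul_inv_cosh hwv' hwv,
      mul_comm (Complex.Gamma (w - v)), Complex.Gamma_mul_Gamma_eq_betaIntegral hwv' hwv,
      show w + v + (w - v) = 2 * w by ring, Complex.cpow_sub _ _ two_ne_zero]
    norm_num
    ring

end

/-! ### The Estermann function: Dirichlet series, polar part, functional equation. -/

section

variable {c : ℕ} [NeZero c]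

/-- The Estermann function, the continuation of `∑ τ_v(n) e(nu/c) n^{-s}`. -/
noncomputable def estermann (u : ZMod c) (v s : ℂ) : ℂ :=
  ZMod.LFunction (fun a : ZMod c => HurwitzZeta.expZeta (ZMod.toAddCircle (u * a)) (s - v)) (s + v)

theorem hasSum_LFunction (Φ : ZMod c → ℂ) {s : ℂ} (hs : 1 < s.re) :
    HasSum (fun n : ℕ+ => Φ (n : ℕ) * (n : ℂ) ^ (-s)) (ZMod.LFunction Φ s) := by
  have h := (ZMod.LSeriesSummable_of_one_lt_re Φ hs).LSeriesHasSum
  rw [← ZMod.LFunction_eq_LSeries Φ hs, LSeriesHasSum,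
    ← PNat.coe_injective.hasSum_iff (fun n hn => ?_)] at h
  · refine h.congr_fun fun n => ?_
    rw [Function.comp_apply, LSeries.term_of_ne_zero n.ne_zero, Complex.cpow_neg, div_eq_mul_inv]
  · have : n = 0 := by
      by_contra h0
      exact hn ⟨⟨n, Nat.pos_of_ne_zero h0⟩, rfl⟩
    rw [this, LSeries.term_zero]

theorem norm_stdAddChar (j : ZMod c) : ‖ZMod.stdAddChar j‖ = 1 := by
  rw [ZMod.stdAddChar_apply, Circle.norm_coe]

theorem norm_pnat_cpow (n : ℕ+) (s : ℂ) : ‖(n : ℂ) ^ s‖ = (n : ℝ) ^ s.re :=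
  Complex.norm_natCast_cpow_of_pos n.pos s

theorem summable_pnat_rpow {σ : ℝ} (hσ : 1 < σ) : Summable fun n : ℕ+ => (n : ℝ) ^ (-σ) := by
  have := (Real.summable_nat_rpow (p := -σ)).mpr (by linarith)
  exact this.comp_injective PNat.coe_injective

theorem div_cpow_mul_cpow {a b : ℕ} (ha : 0 < a) (hb : 0 < b) (v s : ℂ) :
    ((a : ℂ) / b) ^ v * ((a * b : ℕ) : ℂ) ^ (-s) = (a : ℂ) ^ (-(s - v)) * (b : ℂ) ^ (-(s + v)) := by
  have ha' : (a : ℂ) ≠ 0 := by exact_mod_cast ha.ne'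
  have hb' : (b : ℂ) ≠ 0 := by exact_mod_cast hb.ne'
  have h1 : ((a : ℂ) / b) ^ v * (b : ℂ) ^ v = (a : ℂ) ^ v := by
    have := Complex.mul_cpow_ofReal_nonneg (a := (a : ℝ) / b) (b := b) (by positivity)
      (by positivity) v
    push_cast at this
    rw [← this, div_mul_cancel₀ _ hb']
  have h2 : (b : ℂ) ^ v ≠ 0 := by simp [Complex.cpow_eq_zero_iff, hb']
  rw [← mul_left_inj' h2, mul_right_comm, h1, Nat.cast_mul, Complex.natCast_mul_natCast_cpow,
    mul_assoc ((a : ℂ) ^ (-(s - v))), ← Complex.cpow_add _ _ hb', ← mul_assoc,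
    ← Complex.cpow_add _ _ ha']
  ring_nf

theorem summable_estermann_pairs (u : ZMod c) {v s : ℂ} (hv : v.re = 0) (hs : 1 < s.re) :
    Summable fun p : ℕ+ × ℕ+ => ‖(p.1 : ℂ) ^ (-(s - v)) * (p.2 : ℂ) ^ (-(s + v)) *
      ZMod.stdAddChar (u * ((p.1 * p.2 : ℕ) : ZMod c))‖ := by
  have h := (summable_pnat_rpow hs).mul_of_nonneg (summable_pnat_rpow hs)
    (fun n => by positivity) (fun n => by positivity)
  refine h.congr fun p => ?_
  rw [norm_mul, norm_mul, norm_stdAddChar, mul_one, norm_pnat_cpow, norm_pnat_cpow]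
  simp [hv]

theorem sum_divisors_eq_tau_mul (u : ZMod c) (v s : ℂ) (n : ℕ+) :
    ∑ p : Nat.divisorsAntidiagonal n, (p.1.1 : ℂ) ^ (-(s - v)) * (p.1.2 : ℂ) ^ (-(s + v)) *
      ZMod.stdAddChar (u * ((p.1.1 * p.1.2 : ℕ) : ZMod c)) =
    tau v n * ZMod.stdAddChar (u * ((n : ℕ) : ZMod c)) * (n : ℂ) ^ (-s) := by
  rw [Finset.univ_eq_attach, Finset.sum_attach (Nat.divisorsAntidiagonal n)
    (fun p : ℕ × ℕ => (p.1 : ℂ) ^ (-(s - v)) * (p.2 : ℂ) ^ (-(s + v)) *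
      ZMod.stdAddChar (u * ((p.1 * p.2 : ℕ) : ZMod c))), tau, Finset.sum_mul, Finset.sum_mul]
  refine Finset.sum_congr rfl fun p hp => ?_
  obtain ⟨h1, h2⟩ := Nat.mem_divisorsAntidiagonal.mp hp
  have hp1 : 0 < p.1 := Nat.pos_of_ne_zero fun h => h2 (by rw [← h1, h, zero_mul])
  have hp2 : 0 < p.2 := Nat.pos_of_ne_zero fun h => h2 (by rw [← h1, h, mul_zero])
  rw [← div_cpow_mul_cpow hp1 hp2, h1]
  ring

/-- One absolutely convergent double series over `(n₁, n₂)` is summed in two ways. Summing over `n₁`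
first gives a periodic zeta value depending on `n₂` mod `c`; grouping by `n₁ n₂ = n` gives `τ_v(n)`.
-/
theorem hasSum_estermann (u : ZMod c) {v s : ℂ} (hv : v.re = 0) (hs : 1 < s.re) :
    HasSum (fun n : ℕ+ => tau v n * ZMod.stdAddChar (u * ((n : ℕ) : ZMod c)) * (n : ℂ) ^ (-s))
      (estermann u v s) := by
  have hsum := (summable_estermann_pairs u hv hs).of_norm.hasSum
  set T : ℕ+ × ℕ+ → ℂ := fun p => (p.1 : ℂ) ^ (-(s - v)) * (p.2 : ℂ) ^ (-(s + v)) *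
      ZMod.stdAddChar (u * ((p.1 * p.2 : ℕ) : ZMod c)) with hT
  have h1 : HasSum (fun n : ℕ+ => HurwitzZeta.expZeta (ZMod.toAddCircle (u * ((n : ℕ) : ZMod c))) (s - v) *
      (n : ℂ) ^ (-(s + v))) (∑' p, T p) := by
    rw [← (Equiv.prodComm ℕ+ ℕ+).hasSum_iff] at hsum
    refine hsum.prod_fiberwise fun n => ?_
    have hs' : 1 < (s - v).re := by simpa [hv] using hs
    have h2 := (hasSum_LFunction (fun k => ZMod.stdAddChar (u * ((n : ℕ) : ZMod c) * k)) hs').mul_right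
      ((n : ℂ) ^ (-(s + v)))
    rw [ZMod.LFunction_stdAddChar_eq_expZeta _ _
      (Or.inr fun h => by rw [h] at hs'; simp at hs')] at h2
    refine h2.congr_fun fun k => ?_
    simp only [hT, Function.comp_apply, Equiv.prodComm_apply, Prod.swap_prod_mk]
    rw [show u * ((n : ℕ) : ZMod c) * ((k : ℕ) : ZMod c) = u * ((k * n : ℕ) : ZMod c) by push_cast; ring]
    ring
  have h2 : estermann u v s = ∑' p, T p := by
    refine (hasSum_LFunction (fun a : ZMod c =>
      HurwitzZeta.expZeta (ZMod.toAddCircle (u * a)) (s - v)) ?_).unique h1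
    simpa [hv] using hs
  rw [h2]
  rw [← sigmaAntidiagonalEquivProd.hasSum_iff] at hsum
  refine hsum.sigma fun n => ?_
  rw [← sum_divisors_eq_tau_mul u v s n]
  exact hasSum_fintype _

theorem summable_norm_tau_mul_rpow {v : ℂ} (hv : v.re = 0) {σ : ℝ} (hσ : 1 < σ) :
    Summable fun n : ℕ+ => ‖tau v n‖ * (n : ℝ) ^ (-σ) := by
  -- Modulus `1` makes the additive character trivial, so the double series controls `τ_v` alone.
  have h := summable_estermann_pairs (c := 1) 0 hv (s := σ) (by simpa)
  rw [← sigmaAntidiagonalEquivProd.summable_iff] at h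
  refine h.sigma.of_nonneg_of_le (fun n => by positivity) fun n => ?_
  rw [tsum_fintype]
  have h1 := sum_divisors_eq_tau_mul (c := 1) 0 v σ n
  have h2 := congrArg norm h1
  rw [norm_mul, norm_mul, norm_stdAddChar, mul_one, norm_pnat_cpow] at h2
  rw [Complex.neg_re, Complex.ofReal_re] at h2
  rw [← h2]
  exact norm_sum_le _ _

theorem sum_expZeta {z : ℂ} (hz : z ≠ 1) :
    ∑ a : ZMod c, HurwitzZeta.expZeta (ZMod.toAddCircle a) z =
      (c : ℂ) ^ (1 - z) * riemannZeta z := by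
  classical
  have hc : (c : ℂ) ≠ 0 := Nat.cast_ne_zero.mpr (NeZero.ne c)
  simp_rw [← fun a : ZMod c => ZMod.LFunction_stdAddChar_eq_expZeta a z (Or.inr hz), ZMod.LFunction]
  rw [← Finset.mul_sum, Finset.sum_comm]
  simp_rw [← Finset.sum_mul, AddChar.sum_mulShift _ (ZMod.isPrimitive_stdAddChar c)]
  simp only [Nat.cast_ite, Nat.cast_zero, ite_mul, zero_mul, Finset.sum_ite_eq', Finset.mem_univ,
    if_true, map_zero, HurwitzZeta.hurwitzZeta_zero, ZMod.card]
  rw [sub_eq_add_neg, Complex.cpow_add _ _ hc, Complex.cpow_one]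
  ring

/-- The entire part of the Estermann function. -/
noncomputable def estermannRegular (u : ZMod c) (v s : ℂ) : ℂ :=
  (c : ℂ) ^ (-(s + v)) * ∑ a ∈ Finset.univ.filter (fun a : ZMod c => a ≠ 0),
    HurwitzZeta.expZeta (ZMod.toAddCircle (u * a)) (s - v) *
      (HurwitzZeta.hurwitzZeta (ZMod.toAddCircle a) (s + v) -
        HurwitzZeta.hurwitzZeta 0 (s + v))

theorem differentiable_estermannRegular (u : (ZMod c)ˣ) (v : ℂ) :
    Differentiable ℂ (estermannRegular (u : ZMod c) v) := by
  have hc : (c : ℂ) ≠ 0 := Nat.cast_ne_zero.mpr (NeZero.ne c)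
  refine Differentiable.mul (fun s => DifferentiableAt.const_cpow (by fun_prop) (Or.inl hc))
    (Differentiable.fun_sum fun a ha => ?_)
  have ha0 : (ZMod.toAddCircle ((u : ZMod c) * a)) ≠ 0 := by
    rw [ne_eq, ZMod.toAddCircle_eq_zero, Units.mul_right_eq_zero]
    exact (Finset.mem_filter.mp ha).2
  refine Differentiable.mul ?_ ?_
  · exact (HurwitzZeta.differentiable_expZeta_of_ne_zero ha0).comp (by fun_prop)
  · exact (HurwitzZeta.differentiable_hurwitzZeta_sub_hurwitzZeta (ZMod.toAddCircle a) 0).comp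
      (by fun_prop : Differentiable ℂ fun s => s + v)

/-- Subtracting the Hurwitz function at `0` from each summand removes its pole and kills the term `a
= 0`, the only one whose periodic zeta function has a pole. The subtracted sum collapses by
orthogonality of characters, so the polar part does not depend on the unit `u`. -/
theorem estermann_eq (u : (ZMod c)ˣ) {v s : ℂ} (hs : s - v ≠ 1) :
    estermann (u : ZMod c) v s = (c : ℂ) ^ (1 - 2 * s) * riemannZeta (s + v) * riemannZeta (s - v) +
      estermannRegular (u : ZMod c) v s := by
  have hc : (c : ℂ) ≠ 0 := Nat.cast_ne_zero.mpr (NeZero.ne c)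
  have h1 : ∑ a : ZMod c, HurwitzZeta.expZeta (ZMod.toAddCircle ((u : ZMod c) * a)) (s - v) =
      (c : ℂ) ^ (1 - (s - v)) * riemannZeta (s - v) := by
    rw [← sum_expZeta hs]
    exact Fintype.sum_equiv (Units.mulLeft u) _ _ fun a => rfl
  have h2 : ∑ a ∈ Finset.univ.filter (fun a : ZMod c => a ≠ 0),
      HurwitzZeta.expZeta (ZMod.toAddCircle ((u : ZMod c) * a)) (s - v) *
      (HurwitzZeta.hurwitzZeta (ZMod.toAddCircle a) (s + v) -
        HurwitzZeta.hurwitzZeta 0 (s + v)) =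
      ∑ a : ZMod c, HurwitzZeta.expZeta (ZMod.toAddCircle ((u : ZMod c) * a)) (s - v) *
      (HurwitzZeta.hurwitzZeta (ZMod.toAddCircle a) (s + v) -
        HurwitzZeta.hurwitzZeta 0 (s + v)) := by
    rw [Finset.sum_filter]
    refine Finset.sum_congr rfl fun a _ => ?_
    split_ifs with h
    · rfl
    · rw [not_not.mp h]; simp
  rw [estermannRegular, h2]
  simp_rw [mul_sub]
  rw [Finset.sum_sub_distrib, ← Finset.sum_mul, h1, HurwitzZeta.hurwitzZeta_zero, estermann,
    ZMod.LFunction, mul_sub]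
  have h3 : (c : ℂ) ^ (1 - 2 * s) = (c : ℂ) ^ (-(s + v)) * (c : ℂ) ^ (1 - (s - v)) := by
    rw [← Complex.cpow_add _ _ hc]; ring_nf
  rw [h3]
  ring

/-- Hurwitz's formula exchanges the two zeta factors of each summand and yields four sums. The
substitution `a ↦ -a` identifies them in pairs with phases `e^{±iπv}` and `e^{±iπw}`, giving the two
cosines, and `a ↦ ua` moves the unit to the other factor, inverting it. -/
theorem estermann_one_sub (u : (ZMod c)ˣ) {v w : ℂ} (hv : v.re = 0) (hw : 1 < w.re) :
    estermann (u : ZMod c) v (1 - w) = (c : ℂ) ^ (2 * w - 1) * (2 * Real.pi : ℂ) ^ (-(2 * w)) *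
      (Complex.Gamma (w - v) * Complex.Gamma (w + v)) *
      (2 * Complex.cos (Real.pi * v) * estermann ((u⁻¹ : (ZMod c)ˣ) : ZMod c) v w +
        2 * Complex.cos (Real.pi * w) * estermann (-((u⁻¹ : (ZMod c)ˣ) : ZMod c)) v w) := by
  have hc : (c : ℂ) ≠ 0 := Nat.cast_ne_zero.mpr (NeZero.ne c)
  have hpi : (2 * Real.pi : ℂ) ≠ 0 := by simp [Real.pi_ne_zero]
  have hre1 : 1 < (w - v).re := by simpa [hv] using hw
  have hre2 : 1 < (w + v).re := by simpa [hv] using hw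
  have hne : ∀ z : ℂ, 1 < z.re → (∀ n : ℕ, z ≠ -n) ∧ z ≠ 1 ∧ ∀ n : ℕ, z ≠ 1 - n := by
    intro z hz
    refine ⟨fun n h => ?_, fun h => ?_, fun n h => ?_⟩
    · rw [h] at hz; simp at hz; linarith [(n.cast_nonneg : (0 : ℝ) ≤ n)]
    · rw [h] at hz; simp at hz
    · rw [h] at hz; simp at hz; linarith [(n.cast_nonneg : (0 : ℝ) ≤ n)]
  set E : ZMod c → ℂ := fun a => HurwitzZeta.expZeta (ZMod.toAddCircle a) (w - v) with hE
  set H : ZMod c → ℂ := fun a => HurwitzZeta.hurwitzZeta (ZMod.toAddCircle a) (w + v) with hH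
  have e1 : ∀ a : ZMod c, HurwitzZeta.hurwitzZeta (ZMod.toAddCircle a) (1 - w + v) =
      (2 * Real.pi) ^ (-(w - v)) * Complex.Gamma (w - v) *
        (Complex.exp (-Real.pi * Complex.I * (w - v) / 2) * E a +
          Complex.exp (Real.pi * Complex.I * (w - v) / 2) * E (-a)) := by
    intro a
    rw [show 1 - w + v = 1 - (w - v) by ring,
      HurwitzZeta.hurwitzZeta_one_sub _ (hne _ hre1).1 (Or.inr (hne _ hre1).2.1)]
    simp only [hE, map_neg]
  have e2 : ∀ a : ZMod c, HurwitzZeta.expZeta (ZMod.toAddCircle ((u : ZMod c) * a)) (1 - w - v) =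
      (2 * Real.pi) ^ (-(w + v)) * Complex.Gamma (w + v) *
        (Complex.exp (Real.pi * Complex.I * (w + v) / 2) * H (u * a) +
          Complex.exp (-Real.pi * Complex.I * (w + v) / 2) * H (-(u * a))) := by
    intro a
    rw [show 1 - w - v = 1 - (w + v) by ring, HurwitzZeta.expZeta_one_sub _ (hne _ hre2).2.2]
    simp only [hH, map_neg]
  have hcinv : (c : ℂ) ^ (-(w + v)) * (c : ℂ) ^ (w + v) = 1 := by
    rw [← Complex.cpow_add _ _ hc]; simp
  have s1 : ∑ a : ZMod c, E a * H (u * a) =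
      (c : ℂ) ^ (w + v) * estermann ((u⁻¹ : (ZMod c)ˣ) : ZMod c) v w := by
    rw [estermann, ZMod.LFunction, ← mul_assoc, mul_comm ((c : ℂ) ^ (w + v)), hcinv, one_mul]
    refine Fintype.sum_equiv (Units.mulLeft u) _ _ fun a => ?_
    simp [hE, hH]
  have s2 : ∑ a : ZMod c, E a * H (-(u * a)) =
      (c : ℂ) ^ (w + v) * estermann (-((u⁻¹ : (ZMod c)ˣ) : ZMod c)) v w := by
    rw [estermann, ZMod.LFunction, ← mul_assoc, mul_comm ((c : ℂ) ^ (w + v)), hcinv, one_mul]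
    refine Fintype.sum_equiv ((Units.mulLeft u).trans (Equiv.neg _)) _ _ fun a => ?_
    simp [hE, hH]
  have s3 : ∑ a : ZMod c, E (-a) * H (-(u * a)) = ∑ a : ZMod c, E a * H (u * a) :=
    Fintype.sum_equiv (Equiv.neg _) _ _ fun a => by simp
  have s4 : ∑ a : ZMod c, E (-a) * H (u * a) = ∑ a : ZMod c, E a * H (-(u * a)) :=
    Fintype.sum_equiv (Equiv.neg _) _ _ fun a => by simp
  have x1 : Complex.exp (-Real.pi * Complex.I * (w - v) / 2) *
      Complex.exp (Real.pi * Complex.I * (w + v) / 2) = Complex.exp (Real.pi * v * Complex.I) := by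
    rw [← Complex.exp_add]; ring_nf
  have x2 : Complex.exp (-Real.pi * Complex.I * (w - v) / 2) *
      Complex.exp (-Real.pi * Complex.I * (w + v) / 2) =
      Complex.exp (-(Real.pi * w) * Complex.I) := by
    rw [← Complex.exp_add]; ring_nf
  have x3 : Complex.exp (Real.pi * Complex.I * (w - v) / 2) *
      Complex.exp (Real.pi * Complex.I * (w + v) / 2) = Complex.exp (Real.pi * w * Complex.I) := by
    rw [← Complex.exp_add]; ring_nf
  have x4 : Complex.exp (Real.pi * Complex.I * (w - v) / 2) *
      Complex.exp (-Real.pi * Complex.I * (w + v) / 2) =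
      Complex.exp (-(Real.pi * v) * Complex.I) := by
    rw [← Complex.exp_add]; ring_nf
  rw [estermann, ZMod.LFunction]
  simp_rw [e1, e2]
  generalize Complex.exp (-Real.pi * Complex.I * (w - v) / 2) = y1 at x1 x2
  generalize Complex.exp (Real.pi * Complex.I * (w - v) / 2) = y2 at x3 x4
  generalize Complex.exp (Real.pi * Complex.I * (w + v) / 2) = y3 at x1 x3
  generalize Complex.exp (-Real.pi * Complex.I * (w + v) / 2) = y4 at x2 x4
  have hexp : ∀ a : ZMod c,
      (2 * Real.pi : ℂ) ^ (-(w + v)) * Complex.Gamma (w + v) * (y3 * H (u * a) + y4 * H (-(u * a))) *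
      ((2 * Real.pi : ℂ) ^ (-(w - v)) * Complex.Gamma (w - v) * (y1 * E a + y2 * E (-a))) =
      ((2 * Real.pi : ℂ) ^ (-(w + v)) * (2 * Real.pi : ℂ) ^ (-(w - v)) *
        (Complex.Gamma (w - v) * Complex.Gamma (w + v))) *
      ((y1 * y3) * (E a * H (u * a)) + (y1 * y4) * (E a * H (-(u * a))) +
        (y2 * y3) * (E (-a) * H (u * a)) + (y2 * y4) * (E (-a) * H (-(u * a)))) := by
    intro a; ring
  have hcp : (c : ℂ) ^ (2 * w - 1) = (c : ℂ) ^ (-(1 - w + v)) * (c : ℂ) ^ (w + v) := by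
    rw [← Complex.cpow_add _ _ hc]; ring_nf
  simp_rw [hexp]
  rw [← Finset.mul_sum, Finset.sum_add_distrib, Finset.sum_add_distrib, Finset.sum_add_distrib,
    ← Finset.mul_sum, ← Finset.mul_sum, ← Finset.mul_sum, ← Finset.mul_sum, s3, s4, s1, s2, x1, x2,
    x3, x4, ← Complex.cpow_add _ _ hpi, show -(w + v) + -(w - v) = -(2 * w) by ring,
    Complex.cos, Complex.cos, hcp]
  generalize (c : ℂ) ^ (w + v) = A
  generalize (c : ℂ) ^ (-(1 - w + v)) = B
  ring

end

/-! ### Growth of Mellin transforms and zeta functions in strips. -/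

theorem norm_cpow_smul {t : ℝ} (ht : 0 < t) (s z : ℂ) :
    ‖(t : ℂ) ^ (s - 1) • z‖ = t ^ (s.re - 1) * ‖z‖ := by
  rw [norm_smul, Complex.norm_cpow_eq_rpow_re_of_pos ht]
  simp

theorem integrableOn_rpow_mul_norm {f : ℝ → ℂ} {s : ℂ} (h : MellinConvergent f s) :
    IntegrableOn (fun t : ℝ => t ^ (s.re - 1) * ‖f t‖) (Ioi 0) :=
  (IntegrableOn.congr_fun (f := fun t : ℝ => ‖(t : ℂ) ^ (s - 1) • f t‖) h.norm
    (fun _ ht => norm_cpow_smul ht s _) measurableSet_Ioi)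

theorem exists_norm_mellin_le {f : ℝ → ℂ} {a b : ℝ} (ha : MellinConvergent f a)
    (hb : MellinConvergent f b) : ∃ C : ℝ, ∀ s ∈ closedStrip a b, ‖mellin f s‖ ≤ C := by
  have h1 := integrableOn_rpow_mul_norm ha
  have h2 := integrableOn_rpow_mul_norm hb
  rw [Complex.ofReal_re] at h1 h2
  refine ⟨∫ t in Ioi (0 : ℝ), (t ^ (a - 1) * ‖f t‖ + t ^ (b - 1) * ‖f t‖), fun s hs => ?_⟩
  refine (norm_integral_le_integral_norm _).trans (integral_mono_of_nonneg
    (Eventually.of_forall fun t => norm_nonneg _) (h1.add h2) ?_)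
  filter_upwards [self_mem_ae_restrict measurableSet_Ioi] with t ht
  rw [norm_cpow_smul ht, ← add_mul]
  gcongr
  have ht0 : (0 : ℝ) < t := ht
  rcases le_total t 1 with h | h
  · have := Real.rpow_le_rpow_of_exponent_ge ht0 h (sub_le_sub_right hs.1 1)
    have := Real.rpow_nonneg ht0.le (b - 1)
    linarith
  · have := Real.rpow_le_rpow_of_exponent_le h (sub_le_sub_right hs.2 1)
    have := Real.rpow_nonneg ht0.le (a - 1)
    linarith

namespace ExpGrowth

variable {a b : ℝ} {f : ℂ → ℂ}

theorem comp_div_two (hf : ExpGrowth (a / 2) (b / 2) f) : ExpGrowth a b (fun s => f (s / 2)) := by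
  obtain ⟨K, hK⟩ := hf
  have him : ∀ s : ℂ, |(s / 2).im| = |s.im| / 2 := fun s => by
    rw [show s / 2 = s / (2 : ℝ) by norm_num, Complex.div_ofReal_im, abs_div]
    norm_num
  have ht : Tendsto (fun s : ℂ => s / 2) (stripFilter a b) (stripFilter (a / 2) (b / 2)) := by
    refine tendsto_inf.mpr ⟨tendsto_comap_iff.mpr ?_, tendsto_principal.mpr ?_⟩
    · simp only [Function.comp_def, him]
      exact (tendsto_comap.mono_left inf_le_left).atTop_div_const two_pos
    · filter_upwards [mem_inf_of_right (mem_principal_self _)] with s hs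
      have : (s / 2).re = s.re / 2 := by
        rw [show s / 2 = s / (2 : ℝ) by norm_num, Complex.div_ofReal_re]
      exact ⟨by rw [this]; linarith [hs.1], by rw [this]; linarith [hs.2]⟩
  refine ⟨K / 2, (hK.comp_tendsto ht).congr_right fun s => ?_⟩
  simp only [Function.comp_apply, him]
  ring_nf

/-- For `b < 1` the reflection formula gives `Γ(1-s) sin(πs) / π` with `Γ(1-s)` bounded on the
strip. Strips further right follow by induction from `Γ(s) = (s-1) Γ(s-1)`. -/
theorem inv_Gamma (a b : ℝ) : ExpGrowth a b (fun s => (Complex.Gamma s)⁻¹) := by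
  have h0 : ∀ N : ℕ, ∀ a b : ℝ, b < N + 1 → ExpGrowth a b (fun s => (Complex.Gamma s)⁻¹) := by
    intro N
    induction N with
    | zero =>
      intro a b hb
      obtain ⟨C, hC⟩ := exists_norm_Gamma_le (a := 1 - b) (b := 1 - a)
        (by simp only [Nat.cast_zero] at hb; linarith)
      have h1 : ExpGrowth a b (fun s => Complex.Gamma (1 - s)) :=
        of_bounded (C := C) fun s hs => hC _ ⟨by simp; linarith [hs.2], by simp; linarith [hs.1]⟩
      have h2 : ExpGrowth a b (fun s => Complex.cos (Real.pi * (s + (-1 / 2 : ℝ)))) :=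
        comp_add_const (cos_const_mul (Real.pi : ℂ))
      refine ((h1.mul h2).mul (const a b (1 / Real.pi : ℂ))).congr' ?_
      filter_upwards [mem_inf_of_right (mem_principal_self _)] with s hs
      have hpi : (Real.pi : ℂ) ≠ 0 := by simp [Real.pi_ne_zero]
      have h3 := Complex.Gamma_mul_Gamma_one_sub s
      have h4 : Complex.Gamma (1 - s) ≠ 0 := by
        refine Complex.Gamma_ne_zero_of_re_pos ?_
        simp only [Nat.cast_zero] at hb
        simp; linarith [hs.2]
      have h5 : Complex.cos (Real.pi * (s + (-1 / 2 : ℝ))) = Complex.sin (Real.pi * s) := by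
        rw [← Complex.cos_sub_pi_div_two]; push_cast; ring_nf
      rw [h5]
      by_cases h6 : Complex.sin (Real.pi * s) = 0
      · rw [h6, div_zero] at h3
        rw [(mul_eq_zero.mp h3).resolve_right h4, h6]; simp
      · have h7 : Complex.Gamma s ≠ 0 := by
          intro h; rw [h, zero_mul] at h3
          exact div_ne_zero hpi h6 h3.symm
        rw [eq_div_iff h6] at h3
        rw [mul_one_div, div_eq_iff hpi, inv_mul_eq_div, eq_div_iff h7]
        linear_combination h3
    | succ N ih =>
      intro a b hb
      have h1 : ExpGrowth a b (fun s => (Complex.Gamma (s + (-1 : ℂ)))⁻¹) := by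
        refine comp_add_const (w := -1) (ih _ _ ?_)
        push_cast at hb
        simp; linarith
      refine (h1.mul (inv_sub 1)).congr' ?_
      filter_upwards [eventually_stripFilter_ne a b 1] with s hs
      have h2 := Complex.Gamma_add_one (s - 1) (sub_ne_zero.mpr hs)
      rw [sub_add_cancel] at h2
      rw [h2, mul_inv, mul_comm, sub_eq_add_neg]
  obtain ⟨N, hN⟩ := exists_nat_gt b
  exact h0 N a b (by linarith)

theorem inv_Gammaℝ (a b : ℝ) : ExpGrowth a b (fun s => (Complex.Gammaℝ s)⁻¹) := by
  have hpi : (Real.pi : ℂ) ≠ 0 := by simp [Real.pi_ne_zero]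
  refine ((exp_const_mul (Complex.log Real.pi / 2)).mul
    (comp_div_two (inv_Gamma (a / 2) (b / 2)))).congr' (Eventually.of_forall fun s => ?_)
  simp only [Complex.Gammaℝ, mul_inv]
  rw [← Complex.cpow_neg, Complex.cpow_def_of_ne_zero hpi]
  ring_nf

theorem mellin_of_forall_convergent {g : ℝ → ℂ} (hg : ∀ s, MellinConvergent g s) :
    ExpGrowth a b (mellin g) :=
  of_bounded (exists_norm_mellin_le (hg a) (hg b)).choose_spec

/-- An everywhere convergent Mellin transform is bounded on vertical strips. Together with the bound
for `1/Γ` this gives exponential growth of all the zeta functions involved. -/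
theorem Λ₀ (P : WeakFEPair ℂ) : ExpGrowth a b P.Λ₀ :=
  mellin_of_forall_convergent fun s => (P.isStrongFEPair_toStrongFEPair.hasMellin s).1

theorem Λ (P : WeakFEPair ℂ) : ExpGrowth a b P.Λ := by
  refine ((Λ₀ P).add (((inv_sub 0).mul (const a b (-P.f₀))).add
    ((inv_sub (P.k : ℂ)).mul (const a b (P.ε * P.g₀))))).congr' (Eventually.of_forall fun s => ?_)
  simp only [WeakFEPair.Λ, smul_eq_mul, sub_zero, div_eq_mul_inv]
  rw [← neg_sub (P.k : ℂ) s, inv_neg]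
  ring

theorem Λ_div_two (P : WeakFEPair ℂ) : ExpGrowth a b (fun s => P.Λ (s / 2) / 2) :=
  ((comp_div_two (Λ P)).mul (const a b 2⁻¹)).congr' (Eventually.of_forall fun _ => by
    simp only [div_eq_mul_inv])

theorem hurwitzZeta (x : UnitAddCircle) : ExpGrowth a b (HurwitzZeta.hurwitzZeta x) := by
  have h1 : ExpGrowth a b (HurwitzZeta.hurwitzZetaEven x) := by
    refine ((Λ_div_two (HurwitzZeta.hurwitzEvenFEPair x)).mul (inv_Gammaℝ a b)).congr' ?_
    filter_upwards [eventually_stripFilter_ne a b 0] with s hs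
    rw [HurwitzZeta.hurwitzZetaEven_def_of_ne_or_ne (Or.inr hs),
      HurwitzZeta.completedHurwitzZetaEven]
    ring
  have h2 : ExpGrowth a b (HurwitzZeta.hurwitzZetaOdd x) :=
    -- The odd function at `s` is its completed function divided by the Gamma factor at `s + 1`,
    -- hence the translation.
    comp_add_const (w := 1) (f := fun s => HurwitzZeta.hurwitzZetaOdd x (s - 1))
      (((Λ_div_two (HurwitzZeta.hurwitzOddFEPair x)).mul (inv_Gammaℝ _ _)).congr'
        (Eventually.of_forall fun s => by
          simp only [HurwitzZeta.hurwitzZetaOdd, HurwitzZeta.completedHurwitzZetaOdd,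
            sub_add_cancel, div_eq_mul_inv])) |>.congr'
      (Eventually.of_forall fun s => by simp only [add_sub_cancel_right])
  exact h1.add h2

theorem expZeta (x : UnitAddCircle) : ExpGrowth a b (HurwitzZeta.expZeta x) := by
  have h1 : ExpGrowth a b (HurwitzZeta.cosZeta x) := by
    refine ((Λ_div_two (HurwitzZeta.hurwitzEvenFEPair x).symm).mul (inv_Gammaℝ a b)).congr' ?_
    filter_upwards [eventually_stripFilter_ne a b 0] with s hs
    rw [HurwitzZeta.cosZeta, Function.update_of_ne hs, HurwitzZeta.completedCosZeta]
    ring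
  have h2 : ExpGrowth a b (HurwitzZeta.sinZeta x) :=
    comp_add_const (w := 1) (f := fun s => HurwitzZeta.sinZeta x (s - 1))
      (((Λ_div_two (HurwitzZeta.hurwitzOddFEPair x).symm).mul (inv_Gammaℝ _ _)).congr'
        (Eventually.of_forall fun s => by
          simp only [HurwitzZeta.sinZeta, HurwitzZeta.completedSinZeta,
            sub_add_cancel, div_eq_mul_inv])) |>.congr'
      (Eventually.of_forall fun s => by simp only [add_sub_cancel_right])
  exact h1.add ((const a b Complex.I).mul h2)

theorem estermann {c : ℕ} [NeZero c] (u : ZMod c) (v : ℂ) : ExpGrowth a b (estermann u v) := by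
  have hc : (c : ℂ) ≠ 0 := Nat.cast_ne_zero.mpr (NeZero.ne c)
  refine ((comp_add_const (w := v) (cpow_neg hc)).mul (sum (u := Finset.univ) fun x _ =>
    (comp_add_const (w := -v) (expZeta (ZMod.toAddCircle (u * x)))).mul
      (comp_add_const (w := v) (hurwitzZeta (ZMod.toAddCircle x))))).congr' (Eventually.of_forall fun s => ?_)
  simp only [Voronoi.estermann, ZMod.LFunction, sub_eq_add_neg]

end ExpGrowth

/-! ### Test functions and Mellin inversion. -/

/-- Hypotheses on a test function under which the Voronoi formula is proved by moving contours
between the lines `Re s = -δ` and `Re s = 1 + δ`. -/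
structure TestFunction (φ : ℝ → ℂ) (δ : ℝ) : Prop where
  continuousOn : ContinuousOn φ (Ioi 0)
  pos : 0 < δ
  le : δ ≤ 1 / 4
  convergent : ∀ s ∈ closedStrip (-δ) (1 + δ), MellinConvergent φ (2 * s)
  differentiableAt : ∀ s ∈ closedStrip (-δ) (1 + δ),
    DifferentiableAt ℂ (fun s : ℂ => mellin φ (2 * s)) s
  integrable : ∀ σ : ℝ, -δ ≤ σ → σ ≤ 1 + δ →
    Integrable fun t : ℝ => mellin φ (2 * (σ + t * Complex.I))
  integrable_weight : Integrable fun t : ℝ =>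
    (1 + |t|) ^ (1 + 2 * δ) * ‖mellin φ (2 * ((-δ : ℝ) + t * Complex.I))‖

namespace TestFunction

variable {φ : ℝ → ℂ} {δ : ℝ}

theorem line_mem {σ : ℝ} (h1 : -δ ≤ σ) (h2 : σ ≤ 1 + δ) (t : ℝ) :
    (σ + t * Complex.I : ℂ) ∈ closedStrip (-δ) (1 + δ) := ⟨by simpa, by simpa⟩

theorem exists_norm_le (h : TestFunction φ δ) :
    ∃ C : ℝ, ∀ s ∈ closedStrip (-δ) (1 + δ), ‖mellin φ (2 * s)‖ ≤ C := by
  have hδ := h.pos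
  have h1 := h.convergent ((-δ : ℝ) : ℂ) ⟨by simp, by simp; linarith⟩
  have h2 := h.convergent ((1 + δ : ℝ) : ℂ) ⟨by simp; linarith, by simp⟩
  obtain ⟨C, hC⟩ := exists_norm_mellin_le (f := φ) (a := 2 * -δ) (b := 2 * (1 + δ))
    (by simpa using h1) (by simpa using h2)
  refine ⟨C, fun s hs => hC _ ⟨?_, ?_⟩⟩
  · have : (2 * s).re = 2 * s.re := by simp
    rw [this]; linarith [hs.1]
  · have : (2 * s).re = 2 * s.re := by simp
    rw [this]; linarith [hs.2]

theorem expGrowth (h : TestFunction φ δ) :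
    ExpGrowth (-δ) (1 + δ) fun s => mellin φ (2 * s) :=
  ExpGrowth.of_bounded h.exists_norm_le.choose_spec

/-- Mellin inversion on `Re = 2σ`; replacing the ordinate by `2t` turns `1 / 2π` into `1 / π`. -/
theorem eq_integral (h : TestFunction φ δ) {σ : ℝ} (h1 : -δ ≤ σ) (h2 : σ ≤ 1 + δ) {x : ℝ}
    (hx : 0 < x) : φ x = (Real.pi : ℂ)⁻¹ * ∫ t : ℝ, mellin φ (2 * (σ + t * Complex.I)) *
      (x : ℂ) ^ (-2 * (σ + t * Complex.I)) := by
  have e : ∀ t : ℝ, ((2 * σ : ℝ) + (2 * t : ℝ) * Complex.I : ℂ) = 2 * (σ + t * Complex.I) :=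
    fun t => by push_cast; ring
  have hi : Complex.VerticalIntegrable (mellin φ) (2 * σ) := by
    have h3 := (h.integrable σ h1 h2).comp_mul_left' (R := (1 / 2 : ℝ)) (by norm_num)
    refine h3.congr (Eventually.of_forall fun t => ?_)
    simp only
    rw [← e]
    congr 4
    ring
  have hm : MellinConvergent φ ((2 * σ : ℝ) : ℂ) := by
    have := h.convergent (σ : ℂ) ⟨by simpa, by simpa⟩
    push_cast
    exact this
  have key := mellinInv_mellin_eq (2 * σ) φ hx hm hi
    (h.continuousOn.continuousAt (Ioi_mem_nhds hx))
  have hs := Measure.integral_comp_mul_left (fun y : ℝ => (x : ℂ) ^ (-((2 * σ : ℝ) + y * Complex.I)) •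
    mellin φ ((2 * σ : ℝ) + y * Complex.I)) 2
  rw [abs_of_pos (by norm_num : (0 : ℝ) < 2⁻¹)] at hs
  rw [← key, mellinInv, (inv_smul_eq_iff₀ (two_ne_zero' ℝ)).mp hs.symm, smul_smul]
  simp only [e, Complex.real_smul, smul_eq_mul]
  push_cast
  congr 1
  · have : (Real.pi : ℂ) ≠ 0 := by exact_mod_cast Real.pi_ne_zero
    field_simp
  · refine integral_congr_ae (Eventually.of_forall fun t => ?_)
    simp only
    rw [mul_comm]
    ring_nf

end TestFunction

/-! ### Integrating the Estermann function on lines of absolute convergence. -/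

section Estermann

variable {c : ℕ} [NeZero c]

theorem hasSum_integral_estermann (j : ZMod c) {v : ℂ} (hv : v.re = 0) {σ : ℝ} (hσ : 1 < σ)
    {G : ℝ → ℂ} (hG : Integrable G) :
    HasSum (fun n : ℕ+ => tau v n * ZMod.stdAddChar (j * ((n : ℕ) : ZMod c)) *
        ∫ t : ℝ, G t * (n : ℂ) ^ (-(σ + t * Complex.I)))
      (∫ t : ℝ, G t * estermann j v (σ + t * Complex.I)) := by
  have hn : ∀ (n : ℕ+) (t : ℝ), ‖(n : ℂ) ^ (-(σ + t * Complex.I))‖ = (n : ℝ) ^ (-σ) := fun n t => by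
    rw [norm_pnat_cpow]; simp
  have hi : ∀ n : ℕ+, Integrable fun t : ℝ => G t * (n : ℂ) ^ (-(σ + t * Complex.I)) := fun n =>
    hG.mul_bdd (c := (n : ℝ) ^ (-σ))
      (Continuous.const_cpow (by fun_prop) (Or.inl (by exact_mod_cast n.ne_zero))).aestronglyMeasurable
      (Eventually.of_forall fun t => (hn n t).le)
  have h := hasSum_integral_of_summable_integral_norm (μ := volume) (F := fun (n : ℕ+) (t : ℝ) =>
    tau v n * ZMod.stdAddChar (j * ((n : ℕ) : ZMod c)) *
      (G t * (n : ℂ) ^ (-(σ + t * Complex.I)))) (fun n => (hi n).const_mul _) ?_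
  · have heq : ∀ t : ℝ, ∑' n : ℕ+, tau v n * ZMod.stdAddChar (j * ((n : ℕ) : ZMod c)) *
        (G t * (n : ℂ) ^ (-(σ + t * Complex.I))) = G t * estermann j v (σ + t * Complex.I) := by
      intro t
      rw [← ((hasSum_estermann j hv (s := σ + t * Complex.I) (by simpa)).mul_left (G t)).tsum_eq]
      exact tsum_congr fun n => by ring
    simp_rw [integral_const_mul, heq] at h
    exact h
  · simp_rw [norm_mul, hn, norm_stdAddChar, mul_one, integral_const_mul, integral_mul_const]
    refine ((summable_norm_tau_mul_rpow hv hσ).mul_right (∫ t, ‖G t‖)).congr fun n => ?_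
    ring

theorem differentiableAt_estermann (j : ZMod c) {v s : ℂ} (h1 : s - v ≠ 1) (h2 : s + v ≠ 1) :
    DifferentiableAt ℂ (estermann j v) s := by
  have hc : (c : ℂ) ≠ 0 := Nat.cast_ne_zero.mpr (NeZero.ne c)
  unfold estermann ZMod.LFunction
  refine DifferentiableAt.mul (DifferentiableAt.const_cpow (by fun_prop) (Or.inl hc))
    (DifferentiableAt.fun_sum fun a _ => DifferentiableAt.mul ?_ ?_)
  · exact DifferentiableAt.comp (f := fun s => s - v) s
      (HurwitzZeta.differentiableAt_expZeta _ _ (Or.inl h1)) (by fun_prop)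
  · exact DifferentiableAt.comp (f := fun s => s + v) s
      (HurwitzZeta.differentiableAt_hurwitzZeta _ h2) (by fun_prop)

theorem continuous_estermann_line (j : ZMod c) {v : ℂ} (hv : v.re = 0) {σ : ℝ} (hσ : σ ≠ 1) :
    Continuous fun t : ℝ => estermann j v (σ + t * Complex.I) := by
  refine continuous_iff_continuousAt.mpr fun t => ContinuousAt.comp (g := estermann j v)
    (f := fun t : ℝ => (σ + t * Complex.I : ℂ)) (differentiableAt_estermann j ?_ ?_).continuousAt
      (by fun_prop)
  · intro h; apply hσ; simpa [hv] using congrArg Complex.re h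
  · intro h; apply hσ; simpa [hv] using congrArg Complex.re h

theorem exists_norm_estermann_le (j : ZMod c) {v : ℂ} (hv : v.re = 0) {σ : ℝ} (hσ : 1 < σ) :
    ∃ C : ℝ, ∀ t : ℝ, ‖estermann j v (σ + t * Complex.I)‖ ≤ C := by
  refine ⟨∑' n : ℕ+, ‖tau v n‖ * (n : ℝ) ^ (-σ), fun t => ?_⟩
  rw [← (hasSum_estermann j hv (s := σ + t * Complex.I) (by simpa)).tsum_eq]
  refine tsum_of_norm_bounded (summable_norm_tau_mul_rpow hv hσ).hasSum fun n => ?_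
  rw [norm_mul, norm_mul, norm_stdAddChar, norm_pnat_cpow]
  simp

theorem integrable_mul_estermann (j : ZMod c) {v : ℂ} (hv : v.re = 0) {σ : ℝ} (hσ : 1 < σ)
    {G : ℝ → ℂ} (hG : Integrable G) :
    Integrable fun t : ℝ => G t * estermann j v (σ + t * Complex.I) := by
  obtain ⟨C, hC⟩ := exists_norm_estermann_le j hv hσ
  exact hG.mul_bdd (continuous_estermann_line j hv hσ.ne').aestronglyMeasurable
    (Eventually.of_forall hC)

end Estermann

/-! ### Mellin-Parseval: pairing `k₀` and `k₁` with the test function. -/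

theorem integrable_prod_mul_cpow {f g : ℝ → ℂ} {σ r : ℝ} (hg : Integrable g)
    (hf : MellinConvergent f (2 * (1 - σ))) (hr : 0 < r) :
    Integrable (fun p : ℝ × ℝ => g p.2 * ((p.1 * r : ℝ) : ℂ) ^ (-2 * (σ + p.2 * Complex.I)) *
      -- Apart from the unimodular factor `x^{-2it}`, the integrand is an integrable function of `x`
      -- times an integrable function of `t`.
      (f p.1 * p.1)) ((volume.restrict (Ioi 0)).prod volume) := by
  have h1 : Integrable (fun p : ℝ × ℝ => ((p.1 : ℂ) ^ ((2 * (1 - σ) : ℂ) - 1) • f p.1) *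
      (g p.2 * (r : ℂ) ^ (-2 * (σ + p.2 * Complex.I))))
      ((volume.restrict (Ioi 0)).prod volume) :=
    Integrable.mul_prod hf (integrable_mul_cpow_line hg hr σ)
  have hpos : ∀ᵐ p : ℝ × ℝ ∂((volume.restrict (Ioi 0)).prod volume), 0 < p.1 :=
    Measure.quasiMeasurePreserving_fst.ae (ae_restrict_mem measurableSet_Ioi)
  have h2 := h1.mul_bdd (c := 1) (g := fun p : ℝ × ℝ => (p.1 : ℂ) ^ (-2 * (p.2 * Complex.I)))
    (Measurable.aestronglyMeasurable (by fun_prop)) (hpos.mono fun p hp => by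
      rw [norm_ofReal_cpow hp]; simp)
  refine h2.congr (hpos.mono fun p hp => ?_)
  have hp' : (p.1 : ℂ) ≠ 0 := by exact_mod_cast hp.ne'
  have e : (p.1 : ℂ) ^ ((2 * (1 - σ) : ℂ) - 1) * (p.1 : ℂ) ^ (-2 * (p.2 * Complex.I)) =
      (p.1 : ℂ) ^ (-2 * (σ + p.2 * Complex.I)) * p.1 := by
    rw [← Complex.cpow_add _ _ hp', show (2 * (1 - σ) : ℂ) - 1 + -2 * (p.2 * Complex.I) =
      -2 * (σ + p.2 * Complex.I) + 1 by ring, Complex.cpow_add _ _ hp', Complex.cpow_one]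
  simp only [smul_eq_mul]
  rw [Complex.ofReal_mul, Complex.mul_cpow_ofReal_nonneg hp.le hr.le]
  linear_combination (f p.1 * g p.2 * (r : ℂ) ^ (-2 * (σ + p.2 * Complex.I))) * e

theorem integral_integral_mul_cpow {f g : ℝ → ℂ} {σ r : ℝ} (hg : Integrable g)
    (hf : MellinConvergent f (2 * (1 - σ))) (hr : 0 < r) :
    IntegrableOn (fun x : ℝ => (∫ t : ℝ, g t * ((x * r : ℝ) : ℂ) ^ (-2 * (σ + t * Complex.I))) *
      (f x * x)) (Ioi 0) ∧
    ∫ x in Ioi (0 : ℝ), (∫ t : ℝ, g t * ((x * r : ℝ) : ℂ) ^ (-2 * (σ + t * Complex.I))) *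
      (f x * x) =
    ∫ t : ℝ, g t * (r : ℂ) ^ (-2 * (σ + t * Complex.I)) *
      mellin f (2 * (1 - (σ + t * Complex.I))) := by
  have h := integrable_prod_mul_cpow hg hf hr
  simp_rw [← integral_mul_const]
  refine ⟨h.integral_prod_left, ?_⟩
  rw [integral_integral_swap h]
  refine integral_congr_ae (Eventually.of_forall fun t => ?_)
  simp only [mellin]
  rw [← integral_const_mul]
  refine setIntegral_congr_fun measurableSet_Ioi fun x hx => ?_
  have hx0 : (0 : ℝ) < x := hx
  have hx' : (x : ℂ) ≠ 0 := by exact_mod_cast hx0.ne'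
  have e : (x : ℂ) ^ ((2 * (1 - (σ + t * Complex.I)) : ℂ) - 1) =
      (x : ℂ) ^ (-2 * (σ + t * Complex.I)) * x := by
    rw [show (2 * (1 - (σ + t * Complex.I)) : ℂ) - 1 = -2 * (σ + t * Complex.I) + 1 by ring,
      Complex.cpow_add _ _ hx', Complex.cpow_one]
  simp only [smul_eq_mul]
  rw [e, Complex.ofReal_mul, Complex.mul_cpow_ofReal_nonneg hx0.le hr.le]
  ring

theorem differentiableAt_barnesNumerator_zero {v : ℂ} {y : ℝ} (hy : 0 < y) {w : ℂ}
    (h : -1 < w.re - |v.re|) : DifferentiableAt ℂ (barnesNumerator v y 0) w := by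
  have hb := abs_le.mp (le_refl |v.re|)
  have hy' : (y : ℂ) ≠ 0 := by exact_mod_cast hy.ne'
  unfold barnesNumerator
  simp only [Finset.range_zero, Finset.prod_empty, mul_one, inv_one]
  refine DifferentiableAt.mul (DifferentiableAt.mul (by fun_prop) ?_) (DifferentiableAt.mul ?_ ?_)
  · exact DifferentiableAt.const_cpow (by fun_prop) (Or.inl hy')
  · exact DifferentiableAt.comp (f := fun w => w - v + 1) w
      (differentiableAt_Gamma_of_re_pos (by simp; linarith)) (by fun_prop)
  · exact DifferentiableAt.comp (f := fun w => w + v + 1) w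
      (differentiableAt_Gamma_of_re_pos (by simp; linarith)) (by fun_prop)

namespace TestFunction

variable {φ : ℝ → ℂ} {δ : ℝ} {v : ℂ}

theorem one_sub_mem {w : ℂ} (hw : w ∈ closedStrip (-δ) (1 + δ)) :
    1 - w ∈ closedStrip (-δ) (1 + δ) :=
  ⟨by simp; linarith [hw.2], by simp; linarith [hw.1]⟩

theorem continuous_one_sub_line (h : TestFunction φ δ) {σ : ℝ} (h1 : -δ ≤ σ) (h2 : σ ≤ 1 + δ) :
    Continuous fun t : ℝ => mellin φ (2 * (1 - (σ + t * Complex.I))) :=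
  continuous_iff_continuousAt.mpr fun t =>
    ContinuousAt.comp (g := fun s : ℂ => mellin φ (2 * s))
      (f := fun t : ℝ => (1 - (σ + t * Complex.I) : ℂ))
      (h.differentiableAt _ (one_sub_mem (line_mem h1 h2 t))).continuousAt (by fun_prop)

theorem integrable_mul_mellin (h : TestFunction φ δ) {σ : ℝ} (h1 : -δ ≤ σ) (h2 : σ ≤ 1 + δ)
    {g : ℝ → ℂ} (hg : Integrable g) :
    Integrable fun t : ℝ => g t * mellin φ (2 * (1 - (σ + t * Complex.I))) := by
  obtain ⟨C, hC⟩ := h.exists_norm_le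
  exact hg.mul_bdd (h.continuous_one_sub_line h1 h2).aestronglyMeasurable
    (Eventually.of_forall fun t => hC _ (one_sub_mem (line_mem h1 h2 t)))

theorem convergent_one_sub (h : TestFunction φ δ) {σ : ℝ} (h1 : -δ ≤ σ) (h2 : σ ≤ 1 + δ) :
    MellinConvergent φ (2 * (1 - σ)) :=
  h.convergent _ ⟨by simp; linarith, by simp; linarith⟩

theorem integrable_one_sub_weight (h : TestFunction φ δ) : Integrable fun t : ℝ =>
    (1 + |t|) ^ (1 + 2 * δ) * ‖mellin φ (2 * (1 - ((1 + δ : ℝ) + t * Complex.I)))‖ := by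
  refine h.integrable_weight.comp_neg.congr (Eventually.of_forall fun t => ?_)
  simp only [abs_neg]
  congr 4
  push_cast
  ring

theorem continuous_Gamma_mul_Gamma (hδ : 0 < δ) (hv : v.re = 0) : Continuous fun t : ℝ =>
    Complex.Gamma ((1 + δ : ℝ) + t * Complex.I - v) *
      Complex.Gamma ((1 + δ : ℝ) + t * Complex.I + v) := by
  refine continuous_iff_continuousAt.mpr fun t => ContinuousAt.mul ?_ ?_
  · exact ContinuousAt.comp (f := fun t : ℝ => ((1 + δ : ℝ) + t * Complex.I - v : ℂ))
      (differentiableAt_Gamma_of_re_pos (by simp [hv]; linarith)).continuousAt (by fun_prop)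
  · exact ContinuousAt.comp (f := fun t : ℝ => ((1 + δ : ℝ) + t * Complex.I + v : ℂ))
      (differentiableAt_Gamma_of_re_pos (by simp [hv]; linarith)).continuousAt (by fun_prop)

theorem integrable_Gamma_mul_mellin (h : TestFunction φ δ) (hv : v.re = 0) :
    Integrable fun t : ℝ => Complex.Gamma ((1 + δ : ℝ) + t * Complex.I - v) *
      Complex.Gamma ((1 + δ : ℝ) + t * Complex.I + v) *
      mellin φ (2 * (1 - ((1 + δ : ℝ) + t * Complex.I))) := by
  obtain ⟨C, hC0, hC⟩ := exists_norm_Gamma_mul_Gamma_le h.pos h.le |v.im|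
  refine (h.integrable_one_sub_weight.const_mul C).mono' (Continuous.aestronglyMeasurable ?_)
    (Eventually.of_forall fun t => ?_)
  · exact (continuous_Gamma_mul_Gamma h.pos hv).mul
      (h.continuous_one_sub_line (by linarith [h.pos]) le_rfl)
  · have := hC v hv le_rfl ((1 + δ : ℝ) + t * Complex.I) (by simp)
    rw [norm_mul, ← mul_assoc]
    gcongr
    refine this.trans ?_
    simp only [Complex.add_im, Complex.ofReal_im, Complex.mul_im, Complex.ofReal_re,
      Complex.I_im, mul_one, Complex.I_re, mul_zero, add_zero, zero_add]
    gcongr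
    refine mul_le_of_le_one_right (by positivity) ?_
    rw [Real.exp_le_one_iff]
    have := mul_nonneg Real.pi_pos.le (abs_nonneg t)
    linarith

theorem integrable_barnesKernel_mul_mellin (h : TestFunction φ δ) (hv : v.re = 0) :
    Integrable fun t : ℝ => barnesKernel v ((1 + δ : ℝ) + t * Complex.I) *
      mellin φ (2 * (1 - ((1 + δ : ℝ) + t * Complex.I))) := by
  obtain ⟨C, hC0, hC⟩ := exists_norm_Gamma_mul_Gamma_le h.pos h.le |v.im|
  refine (h.integrable_one_sub_weight.const_mul C).mono' (Continuous.aestronglyMeasurable ?_)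
    (Eventually.of_forall fun t => ?_)
  · exact (Continuous.mul (by fun_prop) (continuous_Gamma_mul_Gamma h.pos hv)).mul
      (h.continuous_one_sub_line (by linarith [h.pos]) le_rfl)
  · have := hC v hv le_rfl ((1 + δ : ℝ) + t * Complex.I) (by simp)
    rw [← mul_assoc C] at this
    rw [norm_mul, ← mul_assoc]
    gcongr
    simpa [barnesKernel] using norm_cos_mul_le this

/-- Moving the Gaussian part from `δ` to `-δ` costs the residues at `±v` and restores the full
kernel there. Moving that from `-δ` to `1 + δ` costs the same residues, so they cancel. Only after
pairing with `φ̂` is the undamped kernel known to be integrable on the right-hand line. -/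
theorem integral_kernel_eq (h : TestFunction φ δ) (hv : v.re = 0) {r : ℝ} (hr : 0 < r) :
    (∫ t : ℝ, barnesKernel v (δ + t * Complex.I) * gauss v (δ + t * Complex.I) *
      (r : ℂ) ^ (-2 * (δ + t * Complex.I)) * mellin φ (2 * (1 - (δ + t * Complex.I)))) +
    (∫ t : ℝ, barnesKernel v ((-δ : ℝ) + t * Complex.I) *
      (1 - gauss v ((-δ : ℝ) + t * Complex.I)) *
      (r : ℂ) ^ (-2 * ((-δ : ℝ) + t * Complex.I)) *
        mellin φ (2 * (1 - ((-δ : ℝ) + t * Complex.I)))) =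
    ∫ t : ℝ, barnesKernel v ((1 + δ : ℝ) + t * Complex.I) *
      (r : ℂ) ^ (-2 * ((1 + δ : ℝ) + t * Complex.I)) *
        mellin φ (2 * (1 - ((1 + δ : ℝ) + t * Complex.I))) := by
  have hδ := h.pos
  have hδ' := h.le
  have hv' : |v.re| ≤ δ / 2 := by rw [hv, abs_zero]; positivity
  set G : ℂ → ℂ := fun w => barnesNumerator v r 0 w * mellin φ (2 * (1 - w)) with hG
  have hGd : ∀ w ∈ closedStrip (-δ) (1 + δ), DifferentiableAt ℂ G w := fun w hw =>
    (differentiableAt_barnesNumerator_zero hr (by rw [hv, abs_zero]; linarith [hw.1])).mul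
      (DifferentiableAt.comp (f := fun w => 1 - w) w (h.differentiableAt _ (one_sub_mem hw))
        (by fun_prop))
  have hTG : ∀ w : ℂ, w ≠ v → w ≠ -v → barnesKernel v w * (r : ℂ) ^ (-2 * w) *
      mellin φ (2 * (1 - w)) = G w / ((w - v) * (w - -v)) := by
    intro w h1 h2
    rw [barnesKernel_mul_eq_barnesNumerator_zero r h1 h2, div_mul_eq_mul_div]
  have hGe : ExpGrowth (-δ) (1 + δ) G := by
    obtain ⟨C, hC⟩ := h.exists_norm_le
    exact (expGrowth_barnesNumerator hr 0 (by rw [hv, abs_zero]; linarith)).mul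
      (ExpGrowth.of_bounded fun w hw => hC _ (one_sub_mem hw))
  have hTe : ExpGrowth (-δ) (1 + δ) fun w => barnesKernel v w * (r : ℂ) ^ (-2 * w) *
      mellin φ (2 * (1 - w)) := by
    refine ((hGe.mul (ExpGrowth.inv_sub v)).mul (ExpGrowth.inv_sub (-v))).congr' ?_
    filter_upwards [eventually_stripFilter_ne _ _ v, eventually_stripFilter_ne _ _ (-v)] with w h1 h2
    rw [hTG w h1 h2, div_eq_mul_inv, mul_inv, mul_assoc]
  have i1 : Integrable fun t : ℝ => barnesKernel v ((-δ : ℝ) + t * Complex.I) *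
      (r : ℂ) ^ (-2 * ((-δ : ℝ) + t * Complex.I : ℂ)) *
        mellin φ (2 * (1 - ((-δ : ℝ) + t * Complex.I))) :=
    h.integrable_mul_mellin le_rfl (by linarith) (integrable_barnesKernel_mul_cpow hδ hδ' hv' hr)
  have i2 : Integrable fun t : ℝ => barnesKernel v ((1 + δ : ℝ) + t * Complex.I) *
      (r : ℂ) ^ (-2 * ((1 + δ : ℝ) + t * Complex.I : ℂ)) *
        mellin φ (2 * (1 - ((1 + δ : ℝ) + t * Complex.I))) := by
    refine (integrable_mul_cpow_line (h.integrable_barnesKernel_mul_mellin hv) hr (1 + δ)).congr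
      (Eventually.of_forall fun t => ?_)
    simp only
    ring
  have i3 : Integrable fun t : ℝ => barnesKernel v (δ + t * Complex.I) * gauss v (δ + t * Complex.I) *
      (r : ℂ) ^ (-2 * (δ + t * Complex.I)) * mellin φ (2 * (1 - (δ + t * Complex.I))) :=
    h.integrable_mul_mellin (by linarith) (by linarith)
      (integrable_mul_cpow_line (integrable_barnesKernel_mul_gauss hδ hδ' hv') hr δ)
  have i4 : Integrable fun t : ℝ => barnesKernel v ((-δ : ℝ) + t * Complex.I) *
      (1 - gauss v ((-δ : ℝ) + t * Complex.I)) *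
      (r : ℂ) ^ (-2 * ((-δ : ℝ) + t * Complex.I)) *
        mellin φ (2 * (1 - ((-δ : ℝ) + t * Complex.I))) :=
    h.integrable_mul_mellin le_rfl (by linarith)
      (integrable_mul_cpow_line (integrable_barnesKernel_mul_one_sub_gauss hδ hδ' hv') hr (-δ))
  have i5 : Integrable fun t : ℝ => barnesKernel v ((-δ : ℝ) + t * Complex.I) *
      (r : ℂ) ^ (-2 * ((-δ : ℝ) + t * Complex.I)) *
        mellin φ (2 * (1 - ((-δ : ℝ) + t * Complex.I))) * gauss v ((-δ : ℝ) + t * Complex.I) :=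
    (i1.sub i4).congr (Eventually.of_forall fun t => by simp only [Pi.sub_apply]; ring)
  have s1 := integral_sub_integral_eq_dslope (a := -δ) (b := 1 + δ) (p := v) (q := -v)
    (F := fun w => barnesKernel v w * (r : ℂ) ^ (-2 * w) * mellin φ (2 * (1 - w)))
    (G := G) ⟨by rw [hv]; linarith, by rw [hv]; linarith⟩
    ⟨by rw [Complex.neg_re, hv]; linarith, by rw [Complex.neg_re, hv]; linarith⟩
    (fun w hw => (hGd w hw).differentiableWithinAt) (fun w _ h1 h2 => hTG w h1 h2) hTe i1 i2
  have s2 := integral_sub_integral_eq_dslope (a := -δ) (b := δ) (p := v) (q := -v)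
    (F := fun w => barnesKernel v w * (r : ℂ) ^ (-2 * w) * mellin φ (2 * (1 - w)) * gauss v w)
    (G := fun w => G w * gauss v w) ⟨by rw [hv]; linarith, by rw [hv]; linarith⟩
    ⟨by rw [Complex.neg_re, hv]; linarith, by rw [Complex.neg_re, hv]; linarith⟩
    (fun w hw => ((hGd w ⟨hw.1, by linarith [hw.2]⟩).mul
      (by unfold gauss; fun_prop)).differentiableWithinAt)
    (fun w _ h1 h2 => by rw [hTG w h1 h2, div_mul_eq_mul_div])
    ((hTe.mono le_rfl (by linarith)).mul (expGrowth_gauss v _ _)) i5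
    (i3.congr (Eventually.of_forall fun t => by simp only; ring))
  rw [dslope_mul_gauss (hGd v ⟨by rw [hv]; linarith, by rw [hv]; linarith⟩), ← s1] at s2
  have e3 : (∫ t : ℝ, barnesKernel v (δ + t * Complex.I) * gauss v (δ + t * Complex.I) *
      (r : ℂ) ^ (-2 * (δ + t * Complex.I)) * mellin φ (2 * (1 - (δ + t * Complex.I)))) =
      ∫ t : ℝ, barnesKernel v (δ + t * Complex.I) * (r : ℂ) ^ (-2 * (δ + t * Complex.I)) *
        mellin φ (2 * (1 - (δ + t * Complex.I))) * gauss v (δ + t * Complex.I) :=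
    integral_congr_ae (Eventually.of_forall fun t => by simp only; ring)
  have e4 := integral_sub i1 i5
  have e5 : (∫ t : ℝ, barnesKernel v ((-δ : ℝ) + t * Complex.I) *
      (1 - gauss v ((-δ : ℝ) + t * Complex.I)) *
      (r : ℂ) ^ (-2 * ((-δ : ℝ) + t * Complex.I)) *
        mellin φ (2 * (1 - ((-δ : ℝ) + t * Complex.I)))) = _ :=
    (integral_congr_ae (Eventually.of_forall fun t => by ring)).trans e4
  rw [e3, e5]
  linear_combination s2

theorem integral_kernelIntegral_mul (h : TestFunction φ δ) (hv : v.re = 0) {r : ℝ} (hr : 0 < r) :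
    IntegrableOn (fun x : ℝ => kernelIntegral δ v (x * r) * (φ x * x)) (Ioi 0) ∧
    ∫ x in Ioi (0 : ℝ), kernelIntegral δ v (x * r) * (φ x * x) =
    ∫ t : ℝ, barnesKernel v ((1 + δ : ℝ) + t * Complex.I) *
      (r : ℂ) ^ (-2 * ((1 + δ : ℝ) + t * Complex.I)) *
        mellin φ (2 * (1 - ((1 + δ : ℝ) + t * Complex.I))) := by
  have hδ := h.pos
  have hδ' := h.le
  have hv' : |v.re| ≤ δ / 2 := by rw [hv, abs_zero]; positivity
  obtain ⟨a1, a2⟩ := integral_integral_mul_cpow (integrable_barnesKernel_mul_gauss hδ hδ' hv')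
    (h.convergent_one_sub (σ := δ) (by linarith) (by linarith)) hr
  obtain ⟨b1, b2⟩ := integral_integral_mul_cpow (σ := -δ)
    (integrable_barnesKernel_mul_one_sub_gauss hδ hδ' hv')
    (h.convergent_one_sub (σ := -δ) le_rfl (by linarith)) hr
  simp only [kernelIntegral, add_mul (∫ t : ℝ, _)]
  refine ⟨a1.add b1, ?_⟩
  rw [integral_add a1 b1, a2, b2]
  exact h.integral_kernel_eq hv hr

/-- Here `φ` is expanded by Mellin inversion on `Re s = -δ`, and the transform of `K` appears on `Re
w = 1 + δ`. Thus no inversion formula for `K` itself is needed. -/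
theorem integral_besselK_mul (h : TestFunction φ δ) (hv : v.re = 0) {r : ℝ} (hr : 0 < r) :
    IntegrableOn (fun x : ℝ => besselK (2 * v) (r * x) * (φ x * x)) (Ioi 0) ∧
    ∫ x in Ioi (0 : ℝ), besselK (2 * v) (r * x) * (φ x * x) =
    (Real.pi : ℂ)⁻¹ * ∫ t : ℝ, 2 ^ (2 * ((1 + δ : ℝ) + t * Complex.I : ℂ) - 2) *
      (Complex.Gamma ((1 + δ : ℝ) + t * Complex.I - v) *
      Complex.Gamma ((1 + δ : ℝ) + t * Complex.I + v)) *
      (r : ℂ) ^ (-2 * ((1 + δ : ℝ) + t * Complex.I)) *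
      mellin φ (2 * (1 - ((1 + δ : ℝ) + t * Complex.I))) := by
  have hδ := h.pos
  have hw : ∀ t : ℝ, 0 < ((1 : ℂ) - ((-δ : ℝ) + t * Complex.I)).re := fun t => by simp; linarith
  have hc : MellinConvergent (fun x => besselK (2 * v) (r * x)) (2 * (1 - (-δ : ℝ))) :=
    (MellinConvergent.comp_mul_left hr).mpr (mellin_besselK hv (by simp; linarith)).1
  obtain ⟨a1, a2⟩ := integral_integral_mul_cpow (h.integrable (-δ) le_rfl (by linarith)) hc one_pos
  have hφ : ∀ x ∈ Ioi (0 : ℝ), (Real.pi : ℂ)⁻¹ *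
      ((∫ t : ℝ, mellin φ (2 * ((-δ : ℝ) + t * Complex.I)) *
        ((x * 1 : ℝ) : ℂ) ^ (-2 * ((-δ : ℝ) + t * Complex.I))) * (besselK (2 * v) (r * x) * x)) =
      besselK (2 * v) (r * x) * (φ x * x) := by
    intro x hx
    rw [h.eq_integral le_rfl (by linarith) hx, mul_one]
    ring
  refine ⟨IntegrableOn.congr_fun (a1.const_mul (Real.pi : ℂ)⁻¹) hφ measurableSet_Ioi, ?_⟩
  rw [← setIntegral_congr_fun measurableSet_Ioi hφ, integral_const_mul, a2,
    ← integral_neg_eq_self]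
  congr 1
  refine integral_congr_ae (Eventually.of_forall fun t => ?_)
  have e : (1 : ℂ) - ((-δ : ℝ) + (-t : ℝ) * Complex.I) = (1 + δ : ℝ) + t * Complex.I := by
    push_cast; ring
  have e2 : ((-δ : ℝ) + (-t : ℝ) * Complex.I : ℂ) = 1 - ((1 + δ : ℝ) + t * Complex.I) := by
    rw [← e]; ring
  simp only
  rw [mellin_comp_mul_left _ _ hr, (mellin_besselK hv (hw _)).2, e, e2]
  simp only [Complex.ofReal_one, Complex.one_cpow, smul_eq_mul]
  ring_nf

end TestFunction

/-! ### Polar terms and their limit at `v = 0`. -/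

/-- The entire function `(s - 1) ζ(s)`. -/
noncomputable def entireZeta (s : ℂ) : ℂ := DirichletCharacter.LFunctionTrivChar₁ 1 s

theorem differentiable_entireZeta : Differentiable ℂ entireZeta :=
  DirichletCharacter.differentiable_LFunctionTrivChar₁ 1

theorem entireZeta_one : entireZeta 1 = 1 := by simp [entireZeta]

theorem entireZeta_of_ne {s : ℂ} (hs : s ≠ 1) : entireZeta s = (s - 1) * riemannZeta s := by
  rw [entireZeta, DirichletCharacter.LFunctionTrivChar₁, Function.update_of_ne hs,
    DirichletCharacter.LFunctionTrivChar, DirichletCharacter.LFunction_modOne_eq]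

theorem sqrt_cpow_neg_two_mul {x : ℝ} (hx : 0 < x) (s : ℂ) :
    ((√x : ℝ) : ℂ) ^ (-2 * s) = (x : ℂ) ^ (-s) := by
  have h1 : ((√x : ℝ) : ℂ) ≠ 0 := by exact_mod_cast (Real.sqrt_pos.mpr hx).ne'
  have h2 : (x : ℂ) ≠ 0 := by exact_mod_cast hx.ne'
  rw [Complex.cpow_def_of_ne_zero h1, Complex.cpow_def_of_ne_zero h2,
    ← Complex.ofReal_log (Real.sqrt_nonneg x), ← Complex.ofReal_log hx.le, Real.log_sqrt hx.le]
  push_cast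
  ring_nf

/-- The regular part of an integrand contributes no residue, for distinct and for coinciding poles.
-/
theorem dslope_add_mul {f g : ℂ → ℂ} {p q : ℂ} (hf : DifferentiableAt ℂ f p)
    (hg : DifferentiableAt ℂ g p) :
    dslope (fun s => f s + (s - p) * (s - q) * g s) p q = dslope f p q := by
  by_cases hpq : q = p
  · subst hpq
    have h := (hf.hasDerivAt.add ((((hasDerivAt_id q).sub_const q).mul
      ((hasDerivAt_id q).sub_const q)).mul hg.hasDerivAt)).deriv
    simp only [id_eq, Pi.mul_apply, sub_self, mul_zero, zero_mul, add_zero] at h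
    rw [dslope_same, dslope_same, ← h]
    rfl
  · rw [dslope_of_ne _ hpq, dslope_of_ne _ hpq, slope_def_field, slope_def_field]
    simp

/-- The numerator of the polar part of the Mellin-Barnes integrand in the Voronoi formula. -/
noncomputable def polarNumerator (φ : ℝ → ℂ) (v s : ℂ) : ℂ :=
  mellin φ (2 * s) * ((4 * Real.pi : ℝ) : ℂ) ^ (1 - 2 * s) * (entireZeta (s + v) * entireZeta (s - v))

namespace TestFunction

variable {φ : ℝ → ℂ} {δ : ℝ} {v : ℂ}

theorem differentiableAt_mellin_mul_cpow (h : TestFunction φ δ) {b : ℝ} (hb : 0 < b) {s : ℂ}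
    (hs : s ∈ closedStrip (-δ) (1 + δ)) :
    DifferentiableAt ℂ (fun s : ℂ => mellin φ (2 * s) * (b : ℂ) ^ (1 - 2 * s)) s :=
  (h.differentiableAt s hs).mul
    (DifferentiableAt.const_cpow (by fun_prop) (Or.inl (by exact_mod_cast hb.ne')))

theorem differentiableAt_polarNumerator (h : TestFunction φ δ) {s : ℂ}
    (hs : s ∈ closedStrip (-δ) (1 + δ)) : DifferentiableAt ℂ (polarNumerator φ v) s :=
  (h.differentiableAt_mellin_mul_cpow (by positivity) hs).mul
    (DifferentiableAt.mul (differentiable_entireZeta.comp (by fun_prop)).differentiableAt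
      (differentiable_entireZeta.comp (by fun_prop)).differentiableAt)

theorem two_mul_dslope_polarNumerator (hv0 : v ≠ 0) :
    2 * dslope (polarNumerator φ v) (1 - v) (1 + v) = polarTerms φ v := by
  have hpi : ((4 * Real.pi : ℝ) : ℂ) ≠ 0 := by exact_mod_cast (by positivity : (4 * Real.pi) ≠ 0)
  have h1 : (1 + v : ℂ) ≠ 1 - v := by
    intro h; apply hv0; linear_combination h / 2
  have h2 : (1 + 2 * v : ℂ) ≠ 1 := by simpa
  have h3 : (1 - 2 * v : ℂ) ≠ 1 := by simpa
  rw [dslope_of_ne _ h1, slope_def_field, polarNumerator, polarNumerator, polarTerms,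
    show (1 + v + v : ℂ) = 1 + 2 * v by ring, show (1 + v - v : ℂ) = 1 by ring,
    show (1 - v + v : ℂ) = 1 by ring, show (1 - v - v : ℂ) = 1 - 2 * v by ring,
    entireZeta_one, entireZeta_of_ne h2, entireZeta_of_ne h3,
    show (1 - 2 * (1 + v) : ℂ) = -(1 + 2 * v) by ring,
    show (1 - 2 * (1 - v) : ℂ) = -(1 - 2 * v) by ring, Complex.cpow_neg, Complex.cpow_neg,
    show (2 * (1 + v) : ℂ) = 2 + 2 * v by ring, show (2 * (1 - v) : ℂ) = 2 - 2 * v by ring,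
    show (1 + v - (1 - v) : ℂ) = 2 * v by ring]
  push_cast
  field_simp
  ring

/-- With `A(w) = f(1 + w) · entireZeta (1 + 2w)` the polar terms are `(A(w) - A(-w)) / w`, a
difference quotient at `0`. Its limit `2 A'(0)` is twice the derivative of the numerator `f(s) ·
entireZeta(s)²` at `1`, the double-pole residue. -/
theorem tendsto_polarTerms (h : TestFunction φ δ) :
    Tendsto (fun w : ℂ => polarTerms φ w) (𝓝[≠] 0)
      (𝓝 (2 * dslope (polarNumerator φ 0) (1 - 0) (1 + 0))) := by
  set f : ℂ → ℂ := fun s => mellin φ (2 * s) * ((4 * Real.pi : ℝ) : ℂ) ^ (1 - 2 * s) with hf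
  have hf1 : HasDerivAt f (deriv f 1) 1 := (h.differentiableAt_mellin_mul_cpow (by positivity)
    ⟨by simp; linarith [h.pos], by simp; linarith [h.pos]⟩).hasDerivAt
  have hz1 : HasDerivAt entireZeta (deriv entireZeta 1) 1 :=
    (differentiable_entireZeta 1).hasDerivAt
  have hG : HasDerivAt (polarNumerator φ 0) (deriv f 1 + f 1 * (2 * deriv entireZeta 1)) 1 := by
    have := hf1.mul (hz1.mul hz1)
    convert! this using 1
    · ext s; simp [polarNumerator, hf]
    · simp only [Pi.mul_apply, entireZeta_one]; ring
  have hA : ∀ a : ℂ, HasDerivAt (fun w : ℂ => f (1 + a * w) * entireZeta (1 + 2 * (a * w)))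
      (a * (deriv f 1 + f 1 * (2 * deriv entireZeta 1))) 0 := by
    intro a
    have l1 : HasDerivAt (fun w : ℂ => 1 + a * w) a 0 := by
      simpa using ((hasDerivAt_id (0 : ℂ)).const_mul a).const_add 1
    have l2 : HasDerivAt (fun w : ℂ => 1 + 2 * (a * w)) (2 * a) 0 := by
      simpa using (((hasDerivAt_id (0 : ℂ)).const_mul a).const_mul 2).const_add 1
    have h1 := HasDerivAt.comp (h₂ := f) (h := fun w : ℂ => 1 + a * w) 0
      (show HasDerivAt f (deriv f 1) (1 + a * 0) by rwa [mul_zero, add_zero]) l1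
    have h2 := HasDerivAt.comp (h₂ := entireZeta) (h := fun w : ℂ => 1 + 2 * (a * w)) 0
      (show HasDerivAt entireZeta (deriv entireZeta 1) (1 + 2 * (a * 0)) by
        rwa [mul_zero, mul_zero, add_zero]) l2
    convert! h1.mul h2 using 1
    simp only [Function.comp_apply, mul_zero, add_zero, entireZeta_one]
    ring
  have hD := ((hA 1).sub (hA (-1))).tendsto_slope
  rw [sub_zero, add_zero, dslope_same, hG.deriv]
  refine Tendsto.congr' ?_ (hD.trans (by apply le_of_eq; congr 1; ring))
  filter_upwards [self_mem_nhdsWithin] with w hw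
  have hw0 : w ≠ 0 := hw
  have h2 : (1 + 2 * w : ℂ) ≠ 1 := by simpa
  have h3 : (1 - 2 * w : ℂ) ≠ 1 := by simpa
  have hpi : ((4 * Real.pi : ℝ) : ℂ) ≠ 0 := by exact_mod_cast (by positivity : (4 * Real.pi) ≠ 0)
  simp only [slope_def_field, Pi.sub_apply, one_mul, mul_zero, add_zero, neg_mul, sub_zero,
    hf, polarTerms]
  rw [show (1 + 2 * -w : ℂ) = 1 - 2 * w by ring, entireZeta_of_ne h2, entireZeta_of_ne h3,
    show (1 - 2 * (1 + w) : ℂ) = -(1 + 2 * w) by ring,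
    show (1 - 2 * (1 + -w) : ℂ) = -(1 - 2 * w) by ring, Complex.cpow_neg, Complex.cpow_neg,
    show (2 * (1 + w) : ℂ) = 2 + 2 * w by ring, show (2 * (1 + -w) : ℂ) = 2 - 2 * w by ring]
  push_cast
  field_simp
  ring_nf

/-! ### Both series as integrals of the Estermann function. -/

section

variable {c : ℕ} [NeZero c]

theorem integrable_mul_cpow_estermann (h : TestFunction φ δ) (hv : v.re = 0) (u : ZMod c)
    {b : ℝ} (hb : 0 < b) : Integrable fun t : ℝ =>
      mellin φ (2 * ((1 + δ : ℝ) + t * Complex.I)) *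
        (b : ℂ) ^ (1 - 2 * ((1 + δ : ℝ) + t * Complex.I)) *
        estermann u v ((1 + δ : ℝ) + t * Complex.I) := by
  refine integrable_mul_estermann u hv (by linarith [h.pos]) ?_
  refine (h.integrable (1 + δ) (by linarith [h.pos]) le_rfl).mul_bdd
    (c := b ^ (1 - 2 * (1 + δ))) (Continuous.aestronglyMeasurable ?_)
    (Eventually.of_forall fun t => ?_)
  · exact Continuous.const_cpow (by fun_prop) (Or.inl (by exact_mod_cast hb.ne'))
  · rw [norm_ofReal_cpow hb]
    simp

theorem hasSum_tau_mul (h : TestFunction φ δ) (hv : v.re = 0) (u : ZMod c) {b : ℝ} (hb : 0 < b) :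
    HasSum (fun n : ℕ+ => b * (tau v n * ZMod.stdAddChar (u * ((n : ℕ) : ZMod c)) *
        φ (b * √(n : ℝ))))
      ((Real.pi : ℂ)⁻¹ * ∫ t : ℝ, mellin φ (2 * ((1 + δ : ℝ) + t * Complex.I)) *
        (b : ℂ) ^ (1 - 2 * ((1 + δ : ℝ) + t * Complex.I)) *
        estermann u v ((1 + δ : ℝ) + t * Complex.I)) := by
  have hb' : (b : ℂ) ≠ 0 := by exact_mod_cast hb.ne'
  have hi : Integrable fun t : ℝ => mellin φ (2 * ((1 + δ : ℝ) + t * Complex.I)) *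
        (b : ℂ) ^ (1 - 2 * ((1 + δ : ℝ) + t * Complex.I)) := by
    refine (h.integrable (1 + δ) (by linarith [h.pos]) le_rfl).mul_bdd
      (c := b ^ (1 - 2 * (1 + δ))) (Continuous.aestronglyMeasurable ?_)
      (Eventually.of_forall fun t => ?_)
    · exact Continuous.const_cpow (by fun_prop) (Or.inl hb')
    · rw [norm_ofReal_cpow hb]
      simp
  refine ((hasSum_integral_estermann u hv (by linarith [h.pos]) hi).mul_left
    (Real.pi : ℂ)⁻¹).congr_fun fun n => ?_
  have hn : (0 : ℝ) < (n : ℝ) := by exact_mod_cast n.pos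
  rw [h.eq_integral (by linarith [h.pos]) le_rfl (mul_pos hb (Real.sqrt_pos.mpr hn))]
  have e : (b : ℂ) * ∫ t : ℝ, mellin φ (2 * ((1 + δ : ℝ) + t * Complex.I)) *
      ((b * √(n : ℝ) : ℝ) : ℂ) ^ (-2 * ((1 + δ : ℝ) + t * Complex.I)) =
      ∫ t : ℝ, mellin φ (2 * ((1 + δ : ℝ) + t * Complex.I)) *
        (b : ℂ) ^ (1 - 2 * ((1 + δ : ℝ) + t * Complex.I)) *
        (n : ℂ) ^ (-((1 + δ : ℝ) + t * Complex.I)) := by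
    rw [← integral_const_mul]
    refine integral_congr_ae (Eventually.of_forall fun t => ?_)
    simp only
    rw [Complex.ofReal_mul, Complex.mul_cpow_ofReal_nonneg hb.le (Real.sqrt_nonneg _),
      sqrt_cpow_neg_two_mul hn, sub_eq_add_neg, Complex.cpow_add _ _ hb', Complex.cpow_one,
      ← neg_mul]
    push_cast
    ring
  rw [← e]
  ring

/-- The functional equation with the constants arranged as Parseval produces them: the Barnes kernel
goes with `-u⁻¹` and leads to `k₀`, the bare Gamma product goes with `u⁻¹` and leads to `k₁`. The
powers of `c` cancel. -/
theorem gamma_estermann_eq (u : (ZMod c)ˣ) (hv : v.re = 0) {w : ℂ} (hw : 1 < w.re) (m : ℂ) :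
    (Real.pi : ℂ)⁻¹ * (m * ((4 * Real.pi / c : ℝ) : ℂ) ^ (1 - 2 * (1 - w)) *
      estermann (u : ZMod c) v (1 - w)) =
    (2 * Real.pi ^ 2 : ℂ)⁻¹ * (2 : ℂ) ^ (2 * w) * (barnesKernel v w * m) *
        estermann (-((u⁻¹ : (ZMod c)ˣ) : ZMod c)) v w +
      2 / Real.pi ^ 2 * Complex.cos (Real.pi * v) * (2 : ℂ) ^ (2 * w - 2) *
        (Complex.Gamma (w - v) * Complex.Gamma (w + v) * m) *
        estermann ((u⁻¹ : (ZMod c)ˣ) : ZMod c) v w := by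
  have hc : (c : ℂ) ≠ 0 := Nat.cast_ne_zero.mpr (NeZero.ne c)
  have hcr : (0 : ℝ) < c := by exact_mod_cast Nat.pos_of_ne_zero (NeZero.ne c)
  have hpi : (Real.pi : ℂ) ≠ 0 := by exact_mod_cast Real.pi_ne_zero
  have e1 : ((4 * Real.pi / c : ℝ) : ℂ) ^ (2 * w - 1) * (c : ℂ) ^ (2 * w - 1) =
      ((4 * Real.pi : ℝ) : ℂ) ^ (2 * w - 1) := by
    have := Complex.mul_cpow_ofReal_nonneg (a := 4 * Real.pi / c) (b := c) (by positivity)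
      (by positivity) (2 * w - 1)
    rw [Complex.ofReal_natCast] at this
    rw [← this, ← Complex.ofReal_natCast, ← Complex.ofReal_mul, div_mul_cancel₀ _ hcr.ne']
  have e2 : ((4 * Real.pi : ℝ) : ℂ) ^ (2 * w - 1) =
      (2 : ℂ) ^ (2 * w) * (2 * Real.pi : ℂ) ^ (2 * w) * (4 * Real.pi : ℂ)⁻¹ := by
    have := Complex.mul_cpow_ofReal_nonneg (a := 2) (b := 2 * Real.pi) (by positivity)
      (by positivity) (2 * w)
    push_cast at this
    rw [← this, Complex.cpow_sub _ _ (by push_cast; simp [hpi]), Complex.cpow_one, div_eq_mul_inv]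
    push_cast
    ring_nf
  have e3 : (2 * Real.pi : ℂ) ^ (2 * w) * (2 * Real.pi : ℂ) ^ (-(2 * w)) = 1 := by
    rw [← Complex.cpow_add _ _ (by simp [hpi])]; simp
  have e4 : (2 : ℂ) ^ (2 * w - 2) = (2 : ℂ) ^ (2 * w) * 4⁻¹ := by
    rw [Complex.cpow_sub _ _ two_ne_zero, div_eq_mul_inv]
    norm_num
  rw [estermann_one_sub u hv hw, e4, show 1 - 2 * (1 - w) = 2 * w - 1 by ring, barnesKernel]
  set Dp := estermann ((u⁻¹ : (ZMod c)ˣ) : ZMod c) v w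
  set Dm := estermann (-((u⁻¹ : (ZMod c)ˣ) : ZMod c)) v w
  calc _ = (Real.pi : ℂ)⁻¹ * m * (((4 * Real.pi / c : ℝ) : ℂ) ^ (2 * w - 1) *
        (c : ℂ) ^ (2 * w - 1)) * (2 * Real.pi : ℂ) ^ (-(2 * w)) *
        (Complex.Gamma (w - v) * Complex.Gamma (w + v)) *
        (2 * Complex.cos (Real.pi * v) * Dp + 2 * Complex.cos (Real.pi * w) * Dm) := by ring
    _ = (Real.pi : ℂ)⁻¹ * m * (4 * Real.pi : ℂ)⁻¹ * (2 : ℂ) ^ (2 * w) *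
        ((2 * Real.pi : ℂ) ^ (2 * w) * (2 * Real.pi : ℂ) ^ (-(2 * w))) *
        (Complex.Gamma (w - v) * Complex.Gamma (w + v)) *
        (2 * Complex.cos (Real.pi * v) * Dp + 2 * Complex.cos (Real.pi * w) * Dm) := by
      rw [e1, e2]; ring
    _ = _ := by
      rw [e3]
      field_simp
      ring

theorem integrable_mul_two_cpow {g : ℝ → ℂ} (hg : Integrable g) (σ : ℝ) (z : ℂ) :
    Integrable fun t : ℝ => (2 : ℂ) ^ (2 * (σ + t * Complex.I) - z) * g t := by
  refine hg.bdd_mul (c := 2 ^ (2 * σ - z.re)) (Continuous.aestronglyMeasurable ?_)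
    (Eventually.of_forall fun t => ?_)
  · exact Continuous.const_cpow (by fun_prop) (Or.inl two_ne_zero)
  · have := norm_ofReal_cpow two_pos (2 * (σ + t * Complex.I) - z)
    rw [Complex.ofReal_ofNat] at this
    rw [this]
    simp

/-- Under `w = 1 - s` the line `Re s = -δ` becomes `Re w = 1 + δ`, where both Dirichlet series can
be integrated term by term; Parseval identifies each term with its Bessel integral. Using
`kernelIntegral` instead of `k₀` keeps `v = 0` included. -/
theorem hasSum_tau_mul_integral (h : TestFunction φ δ) (hv : v.re = 0) (u : (ZMod c)ˣ) :
    (∀ n : ℕ+, IntegrableOn (fun x : ℝ =>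
      (ZMod.stdAddChar (-((u⁻¹ : (ZMod c)ˣ) : ZMod c) * ((n : ℕ) : ZMod c)) *
          ((2 * Real.pi ^ 2 : ℂ)⁻¹ * kernelIntegral δ v (x * √(n : ℝ) / 2)) +
        ZMod.stdAddChar (((u⁻¹ : (ZMod c)ˣ) : ZMod c) * ((n : ℕ) : ZMod c)) *
          k₁ (x * √(n : ℝ)) v) * φ x * x) (Ioi 0)) ∧
    HasSum (fun n : ℕ+ => tau v n * ∫ x in Ioi (0 : ℝ),
      (ZMod.stdAddChar (-((u⁻¹ : (ZMod c)ˣ) : ZMod c) * ((n : ℕ) : ZMod c)) *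
          ((2 * Real.pi ^ 2 : ℂ)⁻¹ * kernelIntegral δ v (x * √(n : ℝ) / 2)) +
        ZMod.stdAddChar (((u⁻¹ : (ZMod c)ˣ) : ZMod c) * ((n : ℕ) : ZMod c)) *
          k₁ (x * √(n : ℝ)) v) * φ x * x)
      ((Real.pi : ℂ)⁻¹ * ∫ t : ℝ, mellin φ (2 * ((-δ : ℝ) + t * Complex.I)) *
        ((4 * Real.pi / c : ℝ) : ℂ) ^ (1 - 2 * ((-δ : ℝ) + t * Complex.I)) *
        estermann (u : ZMod c) v ((-δ : ℝ) + t * Complex.I)) ∧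
    Integrable fun t : ℝ => mellin φ (2 * ((-δ : ℝ) + t * Complex.I)) *
        ((4 * Real.pi / c : ℝ) : ℂ) ^ (1 - 2 * ((-δ : ℝ) + t * Complex.I)) *
        estermann (u : ZMod c) v ((-δ : ℝ) + t * Complex.I) := by
  have hδ := h.pos
  have hpi : (Real.pi : ℂ) ≠ 0 := by exact_mod_cast Real.pi_ne_zero
  set P : ZMod c := ((u⁻¹ : (ZMod c)ˣ) : ZMod c) with hP
  set H1 : ℝ → ℂ := fun t => (2 * Real.pi ^ 2 : ℂ)⁻¹ *
    (2 : ℂ) ^ (2 * ((1 + δ : ℝ) + t * Complex.I)) * (barnesKernel v ((1 + δ : ℝ) + t * Complex.I) *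
      mellin φ (2 * (1 - ((1 + δ : ℝ) + t * Complex.I)))) with hH1
  set H2 : ℝ → ℂ := fun t => 2 / Real.pi ^ 2 * Complex.cos (Real.pi * v) *
    (2 : ℂ) ^ (2 * ((1 + δ : ℝ) + t * Complex.I) - 2) *
      (Complex.Gamma ((1 + δ : ℝ) + t * Complex.I - v) *
        Complex.Gamma ((1 + δ : ℝ) + t * Complex.I + v) *
        mellin φ (2 * (1 - ((1 + δ : ℝ) + t * Complex.I)))) with hH2
  have i1 : Integrable H1 := by
    refine ((integrable_mul_two_cpow (h.integrable_barnesKernel_mul_mellin hv) (1 + δ) 0).const_mul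
      (2 * Real.pi ^ 2 : ℂ)⁻¹).congr (Eventually.of_forall fun t => ?_)
    simp only [hH1, sub_zero]
    ring
  have i2 : Integrable H2 := by
    refine ((integrable_mul_two_cpow (h.integrable_Gamma_mul_mellin hv) (1 + δ) 2).const_mul
      (2 / Real.pi ^ 2 * Complex.cos (Real.pi * v))).congr (Eventually.of_forall fun t => ?_)
    simp only [hH2]
    ring
  have hσ : (1 : ℝ) < 1 + δ := by linarith
  have hfe : ∀ t : ℝ, (Real.pi : ℂ)⁻¹ * (mellin φ (2 * ((-δ : ℝ) + (-t : ℝ) * Complex.I)) *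
        ((4 * Real.pi / c : ℝ) : ℂ) ^ (1 - 2 * ((-δ : ℝ) + (-t : ℝ) * Complex.I)) *
        estermann (u : ZMod c) v ((-δ : ℝ) + (-t : ℝ) * Complex.I)) =
      H1 t * estermann (-P) v ((1 + δ : ℝ) + t * Complex.I) +
        H2 t * estermann P v ((1 + δ : ℝ) + t * Complex.I) := by
    intro t
    rw [show ((-δ : ℝ) + (-t : ℝ) * Complex.I : ℂ) = 1 - ((1 + δ : ℝ) + t * Complex.I) by
      push_cast; ring]
    exact gamma_estermann_eq u hv (by simpa) _
  have j1 := integrable_mul_estermann (-P) hv hσ i1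
  have j2 := integrable_mul_estermann P hv hσ i2
  have hk : ∀ x r : ℝ, k₁ (x * r) v =
      2 / Real.pi * Complex.cos (Real.pi * v) * besselK (2 * v) (r * x) := by
    intro x r
    rw [k₁, show (Real.pi * (1 / 2 + v) : ℂ) = Real.pi * v + Real.pi / 2 by ring,
      Complex.sin_add_pi_div_two, mul_comm x r]
  have hn0 : ∀ n : ℕ+, (0 : ℝ) < (n : ℝ) := fun n => by exact_mod_cast n.pos
  have hr : ∀ n : ℕ+, 0 < √(n : ℝ) := fun n => Real.sqrt_pos.mpr (hn0 n)
  have hform : ∀ (n : ℕ+) (x : ℝ), (ZMod.stdAddChar (-P * ((n : ℕ) : ZMod c)) *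
          ((2 * Real.pi ^ 2 : ℂ)⁻¹ * kernelIntegral δ v (x * √(n : ℝ) / 2)) +
        ZMod.stdAddChar (P * ((n : ℕ) : ZMod c)) * k₁ (x * √(n : ℝ)) v) * φ x * x =
      ZMod.stdAddChar (-P * ((n : ℕ) : ZMod c)) * (2 * Real.pi ^ 2 : ℂ)⁻¹ *
        (kernelIntegral δ v (x * (√(n : ℝ) / 2)) * (φ x * x)) +
      ZMod.stdAddChar (P * ((n : ℕ) : ZMod c)) * (2 / Real.pi * Complex.cos (Real.pi * v)) *
        (besselK (2 * v) (√(n : ℝ) * x) * (φ x * x)) := by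
    intro n x
    rw [hk, mul_div_assoc]
    ring
  simp only [hform]
  have a1 := fun n : ℕ+ => h.integral_kernelIntegral_mul hv (half_pos (hr n))
  have a2 := fun n : ℕ+ => h.integral_besselK_mul hv (hr n)
  refine ⟨fun n => ((a1 n).1.const_mul _).add ((a2 n).1.const_mul _), ?_, ?_⟩
  · have hval : (Real.pi : ℂ)⁻¹ * (∫ t : ℝ, mellin φ (2 * ((-δ : ℝ) + t * Complex.I)) *
        ((4 * Real.pi / c : ℝ) : ℂ) ^ (1 - 2 * ((-δ : ℝ) + t * Complex.I)) *
        estermann (u : ZMod c) v ((-δ : ℝ) + t * Complex.I)) =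
        (∫ t, H1 t * estermann (-P) v ((1 + δ : ℝ) + t * Complex.I)) +
          ∫ t, H2 t * estermann P v ((1 + δ : ℝ) + t * Complex.I) := by
      rw [← integral_add j1 j2, ← integral_neg_eq_self, ← integral_const_mul]
      exact integral_congr_ae (Eventually.of_forall hfe)
    rw [hval]
    refine ((hasSum_integral_estermann (-P) hv hσ i1).add
      (hasSum_integral_estermann P hv hσ i2)).congr_fun fun n => ?_
    rw [integral_add ((a1 n).1.const_mul _) ((a2 n).1.const_mul _), integral_const_mul,
      integral_const_mul, (a1 n).2, (a2 n).2]
    have b1 : (2 * Real.pi ^ 2 : ℂ)⁻¹ * (∫ t : ℝ, barnesKernel v ((1 + δ : ℝ) + t * Complex.I) *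
        ((√(n : ℝ) / 2 : ℝ) : ℂ) ^ (-2 * ((1 + δ : ℝ) + t * Complex.I)) *
        mellin φ (2 * (1 - ((1 + δ : ℝ) + t * Complex.I)))) =
        ∫ t : ℝ, H1 t * (n : ℂ) ^ (-((1 + δ : ℝ) + t * Complex.I)) := by
      rw [← integral_const_mul]
      refine integral_congr_ae (Eventually.of_forall fun t => ?_)
      have e : ((√(n : ℝ) / 2 : ℝ) : ℂ) ^ (-2 * ((1 + δ : ℝ) + t * Complex.I)) =
          (n : ℂ) ^ (-((1 + δ : ℝ) + t * Complex.I)) *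
            (2 : ℂ) ^ (2 * ((1 + δ : ℝ) + t * Complex.I)) := by
        have h2 := Complex.mul_cpow_ofReal_nonneg (hr n).le (by norm_num : (0 : ℝ) ≤ 2⁻¹)
          (-2 * ((1 + δ : ℝ) + t * Complex.I))
        rw [div_eq_mul_inv, Complex.ofReal_mul, h2, sqrt_cpow_neg_two_mul (hn0 n)]
        congr 1
        have h3 : ((2⁻¹ : ℝ) : ℂ) = (2 : ℂ)⁻¹ := by push_cast; rfl
        rw [h3, Complex.inv_cpow _ _ (by
          rw [show (2 : ℂ) = ((2 : ℝ) : ℂ) by norm_num, Complex.arg_ofReal_of_nonneg two_pos.le]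
          exact Real.pi_pos.ne), ← Complex.cpow_neg]
        ring_nf
      simp only [hH1]
      rw [e]
      ring
    have b2 : 2 / Real.pi * Complex.cos (Real.pi * v) * ((Real.pi : ℂ)⁻¹ *
        ∫ t : ℝ, (2 : ℂ) ^ (2 * ((1 + δ : ℝ) + t * Complex.I : ℂ) - 2) *
        (Complex.Gamma ((1 + δ : ℝ) + t * Complex.I - v) *
        Complex.Gamma ((1 + δ : ℝ) + t * Complex.I + v)) *
        ((√(n : ℝ) : ℝ) : ℂ) ^ (-2 * ((1 + δ : ℝ) + t * Complex.I)) *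
        mellin φ (2 * (1 - ((1 + δ : ℝ) + t * Complex.I)))) =
        ∫ t : ℝ, H2 t * (n : ℂ) ^ (-((1 + δ : ℝ) + t * Complex.I)) := by
      rw [← mul_assoc, ← integral_const_mul]
      refine integral_congr_ae (Eventually.of_forall fun t => ?_)
      simp only [hH2]
      rw [sqrt_cpow_neg_two_mul (hn0 n)]
      push_cast
      field_simp
    rw [mul_assoc (ZMod.stdAddChar (-P * ((n : ℕ) : ZMod c))), b1,
      mul_assoc (ZMod.stdAddChar (P * ((n : ℕ) : ZMod c))), b2]
    ring
  -- Integrability on `Re s = -δ` is read back through the functional equation, so no growth bound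
  -- for the Estermann function on that line is used.
  · have := ((j1.add j2).comp_neg).const_mul (Real.pi : ℂ)
    refine this.congr (Eventually.of_forall fun t => ?_)
    simp only [Pi.add_apply]
    rw [← hfe (-t), neg_neg, mul_inv_cancel_left₀ hpi]

end

end TestFunction

/-! ### The shift past the poles `1 ± v`. -/

namespace TestFunction

section

variable {φ : ℝ → ℂ} {δ : ℝ} {v : ℂ} {c : ℕ} [NeZero c]

/-- The integrand is a numerator over `(s - (1-v))(s - (1+v))`, in which the regular part of the
Estermann function carries both factors and drops out of the divided difference. -/
theorem estermann_shift (h : TestFunction φ δ) (hv : v.re = 0) (u : (ZMod c)ˣ) :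
    (Real.pi : ℂ)⁻¹ * (∫ t : ℝ, mellin φ (2 * ((1 + δ : ℝ) + t * Complex.I)) *
        ((4 * Real.pi / c : ℝ) : ℂ) ^ (1 - 2 * ((1 + δ : ℝ) + t * Complex.I)) *
        estermann (u : ZMod c) v ((1 + δ : ℝ) + t * Complex.I)) =
    2 * dslope (polarNumerator φ v) (1 - v) (1 + v) +
    (Real.pi : ℂ)⁻¹ * (∫ t : ℝ, mellin φ (2 * ((-δ : ℝ) + t * Complex.I)) *
        ((4 * Real.pi / c : ℝ) : ℂ) ^ (1 - 2 * ((-δ : ℝ) + t * Complex.I)) *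
        estermann (u : ZMod c) v ((-δ : ℝ) + t * Complex.I)) := by
  have hδ := h.pos
  have hc : (c : ℂ) ≠ 0 := Nat.cast_ne_zero.mpr (NeZero.ne c)
  have hcr : (0 : ℝ) < c := by exact_mod_cast Nat.pos_of_ne_zero (NeZero.ne c)
  have hpi : (Real.pi : ℂ) ≠ 0 := by exact_mod_cast Real.pi_ne_zero
  have hb : 0 < 4 * Real.pi / c := by positivity
  have hi := (h.hasSum_tau_mul_integral hv u).2.2
  have hi' := h.integrable_mul_cpow_estermann hv (u : ZMod c) hb
  have hbdef : 4 * Real.pi / c * c = 4 * Real.pi := div_mul_cancel₀ _ hcr.ne'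
  generalize 4 * Real.pi / (c : ℝ) = b at hb hi hi' hbdef ⊢
  have hb' : (b : ℂ) ≠ 0 := by exact_mod_cast hb.ne'
  set B : ℂ → ℂ := fun s => mellin φ (2 * s) * (b : ℂ) ^ (1 - 2 * s) *
    estermannRegular (u : ZMod c) v s with hB
  set G : ℂ → ℂ := fun s => polarNumerator φ v s + (s - (1 - v)) * (s - (1 + v)) * B s with hG
  have hBd : ∀ s ∈ closedStrip (-δ) (1 + δ), DifferentiableAt ℂ B s := fun s hs =>
    (h.differentiableAt_mellin_mul_cpow hb hs).mul (differentiable_estermannRegular u v s)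
  have hp : (1 - v).re ∈ Ioo (-δ) (1 + δ) := ⟨by simp [hv]; linarith, by simp [hv]; linarith⟩
  have hq : (1 + v).re ∈ Ioo (-δ) (1 + δ) := ⟨by simp [hv]; linarith, by simp [hv]; linarith⟩
  have hds : dslope G (1 - v) (1 + v) = dslope (polarNumerator φ v) (1 - v) (1 + v) :=
    dslope_add_mul (h.differentiableAt_polarNumerator ⟨hp.1.le, hp.2.le⟩) (hBd _ ⟨hp.1.le, hp.2.le⟩)
  have hFG : ∀ s ∈ closedStrip (-δ) (1 + δ), s ≠ 1 - v → s ≠ 1 + v →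
      mellin φ (2 * s) * (b : ℂ) ^ (1 - 2 * s) * estermann (u : ZMod c) v s =
        G s / ((s - (1 - v)) * (s - (1 + v))) := by
    intro s _ h1 h2
    have n1 : s + v ≠ 1 := fun h => h1 (by rw [← h]; ring)
    have n2 : s - v ≠ 1 := fun h => h2 (by rw [← h]; ring)
    -- The factor `c^{1-2s}` of the polar part cancels the denominator of `b = 4π/c`, so the polar
    -- terms are independent of `c`.
    have e1 : ((4 * Real.pi : ℝ) : ℂ) ^ (1 - 2 * s) = (b : ℂ) ^ (1 - 2 * s) * (c : ℂ) ^ (1 - 2 * s) := by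
      have := Complex.mul_cpow_ofReal_nonneg (a := b) (b := c) hb.le (by positivity) (1 - 2 * s)
      rw [Complex.ofReal_natCast] at this
      rw [← this, ← Complex.ofReal_natCast, ← Complex.ofReal_mul, hbdef]
    rw [eq_div_iff (mul_ne_zero (sub_ne_zero.mpr h1) (sub_ne_zero.mpr h2)), estermann_eq u n2]
    simp only [hG, polarNumerator, hB]
    rw [e1, entireZeta_of_ne n1, entireZeta_of_ne n2]
    ring
  have key := integral_sub_integral_eq_dslope (a := -δ) (b := 1 + δ) (p := 1 - v) (q := 1 + v)
    (F := fun s => mellin φ (2 * s) * (b : ℂ) ^ (1 - 2 * s) * estermann (u : ZMod c) v s)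
    (G := G) hp hq (fun s hs => DifferentiableAt.differentiableWithinAt
      ((h.differentiableAt_polarNumerator hs).add (DifferentiableAt.mul (by fun_prop) (hBd s hs))))
    hFG ?_ hi hi'
  · rw [hds, sub_eq_iff_eq_add] at key
    rw [key, mul_add, ← mul_assoc, ← mul_assoc, mul_comm _ (2 : ℂ), mul_assoc (2 : ℂ),
      inv_mul_cancel₀ hpi, mul_one]
  · have hcpow : ExpGrowth (-δ) (1 + δ) fun s => (b : ℂ) ^ (1 - 2 * s) := by
      refine ((ExpGrowth.const _ _ (b : ℂ)).mul ((ExpGrowth.cpow_neg hb').mul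
        (ExpGrowth.cpow_neg hb'))).congr' (Eventually.of_forall fun s => ?_)
      simp only
      rw [← Complex.cpow_add _ _ hb', show 1 - 2 * s = 1 + (-s + -s) by ring,
        Complex.cpow_add 1 _ hb', Complex.cpow_one]
    exact (h.expGrowth.mul hcpow).mul (ExpGrowth.estermann _ _)

end

end TestFunction

/-! ### From the stated hypotheses to the formula. -/

theorem exists_testFunction {φ : ℝ → ℂ} (hφ : ContinuousOn φ (Ioi 0))
    {σ₀ σ₁ : ℝ} (hσ₀ : σ₀ < 0) (hσ₁ : 1 < σ₁)
    (hconv : ∀ s : ℂ, σ₀ < s.re → s.re < σ₁ → MellinConvergent φ (2 * s))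
    (hreg : DifferentiableOn ℂ (fun s : ℂ => mellin φ (2 * s)) {s : ℂ | σ₀ < s.re ∧ s.re < σ₁})
    {ε : ℝ} (hε : 0 < ε)
    (hint : ∀ σ : ℝ, σ₀ < σ → σ < σ₁ →
      Integrable (fun t : ℝ =>
        ((1 + |t|) ^ (1 - 2 * σ + ε) + 1) * ‖mellin φ (2 * σ + 2 * Complex.I * t)‖)) :
    ∃ δ : ℝ, TestFunction φ δ := by
  obtain ⟨δ, hδ, hδ'⟩ : ∃ δ : ℝ, 0 < δ ∧ δ < min (1 / 4) (min (-σ₀) (σ₁ - 1)) :=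
    exists_between (lt_min (by norm_num) (lt_min (by linarith) (by linarith)))
  simp only [lt_min_iff] at hδ'
  have hopen : IsOpen {s : ℂ | σ₀ < s.re ∧ s.re < σ₁} :=
    (isOpen_lt continuous_const Complex.continuous_re).inter
      (isOpen_lt Complex.continuous_re continuous_const)
  have hmem : ∀ s ∈ closedStrip (-δ) (1 + δ), σ₀ < s.re ∧ s.re < σ₁ := fun s hs =>
    ⟨by linarith [hs.1], by linarith [hs.2]⟩
  have hd : ∀ s ∈ closedStrip (-δ) (1 + δ),
      DifferentiableAt ℂ (fun s : ℂ => mellin φ (2 * s)) s := fun s hs =>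
    (hreg s (hmem s hs)).differentiableAt (hopen.mem_nhds (hmem s hs))
  have hline : ∀ σ : ℝ, -δ ≤ σ → σ ≤ 1 + δ → Continuous fun t : ℝ =>
      mellin φ (2 * (σ + t * Complex.I)) := fun σ h1 h2 => continuous_iff_continuousAt.mpr fun t =>
    ContinuousAt.comp (g := fun s : ℂ => mellin φ (2 * s))
      (f := fun t : ℝ => (σ + t * Complex.I : ℂ))
      (hd _ (TestFunction.line_mem h1 h2 t)).continuousAt (by fun_prop)
  have harg : ∀ σ t : ℝ, (2 * σ + 2 * Complex.I * t : ℂ) = 2 * (σ + t * Complex.I) :=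
    fun σ t => by ring
  refine ⟨δ, hφ, hδ, hδ'.1.le, fun s hs => hconv s (hmem s hs).1 (hmem s hs).2, hd, ?_, ?_⟩
  · intro σ h1 h2
    refine (hint σ (by linarith) (by linarith)).mono' (hline σ h1 h2).aestronglyMeasurable
      (Eventually.of_forall fun t => ?_)
    rw [harg]
    refine le_mul_of_one_le_left (norm_nonneg _) ?_
    have : 0 ≤ (1 + |t|) ^ (1 - 2 * σ + ε) := by positivity
    linarith
  · refine (hint (-δ) (by linarith) (by linarith)).mono' (Continuous.aestronglyMeasurable ?_)
      (Eventually.of_forall fun t => ?_)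
    · refine Continuous.mul ?_ (hline (-δ) le_rfl (by linarith)).norm
      exact Continuous.rpow_const (by fun_prop) fun t => Or.inl (by positivity)
    · rw [harg, norm_mul, norm_norm, Real.norm_of_nonneg (by positivity)]
      gcongr
      -- At `σ = -δ` the given weight covers `1 + 2δ`, the growth exponent of `Γ(w-v) Γ(w+v)` on the
      -- reflected line `Re w = 1 + δ`.
      have h1 : (1 + |t|) ^ (1 + 2 * δ) ≤ (1 + |t|) ^ (1 - 2 * -δ + ε) :=
        Real.rpow_le_rpow_of_exponent_le (by linarith [abs_nonneg t]) (by linarith)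
      linarith

theorem stdAddChar_intCast {c : ℕ} [NeZero c] (j : ℤ) :
    ZMod.stdAddChar (j : ZMod c) = e ((j : ℝ) / c) := by
  rw [ZMod.stdAddChar_coe, e]
  push_cast
  ring_nf

theorem exists_unit_eq {c d : ℕ} (hcd : Nat.Coprime c d) {d' : ℤ}
    (hd' : (d : ℤ) * d' ≡ 1 [ZMOD c]) :
    ∃ u : (ZMod c)ˣ, (u : ZMod c) = d ∧ ((u⁻¹ : (ZMod c)ˣ) : ZMod c) = d' := by
  refine ⟨ZMod.unitOfCoprime d hcd.symm, ZMod.coe_unitOfCoprime d hcd.symm, ?_⟩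
  have h := (ZMod.intCast_eq_intCast_iff _ _ c).mpr hd'
  push_cast at h
  rw [Units.inv_eq_of_mul_eq_one_right]
  rw [ZMod.coe_unitOfCoprime, h]

theorem tendsto_k₀ {δ : ℝ} (hδ : 0 < δ) (hδ' : δ ≤ 1 / 4) {x : ℝ} (hx : 0 < x) :
    Tendsto (fun w : ℂ => k₀ x w) (𝓝[≠] 0)
      (𝓝 ((2 * Real.pi ^ 2 : ℂ)⁻¹ * kernelIntegral δ 0 (x / 2))) := by
  refine (((tendsto_kernelIntegral hδ hδ' (half_pos hx)).mono_left nhdsWithin_le_nhds).const_mul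
    (2 * Real.pi ^ 2 : ℂ)⁻¹).congr' ?_
  have h1 : ∀ᶠ v : ℂ in 𝓝[≠] 0, |v.re| < δ / 2 :=
    ((by fun_prop : Continuous fun v : ℂ => |v.re|).tendsto 0 |>.eventually_lt_const
      (by simpa using by positivity)).filter_mono nhdsWithin_le_nhds
  filter_upwards [h1, self_mem_nhdsWithin] with v hv hv0
  exact (k₀_eq_kernelIntegral hδ hδ' hv.le hv0 hx).symm

end Voronoi

theorem mainTheorem10
    (φ : ℝ → ℂ) (hφ : ContinuousOn φ (Ioi 0))
    (σ₀ σ₁ : ℝ) (hσ₀ : σ₀ < 0) (hσ₁ : 1 < σ₁)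
    (hconv : ∀ s : ℂ, σ₀ < s.re → s.re < σ₁ → MellinConvergent φ (2 * s))
    (hreg : DifferentiableOn ℂ (fun s : ℂ => mellin φ (2 * s)) {s : ℂ | σ₀ < s.re ∧ s.re < σ₁})
    (ε : ℝ) (hε : 0 < ε)
    (hint : ∀ σ : ℝ, σ₀ < σ → σ < σ₁ →
      Integrable (fun t : ℝ =>
        ((1 + |t|) ^ (1 - 2 * σ + ε) + 1) * ‖mellin φ (2 * σ + 2 * Complex.I * t)‖))
    (v : ℂ) (hv : v.re = 0)
    (c d : ℕ) (hc : 1 ≤ c) (hd : 1 ≤ d) (hcd : Nat.Coprime c d)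
    (d' : ℤ) (hd' : (d : ℤ) * d' ≡ 1 [ZMOD c]) :
    -- absolute convergence of the left-hand series
    (Summable fun n : ℕ+ =>
      Voronoi.tau v n * Voronoi.e (n * d / c) * φ (4 * Real.pi * √(n : ℝ) / c)) ∧
    -- the case `v ≠ 0`
    (v ≠ 0 →
      (∀ n : ℕ+, IntegrableOn (fun x : ℝ =>
        (Voronoi.e (-(n * d' / c)) * Voronoi.k₀ (x * √(n : ℝ)) v +
          Voronoi.e (n * d' / c) * Voronoi.k₁ (x * √(n : ℝ)) v) * φ x * x) (Ioi 0)) ∧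
      (Summable fun n : ℕ+ => Voronoi.tau v n * ∫ x in Ioi (0 : ℝ),
        (Voronoi.e (-(n * d' / c)) * Voronoi.k₀ (x * √(n : ℝ)) v +
          Voronoi.e (n * d' / c) * Voronoi.k₁ (x * √(n : ℝ)) v) * φ x * x) ∧
      4 * Real.pi / c * ∑' n : ℕ+,
          Voronoi.tau v n * Voronoi.e (n * d / c) * φ (4 * Real.pi * √(n : ℝ) / c) =
        Voronoi.polarTerms φ v +
        ∑' n : ℕ+, Voronoi.tau v n * ∫ x in Ioi (0 : ℝ),
          (Voronoi.e (-(n * d' / c)) * Voronoi.k₀ (x * √(n : ℝ)) v +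
            Voronoi.e (n * d' / c) * Voronoi.k₁ (x * √(n : ℝ)) v) * φ x * x) ∧
    -- the case `v = 0`: the polar terms and the kernel `k₀` are read as their limits at `0`
    (v = 0 →
      ∃ (P : ℂ) (κ : ℝ → ℂ),
        Tendsto (fun w : ℂ => Voronoi.polarTerms φ w) (𝓝[≠] 0) (𝓝 P) ∧
        (∀ x : ℝ, 0 < x → Tendsto (fun w : ℂ => Voronoi.k₀ x w) (𝓝[≠] 0) (𝓝 (κ x))) ∧
        (∀ n : ℕ+, IntegrableOn (fun x : ℝ =>
          (Voronoi.e (-(n * d' / c)) * κ (x * √(n : ℝ)) +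
            Voronoi.e (n * d' / c) * Voronoi.k₁ (x * √(n : ℝ)) v) * φ x * x) (Ioi 0)) ∧
        (Summable fun n : ℕ+ => Voronoi.tau v n * ∫ x in Ioi (0 : ℝ),
          (Voronoi.e (-(n * d' / c)) * κ (x * √(n : ℝ)) +
            Voronoi.e (n * d' / c) * Voronoi.k₁ (x * √(n : ℝ)) v) * φ x * x) ∧
        4 * Real.pi / c * ∑' n : ℕ+,
            Voronoi.tau v n * Voronoi.e (n * d / c) * φ (4 * Real.pi * √(n : ℝ) / c) =
          P +
          ∑' n : ℕ+, Voronoi.tau v n * ∫ x in Ioi (0 : ℝ),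
            (Voronoi.e (-(n * d' / c)) * κ (x * √(n : ℝ)) +
              Voronoi.e (n * d' / c) * Voronoi.k₁ (x * √(n : ℝ)) v) * φ x * x) := by
  have : NeZero c := ⟨by omega⟩
  have hcr : (0 : ℝ) < c := by exact_mod_cast hc
  have hb : 0 < 4 * Real.pi / c := by positivity
  obtain ⟨δ, h⟩ := Voronoi.exists_testFunction hφ hσ₀ hσ₁ hconv hreg hε hint
  obtain ⟨u, hu, hu'⟩ := Voronoi.exists_unit_eq hcd hd'
  have hLe : ∀ n : ℕ+, Voronoi.e (n * d / c) =
      ZMod.stdAddChar ((u : ZMod c) * ((n : ℕ) : ZMod c)) := fun n => by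
    rw [hu, show ((d : ZMod c) * ((n : ℕ) : ZMod c)) = (((n : ℕ) * d : ℤ) : ZMod c) by
      push_cast; ring, Voronoi.stdAddChar_intCast]
    push_cast
    rfl
  have hRe : ∀ n : ℕ+, Voronoi.e (n * d' / c) =
      ZMod.stdAddChar (((u⁻¹ : (ZMod c)ˣ) : ZMod c) * ((n : ℕ) : ZMod c)) := fun n => by
    rw [hu', show ((d' : ZMod c) * ((n : ℕ) : ZMod c)) = (((n : ℕ) * d' : ℤ) : ZMod c) by
      push_cast; ring, Voronoi.stdAddChar_intCast]
    push_cast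
    rfl
  have hRe' : ∀ n : ℕ+, Voronoi.e (-(n * d' / c)) =
      ZMod.stdAddChar (-((u⁻¹ : (ZMod c)ˣ) : ZMod c) * ((n : ℕ) : ZMod c)) := fun n => by
    rw [hu', show (-(d' : ZMod c) * ((n : ℕ) : ZMod c)) = ((-((n : ℕ) * d') : ℤ) : ZMod c) by
      push_cast; ring, Voronoi.stdAddChar_intCast, ← neg_div]
    push_cast
    rfl
  have hφn : ∀ n : ℕ+, φ (4 * Real.pi * √(n : ℝ) / c) = φ (4 * Real.pi / c * √(n : ℝ)) :=
    fun n => by rw [mul_div_right_comm]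
  have hbc : ((4 * Real.pi / c : ℝ) : ℂ) = 4 * Real.pi / c := by push_cast; rfl
  simp only [hLe, hRe, hRe', hφn]
  have hL := h.hasSum_tau_mul hv (u : ZMod c) hb
  obtain ⟨hR1, hR2, -⟩ := h.hasSum_tau_mul_integral hv u
  have hshift := h.estermann_shift hv u
  have hb' : ((4 * Real.pi / c : ℝ) : ℂ) ≠ 0 := by exact_mod_cast hb.ne'
  have hLs := (summable_mul_left_iff hb').mp hL.summable
  -- This identity holds for every imaginary `v`, zero included; the two cases differ only in how
  -- its divided difference and kernel are named.
  have hformula : 4 * Real.pi / c * ∑' n : ℕ+, Voronoi.tau v n *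
      ZMod.stdAddChar ((u : ZMod c) * ((n : ℕ) : ZMod c)) * φ (4 * Real.pi / c * √(n : ℝ)) =
      2 * dslope (Voronoi.polarNumerator φ v) (1 - v) (1 + v) + _ :=
    (by rw [← hbc, ← tsum_mul_left, hL.tsum_eq, hshift, ← hR2.tsum_eq])
  refine ⟨hLs, fun hv0 => ?_, fun hv0 => ?_⟩
  · have hk : ∀ (n : ℕ+), ∀ x ∈ Ioi (0 : ℝ), (2 * Real.pi ^ 2 : ℂ)⁻¹ *
        Voronoi.kernelIntegral δ v (x * √(n : ℝ) / 2) = Voronoi.k₀ (x * √(n : ℝ)) v :=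
      fun n x hx => (Voronoi.k₀_eq_kernelIntegral h.pos h.le
        (by rw [hv, abs_zero]; linarith [h.pos]) hv0
        (mul_pos hx (Real.sqrt_pos.mpr (by exact_mod_cast n.pos)))).symm
    have hi : ∀ n : ℕ+, ∫ x in Ioi (0 : ℝ),
        (ZMod.stdAddChar (-((u⁻¹ : (ZMod c)ˣ) : ZMod c) * ((n : ℕ) : ZMod c)) *
          ((2 * Real.pi ^ 2 : ℂ)⁻¹ * Voronoi.kernelIntegral δ v (x * √(n : ℝ) / 2)) +
        ZMod.stdAddChar (((u⁻¹ : (ZMod c)ˣ) : ZMod c) * ((n : ℕ) : ZMod c)) *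
          Voronoi.k₁ (x * √(n : ℝ)) v) * φ x * x = _ := fun n =>
      setIntegral_congr_fun measurableSet_Ioi fun x hx => by simp only [hk n x hx]; rfl
    rw [Voronoi.TestFunction.two_mul_dslope_polarNumerator hv0] at hformula
    simp only [hi] at hR2 hformula
    exact ⟨fun n => (hR1 n).congr_fun (fun x hx => by simp only [hk n x hx]) measurableSet_Ioi,
      hR2.summable, hformula⟩
  · subst hv0
    -- The limit of the polar terms is the double-pole residue, and that of `k₀` is the
    -- Mellin-Barnes integral at `v = 0`; both already stand in the formula.
    exact ⟨_, fun x => (2 * Real.pi ^ 2 : ℂ)⁻¹ * Voronoi.kernelIntegral δ 0 (x / 2),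
      h.tendsto_polarTerms, fun x hx => Voronoi.tendsto_k₀ h.pos h.le hx,
      hR1, hR2.summable, hformula⟩
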